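/- Let $d\ge 1$. For $x,y\in\mathbb R^d$ write $x\prec y$ (or $y\succ x$) if $x_j<y_j$ for $j=1,\dots,d$, say in this case that $x$ is dominated by $y$ (and that $y$ dominates $x$), and put $x_+=x_1+\dots+x_d$. A maximum of a set $S\subseteq\mathbb R^d$ is a point $z\in S$ such that $z\not\prec y$ for all $y\in S$; a minimum is a point $z\in S$ such that $z\not\succ y$ for all $y\in S$. For a sequence $X^{(1)},X^{(2)},\dots$ in $\mathbb R^d$, the observation $X^{(n)}$ sets a (record-large, Pareto) record if $X^{(n)}\not\prec X^{(i)}$ for all $1\le i<n$; the observation $X^{(j)}$, $j\le n$, is a current record at time $n$ if $X^{(j)}\not\prec X^{(i)}$ for all $1\le i\le n$. Let $K_n=-1$ if $X^{(n)}$ does not set a record; otherwise let $K_n$ be the number of $j<n$ such that $X^{(j)}$ is a current record at time $n-1$ but not at time $n$. For record-small values, replace $\prec$ by $\succ$ in these definitions. Then there is a probability law $\mathcal L(\mathcal K(d))$ on $\{0,1,2,\dots\}$ with the following properties. (1) If $X^{(1)},X^{(2)},\dots$ are i.i.d. with independent Exponential$(1)$ coordinates, then, for record-large values, $K_n$ conditionally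 given $K_n\ge 0$ converges in distribution to $\mathcal L(\mathcal K(d))$ as $n\to\infty$. Moreover $\mathcal L(\mathcal K(d))$ is the mixture $\mathbb E\,\mathcal L(\mathcal K_G)$, where $G$ has the standard Gumbel law (density $e^{-g}\exp(-e^{-g})$ on $\mathbb R$) and, for $g\in\mathbb R$ and $x=x(g)=(g/d,\dots,g/d)$, $\mathcal K_g$ is the (almost surely finite) number of maxima dominated by $x$ in a Poisson point process in $\mathbb R^d$ with intensity function $\mathbf 1(z\not\succ x)\,e^{-z_+}$, $z\in\mathbb R^d$. (2) If $X^{(1)},X^{(2)},\dots$ are i.i.d. and uniformly distributed in $(0,1)^d$, then, for record-small values, $K_n$ conditionally given $K_n\ge 0$ converges in distribution to the same law $\mathcal L(\mathcal K(d))$ as $n\to\infty$. Moreover $\mathcal L(\mathcal K(d))$ is the mixture $\mathbb E\,\mathcal L(\mathcal K'_W)$, where $W$ has the Exponential$(1)$ law and, for $w>0$ and $x'=x'(w)=(w^{1/d},\dots,w^{1/d})$, $\mathcal K'_w$ is the (almost surely finite) number of minima that dominate $x'$ in a homogeneous unit-rate Poisson point process in $\{z\in(0,\infty)^d: z\not\prec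 x'\}$. -/

import Mathlib

open MeasureTheory ProbabilityTheory Filter Topology
open scoped ENNReal NNReal

noncomputable section

namespace ParetoRecords

/-! ### Maxima and broken records

Mathlib's `StrongLT x y`, written `x ≺ y`, says that `x j < y j` for every coordinate `j`.
The notions below take the strict relation `r` as an argument: `r = StrongLT` gives maxima and
record-large values, `r = Function.swap StrongLT` gives minima and record-small values. -/

/-- `x` is a maximum of `S`: no point of `S` strictly dominates `x`. -/
def IsMaximum {E : Type*} (r : E → E → Prop) (S : Set E) (x : E) : Prop :=
  ∀ y ∈ S, ¬ r x y

/-- The number (possibly infinite) of maxima of `S` belonging to `S` that are dominated by `x`. -/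
def numMaximaBelow {E : Type*} (r : E → E → Prop) (S : Set E) (x : E) : ℕ∞ :=
  {z | z ∈ S ∧ IsMaximum r S z ∧ r z x}.encard

/-- Among the observations `X 0, X 1, …`, the observation `X n` sets a (Pareto) record. -/
def SetsRecord {E : Type*} (r : E → E → Prop) (X : ℕ → E) (n : ℕ) : Prop :=
  ∀ i < n, ¬ r (X n) (X i)

/-- `X j` is a current record when the `m` observations `X 0, …, X (m - 1)` have been made. -/
def IsCurrentRecord {E : Type*} (r : E → E → Prop) (X : ℕ → E) (m j : ℕ) : Prop :=
  j < m ∧ ∀ i < m, ¬ r (X j) (X i)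

open Classical in
/-- `-1` if `X n` does not set a record; otherwise the number of records killed by `X n`: the number
of earlier observations that are current records just before, but not just after, `X n` arrives.
(Observations are numbered from `0`, so that `X n` is the one preceded by `n` others.) -/
def numBroken {E : Type*} (r : E → E → Prop) (X : ℕ → E) (n : ℕ) : ℤ :=
  if SetsRecord r X n then
    (((Finset.range n).filter fun j =>
      IsCurrentRecord r X n j ∧ ¬ IsCurrentRecord r X (n + 1) j).card : ℤ)
  else -1

/-! ### Poisson point processes -/

/-- The random set `N` of points is a (simple) Poisson point process with intensity measure `ν`:
the number of points in any measurable set is a random variable; it is Poisson with mean `ν B` if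
`ν B` is finite; and the numbers of points in finitely many pairwise disjoint measurable sets of
finite intensity are independent. -/
structure IsPoissonProcess {E Ω : Type*} [MeasurableSpace E] [MeasurableSpace Ω]
    (N : Ω → Set E) (ν : Measure E) (P : Measure Ω) : Prop where
  measurable_count : ∀ B, MeasurableSet B → Measurable fun ω => (N ω ∩ B).encard
  law_count : ∀ B, MeasurableSet B → ν B ≠ ∞ →
    P.map (fun ω => (N ω ∩ B).encard) =
      (poissonMeasure (ν B).toNNReal).map (Nat.cast : ℕ → ℕ∞)
  indep_count : ∀ (m : ℕ) (B : Fin m → Set E), (∀ i, MeasurableSet (B i)) →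
    (∀ i, ν (B i) ≠ ∞) → Pairwise (Function.onFun Disjoint B) →
    iIndepFun (fun i ω => (N ω ∩ B i).encard) P

/-! Poisson point processes exist for every s-finite intensity measure without atoms: superpose
countably many finite processes, each made of a Poisson number of i.i.d. points. -/

section Existence

variable {E : Type} [MeasurableSpace E]

/-- Law of a Poisson number together with an i.i.d. sequence of points. -/
def blockMeasure (l : ℝ≥0) (ρ : Measure E) : Measure (ℕ × (ℕ → E)) :=
  (poissonMeasure l).prod (Measure.infinitePi fun _ : ℕ => ρ)

instance (l : ℝ≥0) (ρ : Measure E) [IsProbabilityMeasure ρ] :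
    IsProbabilityMeasure (blockMeasure l ρ) := by
  unfold blockMeasure; infer_instance

theorem measurable_blockProd (f : E → ℂ) (hf : Measurable f) :
    Measurable fun b : ℕ × (ℕ → E) => ∏ i ∈ Finset.range b.1, f (b.2 i) := by
  refine measurable_from_prod_countable_right fun n => ?_
  simp only
  fun_prop

theorem integral_blockProd (l : ℝ≥0) (ρ : Measure E) [IsProbabilityMeasure ρ] (f : E → ℂ)
    (hf : Measurable f) (hb : ∀ x, ‖f x‖ ≤ 1) :
    ∫ b, ∏ i ∈ Finset.range b.1, f (b.2 i) ∂(blockMeasure l ρ) =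
      Complex.exp (l * (∫ x, f x ∂ρ - 1)) := by
  have hint : Integrable (fun b : ℕ × (ℕ → E) => ∏ i ∈ Finset.range b.1, f (b.2 i))
      (blockMeasure l ρ) := by
    refine Integrable.of_bound (measurable_blockProd f hf).aestronglyMeasurable 1 ?_
    refine Eventually.of_forall fun b => ?_
    rw [norm_prod]
    exact Finset.prod_le_one (fun _ _ => norm_nonneg _) fun _ _ => hb _
  unfold blockMeasure at hint ⊢
  rw [integral_prod _ hint]
  have h1 : ∀ n : ℕ, ∫ y, ∏ i ∈ Finset.range n, f (y i) ∂(Measure.infinitePi fun _ : ℕ => ρ) =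
      (∫ x, f x ∂ρ) ^ n := by
    intro n
    have hind := (iIndepFun_infinitePi (P := fun _ : ℕ => ρ) (X := fun _ => f)
      (fun _ => hf)).precomp (g := fun i : Fin n => (i : ℕ)) Fin.val_injective
    have := hind.integral_fun_prod_eq_prod_integral
      (fun i => (hf.comp (measurable_pi_apply _)).aestronglyMeasurable)
    rw [Finset.prod_congr rfl fun (i : Fin n) _ =>
      show _ = ∫ x, f x ∂ρ from by
        conv_rhs => rw [← Measure.infinitePi_map_eval (fun _ : ℕ => ρ) i]
        rw [integral_map (measurable_pi_apply _).aemeasurable hf.aestronglyMeasurable]] at this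
    simpa [Finset.prod_range] using this
  simp_rw [h1]
  rw [integral_poissonMeasure]
  set r := ∫ x, f x ∂ρ
  calc ∑' n : ℕ, (Real.exp (-l) * l ^ n / n.factorial : ℝ) • r ^ n
      = ∑' n : ℕ, (Real.exp (-l) : ℂ) * ((l * r) ^ n / n.factorial) := by
        congr with n
        rw [Complex.real_smul]
        push_cast
        ring
    _ = Real.exp (-l) * Complex.exp (l * r) := by
        rw [tsum_mul_left, (NormedSpace.expSeries_div_hasSum_exp (l * r : ℂ)).tsum_eq,
          Complex.exp_eq_exp_ℂ]
    _ = _ := by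
        rw [Complex.ofReal_exp, ← Complex.exp_add]
        push_cast
        ring_nf

theorem lintegral_blockSum (l : ℝ≥0) (ρ : Measure E) [IsProbabilityMeasure ρ] (f : E → ℝ≥0∞)
    (hf : Measurable f) :
    ∫⁻ b, ∑ i ∈ Finset.range b.1, f (b.2 i) ∂(blockMeasure l ρ) = l * ∫⁻ x, f x ∂ρ := by
  have hm : Measurable fun b : ℕ × (ℕ → E) => ∑ i ∈ Finset.range b.1, f (b.2 i) := by
    refine measurable_from_prod_countable_right fun n => ?_
    simp only
    fun_prop
  unfold blockMeasure
  rw [lintegral_prod _ hm.aemeasurable]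
  have h1 : ∀ n : ℕ, ∫⁻ y, ∑ i ∈ Finset.range n, f (y i) ∂(Measure.infinitePi fun _ : ℕ => ρ) =
      n * ∫⁻ x, f x ∂ρ := by
    intro n
    rw [lintegral_finsetSum _ (fun i _ => by fun_prop)]
    rw [Finset.sum_congr rfl fun (i : ℕ) _ =>
      show _ = ∫⁻ x, f x ∂ρ from by
        conv_rhs => rw [← Measure.infinitePi_map_eval (fun _ : ℕ => ρ) i]
        rw [lintegral_map hf (by fun_prop)]]
    simp
  simp_rw [h1]
  rw [lintegral_mul_const _ (by fun_prop)]
  congr 1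
  rw [lintegral_countable']
  simp_rw [poissonMeasure_singleton]
  rw [tsum_eq_zero_add' ENNReal.summable]
  simp only [Nat.cast_zero, zero_mul, zero_add]
  have h2 : ∀ n : ℕ, ((n + 1 : ℕ) : ℝ≥0∞) *
      ENNReal.ofReal (Real.exp (-l) * l ^ (n + 1) / (n + 1).factorial) =
      l * (poissonMeasure l {n}) := by
    intro n
    rw [poissonMeasure_singleton, ← ENNReal.ofReal_natCast, ← ENNReal.ofReal_mul (by positivity),
      ← ENNReal.ofReal_coe_nnreal, ← ENNReal.ofReal_mul (by positivity), Nat.factorial_succ]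
    congr 1
    have : ((n : ℝ) + 1) ≠ 0 := by positivity
    have : (n.factorial : ℝ) ≠ 0 := by positivity
    push_cast
    field_simp
    ring
  simp_rw [h2]
  rw [ENNReal.tsum_mul_left]
  have : ∑' n : ℕ, poissonMeasure l {n} = 1 := by
    have := lintegral_countable' (μ := poissonMeasure l) (fun _ => 1)
    simpa using this.symm
  rw [this, mul_one]


/-- Number of points in `B` (with multiplicity). -/
def mcount (B : Set E) (ω : ℕ → ℕ × (ℕ → E)) : ℝ≥0∞ :=
  ∑' k, ∑ i ∈ Finset.range (ω k).1, B.indicator 1 ((ω k).2 i)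

theorem measurable_blockSum (f : E → ℝ≥0∞) (hf : Measurable f) :
    Measurable fun b : ℕ × (ℕ → E) => ∑ i ∈ Finset.range b.1, f (b.2 i) := by
  refine measurable_from_prod_countable_right fun n => ?_
  simp only
  fun_prop

theorem measurable_mcount (B : Set E) (hB : MeasurableSet B) :
    Measurable (mcount B) := by
  refine Measurable.tsum fun k => ?_
  exact (measurable_blockSum (B.indicator 1) (measurable_one.indicator hB)).comp
    (measurable_pi_apply k)

variable (l : ℕ → ℝ≥0) (ρ : ℕ → Measure E) [∀ k, IsProbabilityMeasure (ρ k)]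

theorem lintegral_mcount (B : Set E) (hB : MeasurableSet B) :
    ∫⁻ ω, mcount B ω ∂(Measure.infinitePi fun k => blockMeasure (l k) (ρ k)) =
      (Measure.sum fun k => l k • ρ k) B := by
  have hi : Measurable (B.indicator (1 : E → ℝ≥0∞)) := measurable_one.indicator hB
  unfold mcount
  rw [lintegral_tsum (f := fun k (ω : ℕ → ℕ × (ℕ → E)) =>
      ∑ i ∈ Finset.range (ω k).1, B.indicator 1 ((ω k).2 i))
      fun k => ((measurable_blockSum _ hi).comp (measurable_pi_apply k)).aemeasurable,
    Measure.sum_apply _ hB]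
  congr with k
  rw [Measure.smul_apply, ← lintegral_indicator_one hB]
  rw [← lintegral_map (f := fun b : ℕ × (ℕ → E) => ∑ i ∈ Finset.range b.1, B.indicator 1 (b.2 i))
    (g := fun ω : ℕ → ℕ × (ℕ → E) => ω k) (measurable_blockSum _ hi) (by fun_prop),
    Measure.infinitePi_map_eval, lintegral_blockSum _ _ _ hi]
  rfl

theorem ae_mcount_lt_top (B : Set E) (hB : MeasurableSet B)
    (hfin : (Measure.sum fun k => l k • ρ k) B ≠ ∞) :
    ∀ᵐ ω ∂(Measure.infinitePi fun k => blockMeasure (l k) (ρ k)), mcount B ω < ∞ :=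
  ae_lt_top (measurable_mcount B hB) (by rwa [lintegral_mcount l ρ B hB])

theorem integral_prod_blocks (f : E → ℂ) (hf : Measurable f) (hb : ∀ x, ‖f x‖ ≤ 1) (n : ℕ) :
    ∫ ω, ∏ k ∈ Finset.range n, ∏ i ∈ Finset.range (ω k).1, f ((ω k).2 i)
      ∂(Measure.infinitePi fun k => blockMeasure (l k) (ρ k)) =
      Complex.exp (∑ k ∈ Finset.range n, l k * (∫ x, f x ∂(ρ k) - 1)) := by
  have hm := measurable_blockProd f hf
  have hind := (iIndepFun_infinitePi (P := fun k => blockMeasure (l k) (ρ k))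
    (X := fun _ b => ∏ i ∈ Finset.range b.1, f (b.2 i)) (fun _ => hm)).precomp
      (g := fun i : Fin n => (i : ℕ)) Fin.val_injective
  have := hind.integral_fun_prod_eq_prod_integral
    (fun i => (hm.comp (measurable_pi_apply _)).aestronglyMeasurable)
  rw [Finset.prod_congr rfl fun (k : Fin n) _ =>
    show _ = Complex.exp (l k * (∫ x, f x ∂(ρ k) - 1)) from by
      rw [← integral_blockProd _ _ f hf hb]
      conv_rhs => rw [← Measure.infinitePi_map_eval (fun k => blockMeasure (l k) (ρ k)) k]
      rw [integral_map (measurable_pi_apply _).aemeasurable hm.aestronglyMeasurable]] at this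
  rw [Complex.exp_sum, Finset.prod_range, ← this]
  simp [Finset.prod_range]

/-- Joint characteristic function of the counts. -/
theorem integral_exp_mcount {m : ℕ} (B : Fin m → Set E) (hB : ∀ j, MeasurableSet (B j))
    (hfin : ∀ j, (Measure.sum fun k => l k • ρ k) (B j) ≠ ∞)
    (hdis : Pairwise (Function.onFun Disjoint B)) (t : Fin m → ℝ) :
    ∫ ω, Complex.exp (∑ j, (mcount (B j) ω).toReal * t j * Complex.I)
      ∂(Measure.infinitePi fun k => blockMeasure (l k) (ρ k)) =
      ∏ j, Complex.exp (((Measure.sum fun k => l k • ρ k) (B j)).toNNReal *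
        (Complex.exp (t j * Complex.I) - 1)) := by
  set P := Measure.infinitePi fun k => blockMeasure (l k) (ρ k) with hP
  set ν := Measure.sum fun k => l k • ρ k with hν
  let c : Fin m → ℂ := fun j => Complex.exp (t j * Complex.I)
  let f : E → ℂ := fun x => Complex.exp (∑ j, (B j).indicator (fun _ => (t j : ℂ) * Complex.I) x)
  have hfm : Measurable f := by
    refine Complex.measurable_exp.comp (Finset.measurable_sum _ fun j _ => ?_)
    exact measurable_const.indicator (hB j)
  have hfb : ∀ x, ‖f x‖ ≤ 1 := by
    intro x
    have : ∑ j, (B j).indicator (fun _ => (t j : ℂ) * Complex.I) x =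
        ((∑ j, (B j).indicator (fun _ => t j) x : ℝ) : ℂ) * Complex.I := by
      push_cast
      rw [Finset.sum_mul]
      refine Finset.sum_congr rfl fun j _ => ?_
      by_cases h : x ∈ B j <;> simp [h]
    simp only [f]
    rw [this, Complex.norm_exp_ofReal_mul_I]
  have hf1 : ∀ x, f x = 1 + ∑ j, (B j).indicator (fun _ => c j - 1) x := by
    intro x
    by_cases h : ∃ j, x ∈ B j
    · obtain ⟨j, hj⟩ := h
      have hne : ∀ i, i ≠ j → x ∉ B i := fun i hij hi =>
        Set.disjoint_left.1 (hdis hij) hi hj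
      simp only [f]
      rw [Finset.sum_eq_single j (fun i _ hi => by simp [hne i hi]) (by simp),
        Finset.sum_eq_single j (fun i _ hi => by simp [hne i hi]) (by simp)]
      simp [hj, c]
    · push Not at h
      simp [f, h]
  have hint : ∀ k, ∫ x, f x ∂(ρ k) - 1 = ∑ j, (ρ k).real (B j) * (c j - 1) := by
    intro k
    simp_rw [hf1]
    rw [integral_add (integrable_const _) (integrable_finsetSum _ fun j _ =>
      (integrable_const _).indicator (hB j)), integral_finsetSum _ fun j _ =>
      (integrable_const _).indicator (hB j)]
    simp [integral_indicator_const, hB]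
  -- partial sums
  let R : ℕ → Fin m → (ℕ → ℕ × (ℕ → E)) → ℝ := fun n j ω =>
    ∑ k ∈ Finset.range n, ∑ i ∈ Finset.range (ω k).1, (B j).indicator (fun _ => (1 : ℝ)) ((ω k).2 i)
  have hRf : ∀ n ω, ∏ k ∈ Finset.range n, ∏ i ∈ Finset.range (ω k).1, f ((ω k).2 i) =
      Complex.exp (∑ j, R n j ω * t j * Complex.I) := by
    intro n ω
    simp only [f, ← Complex.exp_sum]
    congr 1
    simp only [R]
    push_cast
    simp only [Finset.sum_mul]
    rw [Finset.sum_comm]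
    refine Finset.sum_congr rfl fun k _ => ?_
    rw [Finset.sum_comm]
    refine Finset.sum_congr rfl fun j _ => Finset.sum_congr rfl fun i _ => ?_
    by_cases h : (ω k).2 i ∈ B j <;> simp [h]
  have hval : ∀ n, ∫ ω, Complex.exp (∑ j, R n j ω * t j * Complex.I) ∂P =
      Complex.exp (∑ j, (∑ k ∈ Finset.range n, (l k * (ρ k).real (B j) : ℝ) : ℝ) * (c j - 1)) := by
    intro n
    simp_rw [← hRf]
    rw [integral_prod_blocks l ρ f hfm hfb]
    congr 1
    push_cast
    simp_rw [hint, Finset.sum_mul, Finset.mul_sum]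
    rw [Finset.sum_comm]
    refine Finset.sum_congr rfl fun k _ => Finset.sum_congr rfl fun j _ => ?_
    ring
  have hνlim : ∀ j, Tendsto (fun n => ∑ k ∈ Finset.range n, (l k * (ρ k).real (B j) : ℝ)) atTop
      (𝓝 (ν (B j)).toReal) := by
    intro j
    have h1 : ν (B j) = ∑' k, (l k : ℝ≥0∞) * ρ k (B j) := by
      rw [hν, Measure.sum_apply _ (hB j)]; rfl
    have h2 := (ENNReal.tendsto_toReal (hfin j)).comp
      (h1 ▸ ENNReal.tendsto_nat_tsum fun k => (l k : ℝ≥0∞) * ρ k (B j))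
    refine h2.congr fun n => ?_
    simp only [Function.comp]
    rw [ENNReal.toReal_sum fun k _ => ENNReal.mul_ne_top (by simp) (measure_ne_top _ _)]
    simp [measureReal_def]
  have hRlim : ∀ᵐ ω ∂P, ∀ j, Tendsto (fun n => R n j ω) atTop (𝓝 (mcount (B j) ω).toReal) := by
    rw [ae_all_iff]
    intro j
    filter_upwards [ae_mcount_lt_top l ρ (B j) (hB j) (hfin j)] with ω hω
    have h2 := (ENNReal.tendsto_toReal hω.ne).comp
      (ENNReal.tendsto_nat_tsum fun k =>
        ∑ i ∈ Finset.range (ω k).1, (B j).indicator (1 : E → ℝ≥0∞) ((ω k).2 i))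
    refine h2.congr fun n => ?_
    simp only [Function.comp, R]
    have hne : ∀ x, (B j).indicator (1 : E → ℝ≥0∞) x ≠ ∞ := fun x => by
      by_cases h : x ∈ B j <;> simp [h]
    rw [ENNReal.toReal_sum fun k _ => ENNReal.sum_ne_top.2 fun i _ => hne _]
    refine Finset.sum_congr rfl fun k _ => ?_
    rw [ENNReal.toReal_sum fun i _ => hne _]
    refine Finset.sum_congr rfl fun i _ => ?_
    by_cases h : (ω k).2 i ∈ B j <;> simp [h]
  have hL : Tendsto (fun n => ∫ ω, Complex.exp (∑ j, R n j ω * t j * Complex.I) ∂P) atTop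
      (𝓝 (∫ ω, Complex.exp (∑ j, (mcount (B j) ω).toReal * t j * Complex.I) ∂P)) := by
    refine tendsto_integral_of_dominated_convergence (fun _ => 1) (fun n => ?_)
      (integrable_const _) (fun n => ?_) ?_
    · simp_rw [← hRf]
      refine (Finset.measurable_prod _ fun k _ => ?_).aestronglyMeasurable
      exact (measurable_blockProd f hfm).comp (measurable_pi_apply k)
    · refine Eventually.of_forall fun ω => ?_
      rw [← hRf, norm_prod]
      refine Finset.prod_le_one (fun _ _ => norm_nonneg _) fun k _ => ?_
      rw [norm_prod]
      exact Finset.prod_le_one (fun _ _ => norm_nonneg _) fun _ _ => hfb _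
    · filter_upwards [hRlim] with ω hω
      refine (Complex.continuous_exp.tendsto _).comp (tendsto_finsetSum _ fun j _ => ?_)
      exact (((Complex.continuous_ofReal.tendsto _).comp (hω j)).mul_const _).mul_const _
  have hR : Tendsto (fun n => ∫ ω, Complex.exp (∑ j, R n j ω * t j * Complex.I) ∂P) atTop
      (𝓝 (Complex.exp (∑ j, ((ν (B j)).toReal : ℝ) * (c j - 1)))) := by
    simp_rw [hval]
    refine (Complex.continuous_exp.tendsto _).comp (tendsto_finsetSum _ fun j _ => ?_)
    exact ((Complex.continuous_ofReal.tendsto _).comp (hνlim j)).mul_const _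
  rw [tendsto_nhds_unique hL hR, Complex.exp_sum]
  rfl

theorem map_mcount (B : Set E) (hB : MeasurableSet B)
    (hfin : (Measure.sum fun k => l k • ρ k) B ≠ ∞) :
    (Measure.infinitePi fun k => blockMeasure (l k) (ρ k)).map (fun ω => (mcount B ω).toReal) =
      (poissonMeasure ((Measure.sum fun k => l k • ρ k) B).toNNReal).map (Nat.cast : ℕ → ℝ) := by
  have hm := (measurable_mcount B hB).ennreal_toReal
  have := Measure.isProbabilityMeasure_map
    (μ := Measure.infinitePi fun k => blockMeasure (l k) (ρ k)) hm.aemeasurable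
  apply Measure.ext_of_charFun
  ext t
  rw [charFun_map_cast_poissonMeasure, charFun_apply, integral_map hm.aemeasurable (by fun_prop)]
  have := integral_exp_mcount l ρ (fun _ : Fin 1 => B) (fun _ => hB) (fun _ => hfin)
    (Subsingleton.pairwise) (fun _ => t)
  simp only [Finset.univ_unique, Finset.sum_singleton, Finset.prod_singleton] at this
  rw [← this]
  simp [mul_comm]

theorem iIndepFun_mcount {m : ℕ} (B : Fin m → Set E) (hB : ∀ j, MeasurableSet (B j))
    (hfin : ∀ j, (Measure.sum fun k => l k • ρ k) (B j) ≠ ∞)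
    (hdis : Pairwise (Function.onFun Disjoint B)) :
    iIndepFun (fun j ω => (mcount (B j) ω).toReal)
      (Measure.infinitePi fun k => blockMeasure (l k) (ρ k)) := by
  have hm := fun j => (measurable_mcount (B j) (hB j)).ennreal_toReal
  rw [iIndepFun_iff_charFun_pi fun j => (hm j).aemeasurable]
  intro t
  have h1 : ∀ j, charFun ((Measure.infinitePi fun k => blockMeasure (l k) (ρ k)).map
      (fun ω => (mcount (B j) ω).toReal)) (t j) = _ := fun j => by
    rw [map_mcount l ρ (B j) (hB j) (hfin j), charFun_map_cast_poissonMeasure]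
  rw [Finset.prod_congr rfl fun j _ => h1 j, ← integral_exp_mcount l ρ B hB hfin hdis t,
    charFun_apply, integral_map (φ := fun ω => WithLp.toLp 2 fun x => (mcount (B x) ω).toReal)
      ((WithLp.measurable_toLp 2 _).comp (measurable_pi_lambda _ hm)).aemeasurable (by fun_prop)]
  congr with ω
  simp [PiLp.inner_apply, Finset.mul_sum, mul_comm]


theorem indepFun_ae_ne {Ω : Type} [MeasurableSpace Ω] {P : Measure Ω} [IsProbabilityMeasure P]
    [MeasurableEq E] {U V : Ω → E} (hU : Measurable U) (hV : Measurable V) (h : IndepFun U V P)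
    (hn : ∀ x, P.map V {x} = 0) : ∀ᵐ ω ∂P, U ω ≠ V ω := by
  have hd : MeasurableSet {p : E × E | p.1 = p.2} := measurableSet_diagonal
  have h1 := (indepFun_iff_map_prod_eq_prod_map_map hU.aemeasurable hV.aemeasurable).1 h
  have h2 : P.map (fun ω => (U ω, V ω)) {p : E × E | p.1 = p.2} = 0 := by
    rw [h1, Measure.prod_apply hd]
    simp only [Set.preimage_ofPred_eq, Set.ofPred_eq_eq_singleton', hn, lintegral_zero]
  rw [Measure.map_apply (hU.prodMk hV) hd] at h2
  rw [ae_iff]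
  simpa using h2

theorem map_coord (k i : ℕ) :
    (Measure.infinitePi fun k => blockMeasure (l k) (ρ k)).map (fun ω => (ω k).2 i) = ρ k := by
  have h1 := measurePreserving_eval_infinitePi (fun k => blockMeasure (l k) (ρ k)) k
  have h2 : MeasurePreserving Prod.snd (blockMeasure (l k) (ρ k))
    (Measure.infinitePi fun _ : ℕ => ρ k) := measurePreserving_snd
  have h3 := measurePreserving_eval_infinitePi (fun _ : ℕ => ρ k) i
  exact (h3.comp (h2.comp h1)).map_eq

theorem ae_ne [MeasurableEq E] (hρ : ∀ k x, ρ k {x} = 0) (k i k' i' : ℕ)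
    (h : (k, i) ≠ (k', i')) :
    ∀ᵐ ω ∂(Measure.infinitePi fun k => blockMeasure (l k) (ρ k)), (ω k).2 i ≠ (ω k').2 i' := by
  by_cases hk : k = k'
  · subst hk
    have hi : i ≠ i' := fun hi => h (by rw [hi])
    have h1 := measurePreserving_eval_infinitePi (fun k => blockMeasure (l k) (ρ k)) k
    have h2 : MeasurePreserving Prod.snd (blockMeasure (l k) (ρ k))
      (Measure.infinitePi fun _ : ℕ => ρ k) := measurePreserving_snd
    have h3 : ∀ᵐ y ∂(Measure.infinitePi fun _ : ℕ => ρ k), y i ≠ y i' := by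
      refine indepFun_ae_ne (measurable_pi_apply _) (measurable_pi_apply _)
        ((iIndepFun_infinitePi (P := fun _ : ℕ => ρ k) (X := fun _ x => x)
          (fun _ => measurable_id)).indepFun hi) fun x => ?_
      rw [Measure.infinitePi_map_eval]
      exact hρ k x
    exact (h2.comp h1).quasiMeasurePreserving.ae h3
  · have hX := (iIndepFun_infinitePi (P := fun k => blockMeasure (l k) (ρ k))
      (X := fun m b => b.2 (if m = k then i else i'))
      (fun m => (measurable_pi_apply _).comp measurable_snd)).indepFun hk
    simp only [if_true, if_neg (Ne.symm hk)] at hX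
    refine indepFun_ae_ne ((measurable_pi_apply _).comp
      (measurable_snd.comp (measurable_pi_apply _))) ((measurable_pi_apply _).comp
      (measurable_snd.comp (measurable_pi_apply _))) hX fun x => ?_
    rw [map_coord]
    exact hρ _ x

/-- The points, discarded altogether on the null event that two of them coincide. -/
def points (ω : ℕ → ℕ × (ℕ → E)) : Set E :=
  {x | (∀ p q : ℕ × ℕ, p ≠ q → (ω p.1).2 p.2 ≠ (ω q.1).2 q.2) ∧
    ∃ p : ℕ × ℕ, p.2 < (ω p.1).1 ∧ (ω p.1).2 p.2 = x}

theorem encard_points {F : Type} (ω : ℕ → ℕ × (ℕ → F))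
    (hω : ∀ p q : ℕ × ℕ, p ≠ q → (ω p.1).2 p.2 ≠ (ω q.1).2 q.2) (B : Set F) :
    ((points ω ∩ B).encard : ℝ≥0∞) = mcount B ω := by
  have h1 : points ω ∩ B = (fun p : ℕ × ℕ => (ω p.1).2 p.2) ''
      {p | p.2 < (ω p.1).1 ∧ (ω p.1).2 p.2 ∈ B} := by
    ext x
    constructor
    · rintro ⟨⟨-, p, hp, rfl⟩, hx⟩
      exact ⟨p, ⟨hp, hx⟩, rfl⟩
    · rintro ⟨p, ⟨hp, hx⟩, rfl⟩
      exact ⟨⟨hω, p, hp, rfl⟩, hx⟩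
  have hinj : Function.Injective (fun p : ℕ × ℕ => (ω p.1).2 p.2) := fun p q hpq => by
    by_contra hne
    exact hω p q hne hpq
  rw [h1, hinj.encard_image, ← Measure.count_apply (MeasurableSet.of_discrete),
    ← lintegral_indicator_one MeasurableSet.of_discrete, lintegral_count, ENNReal.tsum_prod']
  unfold mcount
  congr with k
  rw [tsum_eq_sum (s := Finset.range (ω k).1)]
  · refine Finset.sum_congr rfl fun i hi => ?_
    have := Finset.mem_range.1 hi
    by_cases hB : (ω k).2 i ∈ B <;> simp [hB, this]
  · intro i hi
    have : ¬ i < (ω k).1 := by simpa using hi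
    simp [this]

theorem measurable_of_measurable_toENNReal {Ω : Type} [MeasurableSpace Ω] {f : Ω → ℕ∞}
    (h : Measurable fun ω => (f ω : ℝ≥0∞)) : Measurable f := by
  refine measurable_to_countable' fun n => ?_
  have : f ⁻¹' {n} = (fun ω => (f ω : ℝ≥0∞)) ⁻¹' {(n : ℝ≥0∞)} := by
    ext ω; simp
  rw [this]
  exact h (measurableSet_singleton _)

theorem isPoissonProcess_points [MeasurableEq E] (hρ : ∀ k x, ρ k {x} = 0) :
    IsPoissonProcess points (Measure.sum fun k => l k • ρ k)
      (Measure.infinitePi fun k => blockMeasure (l k) (ρ k)) := by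
  have hmc : ∀ (p : ℕ × ℕ), Measurable fun ω : ℕ → ℕ × (ℕ → E) => (ω p.1).2 p.2 := fun p =>
    (measurable_pi_apply _).comp (measurable_snd.comp (measurable_pi_apply _))
  set good : Set (ℕ → ℕ × (ℕ → E)) :=
    {ω | ∀ p q : ℕ × ℕ, p ≠ q → (ω p.1).2 p.2 ≠ (ω q.1).2 q.2} with hgood
  have hgm : MeasurableSet good := by
    have : good = ⋂ (p : ℕ × ℕ) (q : ℕ × ℕ) (_ : p ≠ q),
        {ω | (ω p.1).2 p.2 = (ω q.1).2 q.2}ᶜ := by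
      ext; simp [hgood]
    rw [this]
    refine MeasurableSet.iInter fun p => MeasurableSet.iInter fun q => MeasurableSet.iInter fun _ =>
      MeasurableSet.compl ?_
    exact ((hmc p).prodMk (hmc q)) (measurableSet_diagonal (α := E))
  have hgae : ∀ᵐ ω ∂(Measure.infinitePi fun k => blockMeasure (l k) (ρ k)), ω ∈ good := by
    simp only [hgood, Set.mem_ofPred_eq, ae_all_iff]
    intro p q h
    exact ae_ne l ρ hρ p.1 p.2 q.1 q.2 h
  have hmeas : ∀ B, MeasurableSet B → Measurable fun ω => (points ω ∩ B : Set E).encard := by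
    intro B hB
    apply measurable_of_measurable_toENNReal
    have : (fun ω => ((points ω ∩ B : Set E).encard : ℝ≥0∞)) = good.indicator (mcount B) := by
      ext ω
      by_cases h : ω ∈ good
      · rw [Set.indicator_of_mem h, encard_points ω h]
      · rw [Set.indicator_of_notMem h]
        have : points ω = ∅ := by
          ext x
          simp only [points, Set.mem_ofPred_eq, Set.mem_empty_iff_false, iff_false]
          exact fun h' => h h'.1
        simp [this]
    rw [this]
    exact (measurable_mcount B hB).indicator hgm
  let φ : ℝ → ℕ∞ := fun x => (⌊x⌋₊ : ℕ∞)
  have hφ : Measurable φ := (measurable_from_nat).comp Nat.measurable_floor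
  have hae : ∀ B, MeasurableSet B → (Measure.sum fun k => l k • ρ k) B ≠ ∞ →
      (fun ω => φ (mcount B ω).toReal) =ᵐ[Measure.infinitePi fun k => blockMeasure (l k) (ρ k)]
        fun ω => (points ω ∩ B : Set E).encard := by
    intro B hB hfin
    filter_upwards [hgae, ae_mcount_lt_top l ρ B hB hfin] with ω hω hlt
    rw [← encard_points ω hω] at hlt ⊢
    generalize (points ω ∩ B : Set E).encard = e at hlt
    induction e using ENat.recTopCoe with
    | top => simp at hlt
    | coe n => simp [φ]
  refine ⟨hmeas, fun B hB hfin => ?_, fun m B hB hfin hdis => ?_⟩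
  · rw [← Measure.map_congr (hae B hB hfin)]
    have := congrArg (Measure.map φ) (map_mcount l ρ B hB hfin)
    rw [Measure.map_map hφ (measurable_mcount B hB).ennreal_toReal,
      Measure.map_map hφ measurable_from_nat] at this
    have hc : φ ∘ (Nat.cast : ℕ → ℝ) = (Nat.cast : ℕ → ℕ∞) := by
      funext n
      simp [φ]
    rw [hc] at this
    exact this
  · exact ((iIndepFun_mcount l ρ B hB hfin hdis).comp (fun _ => φ) fun _ => hφ).congr
      fun j => hae (B j) (hB j) (hfin j)

/-- A Poisson point process exists for every s-finite intensity measure without atoms. -/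
theorem exists_isPoissonProcess [MeasurableEq E] (ν : Measure E) [SFinite ν]
    (hν : ∀ x, ν {x} = 0) :
    ∃ (Ω : Type) (_ : MeasurableSpace Ω) (P : Measure Ω) (N : Ω → Set E),
      IsProbabilityMeasure P ∧ IsPoissonProcess N ν P := by
  by_cases h0 : ν = 0
  · refine ⟨Unit, inferInstance, Measure.dirac (), fun _ => ∅, inferInstance, ?_⟩
    subst h0
    refine ⟨fun B hB => by simp, fun B hB _ => ?_, fun m B _ _ _ => ?_⟩
    · have h1 : poissonMeasure 0 = Measure.dirac 0 := by
        refine Measure.ext_of_singleton fun n => ?_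
        rw [poissonMeasure_singleton]
        rcases n with _ | n <;> simp
      simp [h1, Measure.map_dirac]
    · rw [iIndepFun_iff_measure_inter_preimage_eq_mul]
      intro S sets _
      simp only [Set.empty_inter, Set.encard_empty]
      by_cases h : ∀ i ∈ S, (0 : ℕ∞) ∈ sets i
      · rw [Finset.prod_eq_one]
        · have : (⋂ i ∈ S, (fun _ : Unit => (0 : ℕ∞)) ⁻¹' sets i) = Set.univ := by
            ext; simpa using h
          simp [this]
        · intro i hi
          have : (fun _ : Unit => (0 : ℕ∞)) ⁻¹' sets i = Set.univ := by
            ext; simpa using h i hi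
          simp [this]
      · push Not at h
        obtain ⟨i, hi, hi0⟩ := h
        have h0 : (fun _ : Unit => (0 : ℕ∞)) ⁻¹' sets i = ∅ := by
          ext; simpa using hi0
        rw [Finset.prod_eq_zero hi (by simp [h0])]
        refine measure_mono_null (Set.biInter_subset_of_mem hi) (by simp [h0])
  have : NeZero ν := ⟨h0⟩
  have key : ∀ k, ∃ (l : ℝ≥0) (ρ : Measure E), IsProbabilityMeasure ρ ∧ (∀ x, ρ {x} = 0) ∧
      l • ρ = sfiniteSeq ν k := by
    intro k
    by_cases hk : sfiniteSeq ν k = 0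
    · exact ⟨0, ν.toFinite, inferInstance,
        fun x => toFinite_absolutelyContinuous ν (hν x), by simp [hk]⟩
    · have : NeZero (sfiniteSeq ν k) := ⟨hk⟩
      refine ⟨(sfiniteSeq ν k Set.univ).toNNReal,
        (sfiniteSeq ν k Set.univ)⁻¹ • sfiniteSeq ν k, inferInstance, fun x => ?_, ?_⟩
      · have : sfiniteSeq ν k {x} = 0 :=
          le_antisymm ((sfiniteSeq_le ν k _).trans (hν x).le) (by simp)
        simp [this]
      · ext s _
        rw [Measure.smul_apply, Measure.smul_apply, ENNReal.smul_def, smul_eq_mul, smul_eq_mul,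
          ENNReal.coe_toNNReal (measure_ne_top _ _), ← mul_assoc,
          ENNReal.mul_inv_cancel (by simpa using hk) (measure_ne_top _ _), one_mul]
  choose l ρ hρ hρ0 hl using key
  refine ⟨_, inferInstance, Measure.infinitePi fun k => blockMeasure (l k) (ρ k), points,
    inferInstance, ?_⟩
  have := isPoissonProcess_points l ρ hρ0
  simp_rw [hl, sum_sfiniteSeq] at this
  exact this

end Existence

/-! ### The law of the number of maxima -/

/-- `q` (a law on the natural numbers) is the law of the number of maxima dominated by `x` in a
Poisson point process with intensity measure `ν`. Such processes exist, and the number has law `q`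
for each of them (in particular, it is almost surely finite). -/
def IsMaximaLaw {E : Type} [MeasurableSpace E] (r : E → E → Prop) (ν : Measure E) (x : E)
    (q : Measure ℕ) : Prop :=
  (∃ (Ω : Type) (_ : MeasurableSpace Ω) (P : Measure Ω) (N : Ω → Set E),
    IsProbabilityMeasure P ∧ IsPoissonProcess N ν P) ∧
  ∀ (Ω : Type) (_ : MeasurableSpace Ω) (P : Measure Ω) (N : Ω → Set E),
    IsProbabilityMeasure P → IsPoissonProcess N ν P →
      P.map (fun ω => numMaximaBelow r (N ω) x) = q.map (Nat.cast : ℕ → ℕ∞)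

/-! ### The Gumbel law and the intensities -/

/-- The standard Gumbel law on `ℝ`, with density `exp (-g) * exp (-exp (-g))`. -/
def gumbelMeasure : Measure ℝ :=
  volume.withDensity fun g => ENNReal.ofReal (Real.exp (-g) * Real.exp (-Real.exp (-g)))

/-- The measure on `ℝ^d` with density `exp (-(z 0 + ⋯ + z (d - 1)))` off `{z | x ≺ z}`, and `0` on
that set. -/
def expIntensity {d : ℕ} (x : Fin d → ℝ) : Measure (Fin d → ℝ) :=
  volume.withDensity
    ({z : Fin d → ℝ | ¬ StrongLT x z}.indicator fun z => ENNReal.ofReal (Real.exp (-∑ j, z j)))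

/-- Lebesgue measure on the set of `z ∈ (0, ∞)^d` with not `z ≺ x`. -/
def unitIntensity {d : ℕ} (x : Fin d → ℝ) : Measure (Fin d → ℝ) :=
  volume.restrict {z : Fin d → ℝ | (∀ j, 0 < z j) ∧ ¬ StrongLT z x}

/-! ### Convergence -/

/-- Conditionally on `0 ≤ K n`, the integer random variables `K n` converge in distribution to the
law `κ` on the natural numbers, as `n → ∞`. -/
def CondTendstoInDistribution {Ω : Type*} [MeasurableSpace Ω] (P : Measure Ω) (K : ℕ → Ω → ℤ)
    (κ : ProbabilityMeasure ℕ) : Prop :=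
  ∃ μ : ℕ → ProbabilityMeasure ℕ,
    (∀ n, (cond P {ω | 0 ≤ K n ω}).map (K n) = (μ n : Measure ℕ).map (Nat.cast : ℕ → ℤ)) ∧
    Tendsto μ atTop (𝓝 κ)

end ParetoRecords

end

noncomputable section

namespace ParetoRecords

/-! ### Discretization on a grid -/

/-! The coordinatewise map `z ↦ exp (-z)` reverses domination. It turns Exponential(1) coordinates
into uniform ones, the intensity `exp (-z_+)` into Lebesgue measure on the orthant, and the Gumbel
law into Exponential(1). So the whole theorem reduces to record-small values of uniform points.
Condition on the new observation being `u`. It breaks `k` records when no earlier point lies below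
`u` and exactly `k` minima of the earlier points dominate `u`. Put `w = n * ∏ u j`. The probability
of this event should be close to `exp (-w)` times the probability that `𝒦'_w = k`: the factor `exp
(-w)` is the chance that a Poisson process has no point below `u`, and by scaling only `w` matters.
Integrated over `u` and normalized by the probability of a record, this gives a mixture in which `w`
becomes Exponential(1).

The comparison goes through a grid of mesh `u / L` in the box `(0, M u]`. If no two points of the
box share an index in some direction, and no relevant minimum leaves the box, then the number of
minima is a function of the set of occupied cells (`encard_minima_eq_gridMinima`). The law of that
set is determined by void probabilities through inclusion-exclusion (`measureReal_occupancy`). These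
are `exp (-w V)` for the Poisson process, up to the factor `exp w`, and `(1 - w V / n) ^ n` for the
sample, where the volume `V` does not depend on `u` (`volume_cellRegion`), so the latter converge to
the former. The discretization error has the same bound `gridError d M w` on both sides, and it
vanishes as `M → ∞`. Applied to the Poisson process alone, the same approximation shows that the
number of minima is almost everywhere measurable and almost surely finite, and that its law is the
same for every version of the process and measurable in `w`.

For the integration over `u`, the product of `m + 1` uniform variables has density `(-log v) ^ m /
m!`. After the substitution `w = n v`, the rate `n m! / (log n) ^ m` turns the law of `n * ∏ u j`
into Lebesgue measure on `(0, ∞)` in the limit, with domination by `exp (-w)`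
(`tendsto_lintegral_cubeMeasure`). The box `(0, M u]` fits in the cube only if every `M u j < 1`.
The exceptional set is negligible, because fixing one coordinate away from `0` costs a factor `log
n` (`tendsto_lintegral_cubeMeasure_slab`). Dividing by the record probability, whose normalized
limit is `1`, gives convergence of the point masses, hence convergence in law on `ℕ`. -/

/-- Index of the cell containing `z`, for the grid with mesh `u / L`. -/
def gridIndex {d : ℕ} (L : ℕ) (u z : Fin d → ℝ) (j : Fin d) : ℕ := ⌈L * z j / u j⌉₊

/-- The cells all of whose indices are at most `N`. -/
def gridCells (d N : ℕ) : Finset (Fin d → ℕ) := Fintype.piFinset fun _ => Finset.range (N + 1)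

theorem mem_gridCells {d N : ℕ} {c : Fin d → ℕ} : c ∈ gridCells d N ↔ ∀ j, c j ≤ N := by
  simp [gridCells, Fintype.mem_piFinset]

open Classical in
/-- The cells that contain a point of the configuration `p`. -/
def occupiedCells {d : ℕ} {ι : Type*} (N L : ℕ) (u : Fin d → ℝ) (p : ι → Fin d → ℝ) :
    Finset (Fin d → ℕ) :=
  (gridCells d N).filter fun c => ∃ i, gridIndex L u (p i) = c

open Classical in
/-- The number of minimal cells of `S` with all indices above `L`. -/
def gridMinima {d : ℕ} (L : ℕ) (S : Finset (Fin d → ℕ)) : ℕ :=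
  (S.filter fun c => (∀ j, L < c j) ∧ ∀ b ∈ S, ¬ StrongLT b c).card

theorem mem_occupiedCells {d : ℕ} {ι : Type*} {N L : ℕ} {u : Fin d → ℝ} {p : ι → Fin d → ℝ}
    {c : Fin d → ℕ} :
    c ∈ occupiedCells N L u p ↔ c ∈ gridCells d N ∧ ∃ i, gridIndex L u (p i) = c := by
  simp [occupiedCells]

theorem gridIndex_mono {d L : ℕ} {u y z : Fin d → ℝ} (hu : ∀ j, 0 < u j) {j : Fin d}
    (h : y j ≤ z j) : gridIndex L u y j ≤ gridIndex L u z j := by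
  have := hu j
  exact Nat.ceil_mono (by gcongr)

theorem lt_of_gridIndex_lt {d L : ℕ} {u y z : Fin d → ℝ} (hu : ∀ j, 0 < u j) {j : Fin d}
    (h : gridIndex L u y j < gridIndex L u z j) : y j < z j := by
  by_contra hc
  exact absurd (gridIndex_mono (L := L) hu (not_lt.1 hc)) (not_le.2 h)

/-- The ceiling makes cells open on the left and closed on the right, so comparison with the
multiples `a * u` is exact on the grid. The case `a = 1` detects domination of `u`, and `a = M`
detects leaving the box. -/
theorem lt_gridIndex_iff {d L : ℕ} {u z : Fin d → ℝ} (hL : 0 < L) (hu : ∀ j, 0 < u j)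
    {j : Fin d} (a : ℕ) : L * a < gridIndex L u z j ↔ a * u j < z j := by
  have hL' : (0 : ℝ) < L := by exact_mod_cast hL
  rw [gridIndex, Nat.lt_ceil, lt_div_iff₀ (hu j)]
  push_cast
  rw [mul_assoc]
  exact mul_lt_mul_iff_right₀ hL'

/-- If distinct points in the box share no coordinate index, and all relevant minima lie in the
box, then counting minima is the same as counting minimal cells. -/
theorem encard_minima_eq_gridMinima {d : ℕ} (hd : 1 ≤ d) {ι : Type*} {L N : ℕ} (hL : 0 < L)
    {u : Fin d → ℝ} (hu : ∀ j, 0 < u j) (p : ι → Fin d → ℝ)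
    (hsep : ∀ i i', i ≠ i' → gridIndex L u (p i) ∈ gridCells d N →
      gridIndex L u (p i') ∈ gridCells d N → ∀ j, gridIndex L u (p i) j ≠ gridIndex L u (p i') j)
    (hbox : ∀ i, (∀ i', ¬ StrongLT (p i') (p i)) → StrongLT u (p i) →
      gridIndex L u (p i) ∈ gridCells d N) :
    {i | (∀ i', ¬ StrongLT (p i') (p i)) ∧ StrongLT u (p i)}.encard =
      gridMinima L (occupiedCells N L u p) := by
  classical
  have hinj : Set.InjOn (fun i => gridIndex L u (p i))
      {i | (∀ i', ¬ StrongLT (p i') (p i)) ∧ StrongLT u (p i)} := by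
    intro i hi i' hi' h
    by_contra hne
    exact hsep i i' hne (hbox i hi.1 hi.2) (hbox i' hi'.1 hi'.2) ⟨0, hd⟩ (congrFun h _)
  -- Domination of points always gives `≤` between indices, and separation makes it strict. A point
  -- below a point of the box is itself in the box, so minimality of a point of the box can be
  -- decided inside the box.
  have hlt : ∀ i i', gridIndex L u (p i') ∈ gridCells d N → StrongLT (p i) (p i') →
      gridIndex L u (p i) ∈ gridCells d N ∧
        StrongLT (gridIndex L u (p i)) (gridIndex L u (p i')) := by
    intro i i' hi' h
    have hle : ∀ j, gridIndex L u (p i) j ≤ gridIndex L u (p i') j := fun j =>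
      gridIndex_mono hu (h j).le
    have hi : gridIndex L u (p i) ∈ gridCells d N :=
      mem_gridCells.2 fun j => (hle j).trans (mem_gridCells.1 hi' j)
    have hne : i ≠ i' := fun hii => (hii ▸ h ⟨0, hd⟩).false
    exact ⟨hi, fun j => lt_of_le_of_ne (hle j) (hsep i i' hne hi hi' j)⟩
  have himg : (fun i => gridIndex L u (p i)) ''
      {i | (∀ i', ¬ StrongLT (p i') (p i)) ∧ StrongLT u (p i)} =
      ((occupiedCells N L u p).filter fun c => (∀ j, L < c j) ∧
        ∀ b ∈ occupiedCells N L u p, ¬ StrongLT b c : Finset (Fin d → ℕ)) := by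
    ext c
    simp only [Set.mem_image, Set.mem_ofPred_eq, Finset.coe_filter, mem_occupiedCells]
    constructor
    · rintro ⟨i, hi, rfl⟩
      refine ⟨⟨hbox i hi.1 hi.2, i, rfl⟩, fun j => ?_, ?_⟩
      · simpa using (lt_gridIndex_iff hL hu (j := j) (z := p i) 1).2 (by simpa using hi.2 j)
      · rintro b ⟨-, i', rfl⟩ hb
        exact hi.1 i' fun j => lt_of_gridIndex_lt hu (hb j)
    · rintro ⟨⟨hc, i, rfl⟩, h1, h2⟩
      refine ⟨i, ⟨fun i' hi' => ?_, fun j => ?_⟩, rfl⟩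
      · obtain ⟨h3, h4⟩ := hlt i' i hc hi'
        exact h2 _ ⟨h3, i', rfl⟩ h4
      · simpa using (lt_gridIndex_iff hL hu (j := j) (z := p i) 1).1 (by simpa using h1 j)
  rw [← hinj.encard_image, himg, Set.encard_coe_eq_coe_finsetCard, gridMinima]

/-! ### From void probabilities to the law of the occupied cells -/

open Classical in
/-- The inclusion-exclusion expression for the probability that a random finite subset of `C`
satisfies `A`, in terms of the probabilities `v T` that it is contained in `T`. -/
def occupancySum {κ : Type*} (C : Finset κ) (A : Finset κ → Prop) (v : Finset κ → ℝ) : ℝ :=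
  ∑ S ∈ C.powerset.filter A, ∑ U ∈ S.powerset, (-1) ^ U.card * v (S \ U)

-- Möbius inversion on the lattice of finite sets: the indicator of `O = S` in terms of the
-- indicators of `O ⊆ T`. The sets `U` that contribute are those contained in `S \ O`, and their
-- signs cancel unless `S \ O` is empty.
open Classical in
theorem sum_powerset_ite_subset_sdiff {κ : Type*} (O S : Finset κ) :
    ∑ U ∈ S.powerset, (-1) ^ U.card * (if O ⊆ S \ U then (1 : ℝ) else 0) =
      if O = S then 1 else 0 := by
  by_cases h : O ⊆ S
  · have h1 : ∑ U ∈ S.powerset, (-1) ^ U.card * (if O ⊆ S \ U then (1 : ℝ) else 0) =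
        ∑ U ∈ (S \ O).powerset, (-1) ^ U.card := by
      rw [← Finset.sum_subset (Finset.powerset_mono.2 (Finset.sdiff_subset (s := S) (t := O)))]
      · refine Finset.sum_congr rfl fun U hU => ?_
        rw [if_pos, mul_one]
        have := Finset.subset_sdiff.1 (Finset.mem_powerset.1 hU)
        exact Finset.subset_sdiff.2 ⟨h, this.2.symm⟩
      · intro U hU hU'
        rw [if_neg, mul_zero]
        intro hO
        exact hU' (Finset.mem_powerset.2 (Finset.subset_sdiff.2
          ⟨Finset.mem_powerset.1 hU, (Finset.subset_sdiff.1 hO).2.symm⟩))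
    have h2 := congrArg (Int.cast : ℤ → ℝ) (Finset.sum_powerset_neg_one_pow_card (x := S \ O))
    push_cast at h2
    rw [h1, h2]
    congr 1
    rw [Finset.sdiff_eq_empty_iff_subset]
    exact propext ⟨fun h' => h.antisymm h', fun h' => h' ▸ subset_rfl⟩
  · rw [if_neg fun h' : O = S => h h'.subset]
    refine Finset.sum_eq_zero fun U _ => ?_
    rw [if_neg fun h' => h (h'.trans Finset.sdiff_subset), mul_zero]

/-- By strong induction on `T`, the event `occ = T` is `occ ⊆ T` minus the events `occ = S` with `S`
strictly smaller. Only void events need to be measurable, which is all that a point process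
provides. -/
theorem measurableSet_occupancy {κ Ω : Type*} [MeasurableSpace Ω] (C : Finset κ)
    (occ : Ω → Finset κ) (hocc : ∀ ω, occ ω ⊆ C) (R : Set Ω)
    (hm : ∀ T ⊆ C, MeasurableSet {ω | ω ∈ R ∧ occ ω ⊆ T}) (A : Finset κ → Prop) :
    MeasurableSet {ω | ω ∈ R ∧ A (occ ω)} := by
  classical
  have hms : ∀ T ⊆ C, MeasurableSet {ω | ω ∈ R ∧ occ ω = T} := by
    intro T
    induction T using Finset.strongInduction with
    | H T ih =>
      intro hT
      have : {ω | ω ∈ R ∧ occ ω = T} = {ω | ω ∈ R ∧ occ ω ⊆ T} \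
          ⋃ S ∈ T.ssubsets, {ω | ω ∈ R ∧ occ ω = S} := by
        ext ω
        simp only [Set.mem_ofPred_eq, Set.mem_sdiff, Set.mem_iUnion, Finset.mem_ssubsets,
          exists_prop, not_exists, not_and]
        constructor
        · rintro ⟨hR, rfl⟩
          exact ⟨⟨hR, subset_rfl⟩, fun S hS _ h => hS.ne h.symm⟩
        · rintro ⟨⟨hR, h1⟩, h2⟩
          refine ⟨hR, ?_⟩
          by_contra hne
          exact h2 _ (lt_of_le_of_ne h1 hne) hR rfl
      rw [this]
      refine (hm T hT).diff (Finset.measurableSet_biUnion _ fun S hS => ?_)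
      have hS' := Finset.mem_ssubsets.1 hS
      exact ih S hS' (hS'.1.trans hT)
  have : {ω | ω ∈ R ∧ A (occ ω)} =
      ⋃ S ∈ C.powerset.filter A, {ω | ω ∈ R ∧ occ ω = S} := by
    ext ω
    simp only [Set.mem_ofPred_eq, Set.mem_iUnion, Finset.mem_filter, Finset.mem_powerset,
      exists_prop]
    constructor
    · rintro ⟨hR, hA⟩
      exact ⟨_, ⟨hocc ω, hA⟩, hR, rfl⟩
    · rintro ⟨S, ⟨-, hA⟩, hR, rfl⟩
      exact ⟨hR, hA⟩
  rw [this]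
  exact Finset.measurableSet_biUnion _ fun S hS =>
    hms S (Finset.mem_powerset.1 (Finset.mem_filter.1 hS).1)

/-- Integrate the pointwise Möbius inversion. The event `R` is carried along because, for a sample,
the absence of points below `u` is part of the event to be estimated. -/
theorem measureReal_occupancy {κ Ω : Type*} [MeasurableSpace Ω] (P : Measure Ω)
    [IsFiniteMeasure P] (C : Finset κ) (occ : Ω → Finset κ) (hocc : ∀ ω, occ ω ⊆ C) (R : Set Ω)
    (hm : ∀ T ⊆ C, MeasurableSet {ω | ω ∈ R ∧ occ ω ⊆ T}) (A : Finset κ → Prop) :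
    P.real {ω | ω ∈ R ∧ A (occ ω)} =
      occupancySum C A fun T => P.real {ω | ω ∈ R ∧ occ ω ⊆ T} := by
  classical
  have hAm := measurableSet_occupancy C occ hocc R hm A
  have hpt : ∀ ω, {ω | ω ∈ R ∧ A (occ ω)}.indicator (1 : Ω → ℝ) ω =
      ∑ S ∈ C.powerset.filter A, ∑ U ∈ S.powerset, (-1) ^ U.card *
        {ω | ω ∈ R ∧ occ ω ⊆ S \ U}.indicator (1 : Ω → ℝ) ω := by
    intro ω
    by_cases hR : ω ∈ R
    · simp only [Set.indicator_apply, Set.mem_ofPred_eq, hR, true_and, Pi.one_apply]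
      simp_rw [sum_powerset_ite_subset_sdiff]
      rw [Finset.sum_ite_eq]
      simp [hocc]
    · simp [hR]
  rw [← integral_indicator_one hAm]
  simp_rw [hpt]
  have hi : ∀ S ∈ C.powerset.filter A, ∀ U ∈ S.powerset, Integrable (fun ω => (-1) ^ U.card *
        {ω | ω ∈ R ∧ occ ω ⊆ S \ U}.indicator (1 : Ω → ℝ) ω) P := by
    intro S hS U _
    refine Integrable.const_mul ((integrable_const (1 : ℝ)).indicator (hm _ ?_)) _
    exact Finset.sdiff_subset.trans (Finset.mem_powerset.1 (Finset.mem_filter.1 hS).1)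
  rw [integral_finsetSum _ fun S hS => integrable_finsetSum _ (hi S hS), occupancySum]
  refine Finset.sum_congr rfl fun S hS => ?_
  rw [integral_finsetSum _ (hi S hS)]
  refine Finset.sum_congr rfl fun U _ => ?_
  rw [integral_const_mul, integral_indicator_one]
  exact hm _ (Finset.sdiff_subset.trans (Finset.mem_powerset.1 (Finset.mem_filter.1 hS).1))

theorem tendsto_occupancySum {κ ι : Type*} (C : Finset κ) (A : Finset κ → Prop) {l : Filter ι}
    {v : ι → Finset κ → ℝ} {v' : Finset κ → ℝ} (h : ∀ T, Tendsto (fun i => v i T) l (𝓝 (v' T))) :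
    Tendsto (fun i => occupancySum C A (v i)) l (𝓝 (occupancySum C A v')) := by
  unfold occupancySum
  exact tendsto_finsetSum _ fun S _ => tendsto_finsetSum _ fun U _ => (h _).const_mul _

theorem measurable_occupancySum {κ α : Type*} [MeasurableSpace α] (C : Finset κ)
    (A : Finset κ → Prop) {v : α → Finset κ → ℝ} (h : ∀ T, Measurable fun a => v a T) :
    Measurable fun a => occupancySum C A (v a) := by
  unfold occupancySum
  exact Finset.measurable_sum _ fun S _ => Finset.measurable_sum _ fun U _ => (h _).const_mul _

theorem occupancySum_const_mul {κ : Type*} (C : Finset κ) (A : Finset κ → Prop) (r : ℝ)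
    (v : Finset κ → ℝ) : occupancySum C A (fun T => r * v T) = r * occupancySum C A v := by
  unfold occupancySum
  simp_rw [Finset.mul_sum]
  exact Finset.sum_congr rfl fun S _ => Finset.sum_congr rfl fun U _ => by ring

/-! ### Comparison of the number of minima with its discretization -/

/-- The number of minima of the configuration `p` that dominate `u`. -/
def dominatingMinima {d : ℕ} {ι : Type*} (u : Fin d → ℝ) (p : ι → Fin d → ℝ) : ℕ∞ :=
  {i | (∀ i', ¬ StrongLT (p i') (p i)) ∧ StrongLT u (p i)}.encard

/-- The points of the box with index `t` in direction `j`. -/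
def gridSlab {d : ℕ} (N L : ℕ) (u : Fin d → ℝ) (j : Fin d) (t : ℕ) : Set (Fin d → ℝ) :=
  {z | gridIndex L u z ∈ gridCells d N ∧ gridIndex L u z j = t}

/-- A bound for the probability that some minimum lies outside of a box of size `M`. -/
def outTail (d M : ℕ) (w : ℝ) : ℝ :=
  Real.exp (-(w / 2) * M) * Real.exp (w / 2 * d) * (1 - Real.exp (-(w / 2)))⁻¹ ^ d

theorem outTail_nonneg (d M : ℕ) {w : ℝ} (hw : 0 ≤ w) : 0 ≤ outTail d M w := by
  have : Real.exp (-(w / 2)) ≤ 1 := Real.exp_le_one_iff.2 (by linarith)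
  have : 0 ≤ (1 - Real.exp (-(w / 2)))⁻¹ := inv_nonneg.2 (by linarith)
  unfold outTail
  positivity

theorem measurable_outTail (d M : ℕ) : Measurable (outTail d M) := by
  unfold outTail
  fun_prop

theorem tendsto_outTail (d : ℕ) {w : ℝ} (hw : 0 < w) :
    Tendsto (fun M => outTail d M w) atTop (𝓝 0) := by
  unfold outTail
  have h : Tendsto (fun M : ℕ => Real.exp (-(w / 2) * M)) atTop (𝓝 0) := by
    refine Real.tendsto_exp_atBot.comp ?_
    exact tendsto_natCast_atTop_atTop.const_mul_atTop_of_neg (by linarith)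
  simpa [mul_assoc] using h.mul_const (Real.exp (w / 2 * d) * (1 - Real.exp (-(w / 2)))⁻¹ ^ d)

/-- For `x, y ≥ 1`, expanding `(x - 1) (y - 1) ≥ 0` gives `x + y ≤ x y + 1`; iterate over the
factors. This trades the product in the exponent of a void probability for a sum, which is what
makes the series geometric. -/
theorem one_le_prod_and_sum_le {κ : Type*} (s : Finset κ) (a : κ → ℝ) (ha : ∀ j ∈ s, 1 ≤ a j) :
    1 ≤ ∏ j ∈ s, a j ∧ ∑ j ∈ s, a j ≤ ∏ j ∈ s, a j + s.card := by
  classical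
  induction s using Finset.induction_on with
  | empty => simp
  | insert i s hi ih =>
    obtain ⟨h1, h2⟩ := ih fun j hj => ha j (Finset.mem_insert_of_mem hj)
    have h3 := ha i (Finset.mem_insert_self _ _)
    rw [Finset.prod_insert hi, Finset.sum_insert hi, Finset.card_insert_of_notMem hi]
    push_cast
    constructor <;> nlinarith [mul_nonneg (sub_nonneg.2 h1) (sub_nonneg.2 h3)]

/-- Split `w ∏ a j` into two halves. One half is at least `w M / 2` since some `a j ≥ M` and the
others are at least `1`. The other is at least `(w / 2) (∑ a j - d)`, which leaves a product of `d`
geometric series. -/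
theorem tsum_exp_neg_prod_le {d M : ℕ} {w : ℝ} (hw : 0 < w) :
    ∑' a : {a : Fin d → ℕ // (∀ j, 1 ≤ a j) ∧ ∃ j, M ≤ a j},
      ENNReal.ofReal (Real.exp (-w * ∏ j, (a.1 j : ℝ))) ≤ ENNReal.ofReal (outTail d M w) := by
  classical
  set q := Real.exp (-(w / 2)) with hq
  have hq1 : q < 1 := Real.exp_lt_one_iff.2 (by linarith)
  have hq0 : 0 ≤ q := (Real.exp_pos _).le
  set c := Real.exp (-(w / 2) * M) * Real.exp (w / 2 * d) with hc
  have hc0 : 0 ≤ c := by positivity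
  have hpt : ∀ a : {a : Fin d → ℕ // (∀ j, 1 ≤ a j) ∧ ∃ j, M ≤ a j},
      Real.exp (-w * ∏ j, (a.1 j : ℝ)) ≤ c * ∏ j, q ^ a.1 j := by
    rintro ⟨a, ha, j0, hj0⟩
    have h1 := one_le_prod_and_sum_le Finset.univ (fun j => (a j : ℝ))
      (fun j _ => by exact_mod_cast ha j)
    have h2 : (M : ℝ) ≤ ∏ j, (a j : ℝ) := by
      rw [← Finset.mul_prod_erase Finset.univ _ (Finset.mem_univ j0)]
      have h3 := one_le_prod_and_sum_le (Finset.univ.erase j0) (fun j => (a j : ℝ))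
        (fun j _ => by exact_mod_cast ha j)
      have : (M : ℝ) ≤ a j0 := by exact_mod_cast hj0
      nlinarith [h3.1, (Nat.cast_nonneg M : (0 : ℝ) ≤ M)]
    simp only [hq, hc, ← Real.exp_nat_mul, ← Real.exp_sum, ← Real.exp_add]
    refine Real.exp_le_exp.2 ?_
    rw [← Finset.sum_mul]
    have h4 := h1.2
    rw [Finset.card_univ, Fintype.card_fin] at h4
    nlinarith
  refine (ENNReal.tsum_le_tsum fun a => ENNReal.ofReal_le_ofReal (hpt a)).trans ?_
  rw [ENNReal.tsum_eq_iSup_sum]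
  refine iSup_le fun s => ?_
  rw [← ENNReal.ofReal_sum_of_nonneg fun _ _ => by positivity]
  refine ENNReal.ofReal_le_ofReal ?_
  rw [← Finset.mul_sum, outTail, ← hc, ← hq]
  refine mul_le_mul_of_nonneg_left ?_ hc0
  obtain ⟨N, hN⟩ : ∃ N, ∀ a ∈ s, ∀ j, a.1 j < N := by
    refine ⟨s.sup (fun a => Finset.univ.sup a.1) + 1, fun a ha j => Nat.lt_succ_of_le ?_⟩
    exact (Finset.le_sup (f := a.1) (Finset.mem_univ j)).trans
      (Finset.le_sup (f := fun a => Finset.univ.sup a.1) ha)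
  calc ∑ a ∈ s, ∏ j, q ^ a.1 j
      = ∑ a ∈ s.map (Function.Embedding.subtype _), ∏ j, q ^ a j := by rw [Finset.sum_map]; rfl
    _ ≤ ∑ a ∈ Fintype.piFinset fun _ : Fin d => Finset.range N, ∏ j, q ^ a j := by
        refine Finset.sum_le_sum_of_subset_of_nonneg ?_ fun _ _ _ => by positivity
        intro a ha
        obtain ⟨b, hb, rfl⟩ := Finset.mem_map.1 ha
        exact Fintype.mem_piFinset.2 fun j => Finset.mem_range.2 (hN b hb j)
    _ = ∏ j : Fin d, ∑ i ∈ Finset.range N, q ^ i := by rw [Finset.prod_univ_sum]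
    _ ≤ (1 - q)⁻¹ ^ d := by
        rw [Finset.prod_const, Finset.card_univ, Fintype.card_fin]
        refine pow_le_pow_left₀ (Finset.sum_nonneg fun _ _ => by positivity) ?_ _
        rw [← tsum_geometric_of_lt_one hq0 hq1]
        exact (summable_geometric_of_lt_one hq0 hq1).sum_le_tsum _ fun _ _ => by positivity

theorem abs_measureReal_sub_le {Ω : Type*} [MeasurableSpace Ω] (P : Measure Ω) [IsFiniteMeasure P]
    {A A' B : Set Ω} (h : A \ B ⊆ A') (h' : A' \ B ⊆ A) {b : ℝ} (hb : P.real B ≤ b) :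
    |P.real A - P.real A'| ≤ b := by
  have h1 : ∀ A A' : Set Ω, A \ B ⊆ A' → P.real A ≤ P.real A' + P.real B := fun A A' h =>
    (measureReal_mono (Set.sdiff_subset_iff.1 h |>.trans (Set.union_comm _ _).subset)).trans
      (measureReal_union_le _ _)
  rw [abs_le]
  constructor <;> linarith [h1 A A' h, h1 A' A h']

/-- Comparison of the law of the number of minima dominating `u` with its discretization, on an
event `R`, for a random configuration `p`. -/
theorem measure_dominatingMinima_ne_gridMinima_le {d : ℕ} (hd : 1 ≤ d) {Ω : Type*}
    [MeasurableSpace Ω] (P : Measure Ω) {ι : Ω → Type*} (p : ∀ ω, ι ω → Fin d → ℝ) (R : Set Ω)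
    {L M : ℕ} (hL : 0 < L) {u : Fin d → ℝ} (hu : ∀ j, 0 < u j) {w c σ : ℝ}
    (hw : 0 < w) (hc : 0 ≤ c)
    (hslab : ∀ j, ∀ t ≤ L * M, P {ω | ∃ i i', i ≠ i' ∧ p ω i ∈ gridSlab (L * M) L u j t ∧
      p ω i' ∈ gridSlab (L * M) L u j t} ≤ ENNReal.ofReal σ)
    (hvoid : ∀ a : Fin d → ℕ, (∀ j, 1 ≤ a j) → (∃ j, M ≤ a j) →
      P {ω | ω ∈ R ∧ (∃ i, ∀ j, a j * u j < p ω i j) ∧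
        ∀ i, ¬ StrongLT (p ω i) fun j => a j * u j} ≤
        ENNReal.ofReal (c * Real.exp (-w * ∏ j, (a j : ℝ)))) :
    P {ω | ω ∈ R ∧ dominatingMinima u (p ω) ≠ gridMinima L (occupiedCells (L * M) L u (p ω))} ≤
      (d * (L * M + 1) : ℕ) * ENNReal.ofReal σ + ENNReal.ofReal (c * outTail d M w) := by
  have hcov : {ω | ω ∈ R ∧
      dominatingMinima u (p ω) ≠ gridMinima L (occupiedCells (L * M) L u (p ω))} ⊆
      (⋃ jt ∈ (Finset.univ : Finset (Fin d)) ×ˢ Finset.range (L * M + 1),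
        {ω | ∃ i i', i ≠ i' ∧ p ω i ∈ gridSlab (L * M) L u jt.1 jt.2 ∧
          p ω i' ∈ gridSlab (L * M) L u jt.1 jt.2}) ∪
      ⋃ a : {a : Fin d → ℕ // (∀ j, 1 ≤ a j) ∧ ∃ j, M ≤ a j},
        {ω | ω ∈ R ∧ (∃ i, ∀ j, a.1 j * u j < p ω i j) ∧
          ∀ i, ¬ StrongLT (p ω i) fun j => a.1 j * u j} := by
    rintro ω ⟨hR, hω⟩
    by_contra hcon
    simp only [Set.mem_union, Set.mem_iUnion, not_or, not_exists, Set.mem_ofPred_eq, not_and] at hcon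
    obtain ⟨h1, h2⟩ := hcon
    refine hω (encard_minima_eq_gridMinima hd hL hu (p ω) ?_ ?_)
    · intro i i' hne hi hi' j h
      refine h1 (j, gridIndex L u (p ω i) j) ?_ i i' hne ⟨hi, rfl⟩ ⟨hi', h.symm⟩
      simpa [Nat.lt_succ_iff] using mem_gridCells.1 hi j
    · intro i hmin hi
      by_contra hbox
      have hz : ∀ j, 1 < p ω i j / u j := fun j => (one_lt_div (hu j)).2 (hi j)
      have hc1 : ∀ j, 1 < ⌈p ω i j / u j⌉₊ := fun j => by
        have := hz j
        exact Nat.lt_ceil.2 (by simpa using this)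
      have hlt : ∀ j, ((⌈p ω i j / u j⌉₊ - 1 : ℕ) : ℝ) * u j < p ω i j := by
        intro j
        rw [← lt_div_iff₀ (hu j), ← Nat.lt_ceil]
        have := hc1 j
        omega
      obtain ⟨j0, hj0⟩ : ∃ j, L * M < gridIndex L u (p ω i) j := by
        by_contra hcon
        push Not at hcon
        exact hbox (mem_gridCells.2 hcon)
      -- `a j = ⌈z j / u j⌉ - 1` is the largest integer with `a j * u j < z j`. It is at least `1`
      -- because the minimum `z` dominates `u`, and at least `M` in a direction in which `z` leaves
      -- the box. A point below the corner `a * u` would be below `z`, contradicting minimality, so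
      -- the region below that corner is empty.
      refine h2 ⟨fun j => ⌈p ω i j / u j⌉₊ - 1, fun j => ?_, j0, ?_⟩ hR ⟨i, hlt⟩ ?_
      · exact Nat.le_sub_one_of_lt (hc1 j)
      · have := (lt_gridIndex_iff hL hu M).1 hj0
        rw [← lt_div_iff₀ (hu j0), ← Nat.lt_ceil] at this
        exact Nat.le_sub_one_of_lt this
      · intro i' hi'
        exact hmin i' fun j => (hi' j).trans (hlt j)
  refine (measure_mono hcov).trans ((measure_union_le _ _).trans (add_le_add ?_ ?_))
  · refine (measure_biUnion_finset_le _ _).trans ?_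
    refine (Finset.sum_le_card_nsmul _ _ (ENNReal.ofReal σ) ?_).trans ?_
    · rintro ⟨j, t⟩ hjt
      simp only [Finset.mem_product, Finset.mem_univ, true_and, Finset.mem_range] at hjt
      exact hslab j t (Nat.lt_succ_iff.1 hjt)
    · simp [Finset.card_product]
  · refine (measure_iUnion_le _).trans ?_
    rw [ENNReal.ofReal_mul hc]
    refine le_trans ?_ (mul_le_mul_right (tsum_exp_neg_prod_le (d := d) (M := M) hw)
      (ENNReal.ofReal c))
    rw [← ENNReal.tsum_mul_left]
    refine ENNReal.tsum_le_tsum fun a => ?_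
    rw [← ENNReal.ofReal_mul hc]
    exact hvoid a.1 a.2.1 a.2.2

theorem abs_measureReal_dominatingMinima_sub_le {d : ℕ} (hd : 1 ≤ d) {Ω : Type*}
    [MeasurableSpace Ω] (P : Measure Ω) [IsFiniteMeasure P] {ι : Ω → Type*}
    (p : ∀ ω, ι ω → Fin d → ℝ) (R : Set Ω)
    {L M : ℕ} (hL : 0 < L) {u : Fin d → ℝ} (hu : ∀ j, 0 < u j) {w c σ : ℝ}
    (hw : 0 < w) (hc : 0 ≤ c) (hσ : 0 ≤ σ)
    (hslab : ∀ j, ∀ t ≤ L * M, P {ω | ∃ i i', i ≠ i' ∧ p ω i ∈ gridSlab (L * M) L u j t ∧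
      p ω i' ∈ gridSlab (L * M) L u j t} ≤ ENNReal.ofReal σ)
    (hvoid : ∀ a : Fin d → ℕ, (∀ j, 1 ≤ a j) → (∃ j, M ≤ a j) →
      P {ω | ω ∈ R ∧ (∃ i, ∀ j, a j * u j < p ω i j) ∧
        ∀ i, ¬ StrongLT (p ω i) fun j => a j * u j} ≤
        ENNReal.ofReal (c * Real.exp (-w * ∏ j, (a j : ℝ))))
    (hm : ∀ T ⊆ gridCells d (L * M),
      MeasurableSet {ω | ω ∈ R ∧ occupiedCells (L * M) L u (p ω) ⊆ T}) (k : ℕ) :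
    |P.real {ω | ω ∈ R ∧ dominatingMinima u (p ω) = k} -
      occupancySum (gridCells d (L * M)) (fun S => gridMinima L S = k)
        (fun T => P.real {ω | ω ∈ R ∧ occupiedCells (L * M) L u (p ω) ⊆ T})| ≤
      (d * (L * M + 1) : ℕ) * σ + c * outTail d M w := by
  rw [← measureReal_occupancy P (gridCells d (L * M))
    (fun ω => occupiedCells (L * M) L u (p ω)) (fun ω c hc => (mem_occupiedCells.1 hc).1) R hm
    (fun S => gridMinima L S = k)]
  refine abs_measureReal_sub_le P (B := {ω | ω ∈ R ∧
    dominatingMinima u (p ω) ≠ gridMinima L (occupiedCells (L * M) L u (p ω))}) ?_ ?_ ?_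
  · rintro ω ⟨⟨hR, h1⟩, h2⟩
    simp only [Set.mem_ofPred_eq, not_and, not_not] at h2
    refine ⟨hR, ?_⟩
    rw [h2 hR] at h1
    exact_mod_cast h1
  · rintro ω ⟨⟨hR, h1⟩, h2⟩
    simp only [Set.mem_ofPred_eq, not_and, not_not] at h2
    exact ⟨hR, by rw [h2 hR, h1]⟩
  · refine ENNReal.toReal_le_of_le_ofReal ?_
      ((measure_dominatingMinima_ne_gridMinima_le hd P p R hL hu hw hc hslab hvoid).trans ?_)
    · have := outTail_nonneg d M hw.le
      positivity
    · have := outTail_nonneg d M hw.le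
      rw [ENNReal.ofReal_add (by positivity) (by positivity),
        ENNReal.ofReal_mul (p := ((d * (L * M + 1) : ℕ) : ℝ)) (Nat.cast_nonneg _),
        ENNReal.ofReal_natCast]

/-! ### Volumes of unions of cells -/

theorem measurableSet_strongLT {α : Type*} [MeasurableSpace α] {d : ℕ} {f g : α → Fin d → ℝ}
    (hf : Measurable f) (hg : Measurable g) : MeasurableSet {a | StrongLT (f a) (g a)} := by
  simp only [StrongLT, Set.ofPred_forall]
  exact MeasurableSet.iInter fun j => measurableSet_lt
    ((measurable_pi_apply j).comp hf) ((measurable_pi_apply j).comp hg)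

theorem measurableSet_forall_pos (d : ℕ) : MeasurableSet {z : Fin d → ℝ | ∀ j, 0 < z j} :=
  measurableSet_strongLT measurable_const measurable_id

theorem measurable_gridIndex {d : ℕ} (L : ℕ) (u : Fin d → ℝ) : Measurable (gridIndex L u) :=
  measurable_pi_lambda _ fun j => Nat.measurable_ceil.comp
    (((measurable_pi_apply j).const_mul _).div_const _)

/-- The part of the positive orthant made of the points dominated by `u` and of the cells of
`T`. -/
def cellRegion {d : ℕ} (L : ℕ) (u : Fin d → ℝ) (T : Finset (Fin d → ℕ)) : Set (Fin d → ℝ) :=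
  {z | (∀ j, 0 < z j) ∧ (StrongLT z u ∨ gridIndex L u z ∈ T)}

theorem measurableSet_cellRegion {d : ℕ} (L : ℕ) (u : Fin d → ℝ) (T : Finset (Fin d → ℕ)) :
    MeasurableSet (cellRegion L u T) :=
  (measurableSet_forall_pos d).inter ((measurableSet_strongLT measurable_id measurable_const).union
    (measurable_gridIndex L u T.measurableSet))

/-- The volume of `cellRegion L 1 T`. -/
def cellVolume {d : ℕ} (L : ℕ) (T : Finset (Fin d → ℕ)) : ℝ :=
  (volume (cellRegion L 1 T)).toReal

theorem map_div_volume {d : ℕ} {u : Fin d → ℝ} (hu : ∀ j, 0 < u j) :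
    (volume : Measure (Fin d → ℝ)).map (fun z j => z j / u j) =
      ENNReal.ofReal (∏ j, u j) • volume := by
  have hp : 0 < ∏ j, u j := Finset.prod_pos fun j _ => hu j
  have hdet : (Matrix.diagonal fun j => (u j)⁻¹).det = (∏ j, u j)⁻¹ := by
    rw [Matrix.det_diagonal, Finset.prod_inv_distrib]
  have h := Real.smul_map_diagonal_volume_pi (D := fun j => (u j)⁻¹)
    (by rw [hdet]; exact (inv_pos.2 hp).ne')
  have hf : ⇑(Matrix.toLin' (Matrix.diagonal fun j => (u j)⁻¹)) =
      fun (z : Fin d → ℝ) j => z j / u j := by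
    ext z j
    simp [Matrix.mulVec_diagonal, div_eq_inv_mul]
  rw [hf, hdet, abs_of_pos (inv_pos.2 hp)] at h
  conv_rhs => rw [← h]
  rw [smul_smul, ← ENNReal.ofReal_mul hp.le, mul_inv_cancel₀ hp.ne', ENNReal.ofReal_one, one_smul]

/-- Rescaling each coordinate by `u j` maps the grid of `u` to the grid of the vector `1`. Hence
void probabilities depend on `u` only through `∏ u j`, which is why the limit law is indexed by a
single real parameter. -/
theorem volume_cellRegion {d : ℕ} (L : ℕ) {u : Fin d → ℝ} (hu : ∀ j, 0 < u j)
    (T : Finset (Fin d → ℕ)) :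
    volume (cellRegion L u T) = ENNReal.ofReal (∏ j, u j) * volume (cellRegion L 1 T) := by
  have hm : Measurable fun (z : Fin d → ℝ) j => z j / u j :=
    measurable_pi_lambda _ fun j => (measurable_pi_apply j).div_const _
  rw [← smul_eq_mul, ← Measure.smul_apply, ← map_div_volume hu,
    Measure.map_apply hm (measurableSet_cellRegion _ _ _)]
  congr 1
  ext z
  have h1 : gridIndex L 1 (fun j => z j / u j) = gridIndex L u z := by
    ext j
    simp [gridIndex, mul_div_assoc]
  simp only [cellRegion, Set.mem_ofPred_eq, Set.mem_preimage, h1, StrongLT, Pi.one_apply]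
  simp [hu, div_lt_one]

theorem volume_pi_Ioc {d : ℕ} (a b : Fin d → ℝ) :
    volume (Set.univ.pi fun j => Set.Ioc (a j) (b j)) = ∏ j, ENNReal.ofReal (b j - a j) := by
  simp [volume_pi_pi]

theorem le_of_gridIndex_le {d L N : ℕ} {u z : Fin d → ℝ} (hL : 0 < L) (hu : ∀ j, 0 < u j)
    {j : Fin d} (h : gridIndex L u z j ≤ L * N) : z j ≤ N * u j := by
  by_contra hc
  exact absurd ((lt_gridIndex_iff hL hu N).2 (not_le.1 hc)) (not_lt.2 h)

theorem cellRegion_subset {d L M : ℕ} (hL : 0 < L) (hM : 0 < M) {u : Fin d → ℝ}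
    (hu : ∀ j, 0 < u j) {T : Finset (Fin d → ℕ)} (hT : T ⊆ gridCells d (L * M)) :
    cellRegion L u T ⊆ Set.univ.pi fun j => Set.Ioc 0 (M * u j) := by
  rintro z ⟨h0, h | h⟩ j -
  · refine ⟨h0 j, (h j).le.trans ?_⟩
    have : (1 : ℝ) ≤ M := by exact_mod_cast hM
    nlinarith [hu j]
  · exact ⟨h0 j, le_of_gridIndex_le hL hu (mem_gridCells.1 (hT h) j)⟩

theorem volume_cellRegion_one_ne_top {d L M : ℕ} (hL : 0 < L) (hM : 0 < M)
    {T : Finset (Fin d → ℕ)} (hT : T ⊆ gridCells d (L * M)) :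
    volume (cellRegion L 1 T) ≠ ∞ := by
  refine ne_top_of_le_ne_top ?_ (measure_mono (cellRegion_subset hL hM (fun _ => one_pos) hT))
  rw [volume_pi_Ioc]
  exact ENNReal.prod_ne_top fun _ _ => ENNReal.ofReal_ne_top

theorem volume_cellRegion_eq {d L M : ℕ} (hL : 0 < L) (hM : 0 < M) {u : Fin d → ℝ}
    (hu : ∀ j, 0 < u j) {T : Finset (Fin d → ℕ)} (hT : T ⊆ gridCells d (L * M)) :
    volume (cellRegion L u T) = ENNReal.ofReal ((∏ j, u j) * cellVolume L T) := by
  rw [volume_cellRegion L hu, ENNReal.ofReal_mul (Finset.prod_nonneg fun j _ => (hu j).le),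
    cellVolume, ENNReal.ofReal_toReal (volume_cellRegion_one_ne_top hL hM hT)]

theorem volume_pos_strongLT {d : ℕ} {v : Fin d → ℝ} (hv : ∀ j, 0 ≤ v j) :
    volume {z : Fin d → ℝ | (∀ j, 0 < z j) ∧ StrongLT z v} = ENNReal.ofReal (∏ j, v j) := by
  have : {z : Fin d → ℝ | (∀ j, 0 < z j) ∧ StrongLT z v} =
      Set.univ.pi fun j => Set.Ioo 0 (v j) := by
    ext z
    simp [StrongLT, Set.mem_pi, forall_and]
  rw [this, volume_pi_pi, ENNReal.ofReal_prod_of_nonneg fun j _ => hv j]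
  simp

theorem measurableSet_gridSlab {d : ℕ} (N L : ℕ) (u : Fin d → ℝ) (j : Fin d) (t : ℕ) :
    MeasurableSet (gridSlab N L u j t) :=
  (measurable_gridIndex L u (gridCells d N).measurableSet).inter
    ((measurable_pi_apply j).comp (measurable_gridIndex L u) (measurableSet_singleton t))

/-- The slab has thickness `u j / L` in direction `j` and side `M u i` in each other direction. -/
theorem volume_gridSlab_le {d L M : ℕ} (hL : 0 < L) {u : Fin d → ℝ} (hu : ∀ j, 0 < u j)
    (j : Fin d) (t : ℕ) :
    volume (gridSlab (L * M) L u j t ∩ {z | ∀ j, 0 < z j}) ≤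
      ENNReal.ofReal ((∏ j, u j) * (M ^ (d - 1) / L)) := by
  have hL' : (0 : ℝ) < L := by exact_mod_cast hL
  have hsub : gridSlab (L * M) L u j t ∩ {z | ∀ j, 0 < z j} ⊆ Set.univ.pi fun i => Set.Ioc
      (if i = j then ((t : ℝ) - 1) * u j / L else 0)
      (if i = j then (t : ℝ) * u j / L else M * u i) := by
    rintro z ⟨⟨h1, h2⟩, h0⟩ i -
    by_cases hi : i = j
    · subst hi
      have hui := hu i
      -- Index `0` means `z i ≤ 0`, which the positive orthant excludes; the natural-number ceiling
      -- truncates there.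
      have ht : t ≠ 0 := by
        rintro rfl
        have : L * z i / u i ≤ 0 := by simpa [gridIndex, Nat.ceil_eq_zero] using h2
        have : 0 < L * z i / u i := div_pos (mul_pos hL' (h0 i)) hui
        linarith
      have h3 := (Nat.ceil_eq_iff ht).1 h2
      rw [Nat.cast_sub (Nat.one_le_iff_ne_zero.2 ht), Nat.cast_one, lt_div_iff₀ hui,
        div_le_iff₀ hui] at h3
      simp only [if_true]
      exact ⟨(div_lt_iff₀' hL').2 h3.1, (le_div_iff₀' hL').2 h3.2⟩
    · simp only [if_neg hi]
      exact ⟨h0 i, le_of_gridIndex_le hL hu (mem_gridCells.1 h1 i)⟩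
  refine (measure_mono hsub).trans (le_of_eq ?_)
  rw [volume_pi_Ioc, ← Finset.mul_prod_erase Finset.univ _ (Finset.mem_univ j),
    ← Finset.mul_prod_erase Finset.univ u (Finset.mem_univ j)]
  rw [Finset.prod_congr rfl fun i (hi : i ∈ Finset.univ.erase j) => by
    rw [if_neg (Finset.ne_of_mem_erase hi), if_neg (Finset.ne_of_mem_erase hi), sub_zero]]
  rw [← ENNReal.ofReal_prod_of_nonneg fun i _ => mul_nonneg (Nat.cast_nonneg _) (hu i).le,
    Finset.prod_mul_distrib, Finset.prod_const, Finset.card_erase_of_mem (Finset.mem_univ j),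
    Finset.card_univ, Fintype.card_fin, ← ENNReal.ofReal_mul]
  · congr 1
    simp only [if_true]
    field_simp
    ring
  · simp only [if_true]
    rw [← sub_div, ← sub_mul]
    have := hu j
    simp only [sub_sub_cancel, one_mul]
    positivity

/-! ### Poisson processes -/

section Poisson

variable {E Ω : Type*} [MeasurableSpace E] [MeasurableSpace Ω] {N : Ω → Set E} {ν : Measure E}
  {P : Measure Ω}

theorem IsPoissonProcess.measure_inter_eq_empty (h : IsPoissonProcess N ν P) {B : Set E}
    (hB : MeasurableSet B) (hfin : ν B ≠ ∞) :
    P {ω | N ω ∩ B = ∅} = ENNReal.ofReal (Real.exp (-(ν B).toReal)) := by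
  have h1 := congrArg (fun μ => μ {(0 : ℕ∞)}) (h.law_count B hB hfin)
  rw [Measure.map_apply (h.measurable_count B hB) (measurableSet_singleton _),
    Measure.map_apply measurable_from_nat (measurableSet_singleton _)] at h1
  have h2 : (Nat.cast : ℕ → ℕ∞) ⁻¹' {0} = {0} := by ext; simp
  have h3 : (fun ω => (N ω ∩ B).encard) ⁻¹' {0} = {ω | N ω ∩ B = ∅} := by
    ext; simp
  rw [h2, h3, poissonMeasure_singleton] at h1
  simpa [ENNReal.toReal] using h1

theorem IsPoissonProcess.measurableSet_inter_eq_empty (h : IsPoissonProcess N ν P) {B : Set E}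
    (hB : MeasurableSet B) : MeasurableSet {ω | N ω ∩ B = ∅} := by
  have h3 : (fun ω => (N ω ∩ B).encard) ⁻¹' {0} = {ω | N ω ∩ B = ∅} := by
    ext; simp
  rw [← h3]
  exact h.measurable_count B hB (measurableSet_singleton _)

/-- The left side is `1 - exp (-l) (1 + l)`, and `exp (-l) ≥ 1 - l` bounds it by `1 - (1 - l) (1 +
l)`. -/
theorem poissonMeasure_one_lt_le (l : ℝ≥0) :
    poissonMeasure l {n | 1 < n} ≤ ENNReal.ofReal ((l : ℝ) ^ 2) := by
  have h1 : {n : ℕ | 1 < n} = (({0, 1} : Finset ℕ) : Set ℕ)ᶜ := by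
    ext n
    simp only [Set.mem_ofPred_eq, Finset.coe_insert, Finset.coe_singleton, Set.mem_compl_iff,
      Set.mem_insert_iff, Set.mem_singleton_iff]
    omega
  rw [h1, prob_compl_eq_one_sub (Finset.measurableSet _), ← sum_measure_singleton,
    Finset.sum_pair (by simp), poissonMeasure_singleton, poissonMeasure_singleton,
    ← ENNReal.ofReal_add (by positivity) (by positivity), ← ENNReal.ofReal_one,
    ← ENNReal.ofReal_sub _ (by positivity)]
  refine ENNReal.ofReal_le_ofReal ?_
  have h2 := Real.add_one_le_exp (-(l : ℝ))
  have h3 : (0 : ℝ) ≤ l := l.2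
  simp only [pow_zero, Nat.factorial_zero, Nat.cast_one, pow_one, Nat.factorial_one]
  nlinarith

theorem IsPoissonProcess.measure_one_lt_le (h : IsPoissonProcess N ν P) {B : Set E}
    (hB : MeasurableSet B) {b : ℝ} (hb : 0 ≤ b) (hfin : ν B ≤ ENNReal.ofReal b) :
    P {ω | 1 < (N ω ∩ B).encard} ≤ ENNReal.ofReal (b ^ 2) := by
  have hne : ν B ≠ ∞ := ne_top_of_le_ne_top ENNReal.ofReal_ne_top hfin
  have h1 := congrArg (fun μ => μ {n : ℕ∞ | 1 < n}) (h.law_count B hB hne)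
  rw [Measure.map_apply (h.measurable_count B hB) (MeasurableSet.of_discrete),
    Measure.map_apply measurable_from_nat (MeasurableSet.of_discrete)] at h1
  have h2 : (Nat.cast : ℕ → ℕ∞) ⁻¹' {n | 1 < n} = {n | 1 < n} := by
    ext; simp
  rw [h2] at h1
  change P ((fun ω => (N ω ∩ B).encard) ⁻¹' {n | 1 < n}) ≤ _
  rw [h1]
  refine (poissonMeasure_one_lt_le _).trans (ENNReal.ofReal_le_ofReal ?_)
  refine pow_le_pow_left₀ NNReal.zero_le_coe ?_ 2
  exact ENNReal.toReal_le_of_le_ofReal hb hfin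

end Poisson

/-- A function that is approximated in probability by measurable functions with values in `ℕ` is
almost everywhere measurable and finite. -/
theorem aemeasurable_of_tendsto_measure_ne {Ω : Type*} [MeasurableSpace Ω] {P : Measure Ω}
    {K : Ω → ℕ∞} {Km : ℕ → Ω → ℕ} (hKm : ∀ m, Measurable (Km m))
    (h : Tendsto (fun m => P {ω | K ω ≠ Km m ω}) atTop (𝓝 0)) :
    AEMeasurable K P ∧ ∀ᵐ ω ∂P, K ω ≠ ⊤ := by
  have h1 : ∀ i : ℕ, ∃ m, P {ω | K ω ≠ Km m ω} ≤ (2⁻¹ : ℝ≥0∞) ^ i := fun i =>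
    (h.eventually_le_const (ENNReal.pow_pos (by simp) i)).exists
  choose φ hφ using h1
  have hsum : ∑' i, P {ω | K ω ≠ Km (φ i) ω} ≠ ∞ := by
    refine ne_top_of_le_ne_top ?_ (ENNReal.tsum_le_tsum hφ)
    rw [ENNReal.tsum_geometric]
    simp
  -- Borel–Cantelli along a subsequence with summable errors. It needs only outer measure, so it
  -- applies before `K` is known to be measurable.
  have hae : ∀ᵐ ω ∂P, ∀ᶠ i in atTop, K ω = Km (φ i) ω := by
    filter_upwards [ae_eventually_notMem hsum] with ω hω
    filter_upwards [hω] with i hi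
    simpa using hi
  constructor
  · refine NullMeasurable.aemeasurable fun s hs => ?_
    have hms : MeasurableSet (⋃ i0, ⋂ i, ⋂ (_ : i0 ≤ i),
        (fun ω => (Km (φ i) ω : ℕ∞)) ⁻¹' s) :=
      MeasurableSet.iUnion fun i0 => MeasurableSet.iInter fun i => MeasurableSet.iInter fun _ =>
        (measurable_from_nat.comp (hKm (φ i))) hs
    refine hms.nullMeasurableSet.congr (eventuallyEq_set.2 ?_)
    filter_upwards [hae] with ω hω
    obtain ⟨i0, hi0⟩ := eventually_atTop.1 hω
    refine Iff.trans (b := ∃ i0, ∀ i ≥ i0, (Km (φ i) ω : ℕ∞) ∈ s) (by simp) ?_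
    · rw [Set.mem_preimage]
      constructor
      · rintro ⟨i1, hi1⟩
        rw [hi0 (max i0 i1) (le_max_left _ _)]
        exact hi1 _ (le_max_right _ _)
      · intro hK
        exact ⟨i0, fun i hi => by rwa [← hi0 i hi]⟩
  · filter_upwards [hae] with ω hω
    obtain ⟨i, hi⟩ := hω.exists
    rw [hi]
    exact ENat.natCast_ne_top _

/-! ### The number of minima in a Poisson process -/

theorem dominatingMinima_val {d : ℕ} (u : Fin d → ℝ) (S : Set (Fin d → ℝ)) :
    dominatingMinima u (Subtype.val : S → Fin d → ℝ) =
      numMaximaBelow (Function.swap StrongLT) S u := by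
  rw [dominatingMinima, numMaximaBelow, ← Subtype.val_injective.encard_image]
  congr 1
  ext z
  simp only [IsMaximum, Function.swap, Set.mem_image, Set.mem_ofPred_eq, Subtype.forall,
    Subtype.exists, exists_and_right, exists_eq_right]
  tauto

/-! ### Discretization error and discretized limit law -/

/-- The number of subdivisions of the unit interval that goes with a box of size `M`. -/
def gridMesh (d M : ℕ) : ℕ := M ^ (2 * d)

/-- The bound for the discretization error. -/
def gridError (d M : ℕ) (w : ℝ) : ℝ :=
  (d * (gridMesh d M * M + 1) : ℕ) * (w * (M ^ (d - 1) / gridMesh d M)) ^ 2 + outTail d M w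

/-- The discretized law of the number of minima, for a Poisson process. -/
def gridLimit (d M k : ℕ) (w : ℝ) : ℝ :=
  occupancySum (gridCells d (gridMesh d M * M)) (fun S => gridMinima (gridMesh d M) S = k)
    fun T => Real.exp (-w * cellVolume (gridMesh d M) (gridCells d (gridMesh d M * M) \ T))

theorem measurable_gridError (d M : ℕ) : Measurable (gridError d M) := by
  have := measurable_outTail d M
  unfold gridError
  fun_prop

theorem measurable_gridLimit (d M k : ℕ) : Measurable (gridLimit d M k) :=
  measurable_occupancySum _ _ fun T => by fun_prop

theorem gridError_nonneg (d M : ℕ) {w : ℝ} (hw : 0 ≤ w) : 0 ≤ gridError d M w := by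
  have := outTail_nonneg d M hw
  unfold gridError
  positivity

/-- With mesh number `L = M ^ (2 d)` there are about `d L M` slabs, each with collision bound `(w M
^ (d - 1) / L) ^ 2`. Together they contribute at most `2 d w ^ 2 / M`, and `outTail` decays
exponentially in `M`. -/
theorem tendsto_gridError {d : ℕ} (hd : 1 ≤ d) {w : ℝ} (hw : 0 < w) :
    Tendsto (fun M => gridError d M w) atTop (𝓝 0) := by
  have h1 : Tendsto (fun M : ℕ => 2 * d * w ^ 2 / (M : ℝ) + outTail d M w) atTop (𝓝 0) := by
    simpa using (tendsto_const_div_atTop_nhds_zero_nat (2 * d * w ^ 2)).add (tendsto_outTail d hw)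
  refine tendsto_of_tendsto_of_tendsto_of_le_of_le' tendsto_const_nhds h1
    (Eventually.of_forall fun M => gridError_nonneg d M hw.le) ?_
  filter_upwards [eventually_ge_atTop 1] with M hM
  refine add_le_add_left ?_ _
  have hM' : (1 : ℝ) ≤ M := by exact_mod_cast hM
  have hM0 : (0 : ℝ) < M := by linarith
  have hL : (1 : ℝ) ≤ M ^ (2 * d) * M := by
    rw [← pow_succ]
    exact one_le_pow₀ hM'
  obtain ⟨e, rfl⟩ : ∃ e, d = e + 1 := ⟨d - 1, by omega⟩
  simp only [gridMesh, Nat.add_sub_cancel]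
  push_cast at hL ⊢
  calc ((e : ℝ) + 1) * ((M : ℝ) ^ (2 * (e + 1)) * M + 1) *
        (w * ((M : ℝ) ^ e / (M : ℝ) ^ (2 * (e + 1)))) ^ 2
      ≤ ((e : ℝ) + 1) * ((M : ℝ) ^ (2 * (e + 1)) * M + (M : ℝ) ^ (2 * (e + 1)) * M) *
        (w * ((M : ℝ) ^ e / (M : ℝ) ^ (2 * (e + 1)))) ^ 2 := by gcongr
    _ = 2 * (e + 1) * w ^ 2 / M := by
        field_simp
        ring

/-! ### Estimates for the homogeneous Poisson process off the corner below `u` -/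

section Unit

variable {d : ℕ} {Ω : Type*} [MeasurableSpace Ω] {P : Measure Ω}
  {N : Ω → Set (Fin d → ℝ)} {u : Fin d → ℝ}

/-- Adding the corner below `u` to `A` and then removing it makes the measure a difference of two
orthant volumes. The first is computed by scaling and the second is `∏ u j`. -/
theorem unitIntensity_apply (u : Fin d → ℝ) {A : Set (Fin d → ℝ)} (hA : MeasurableSet A) :
    unitIntensity u A =
      volume (({z | ∀ j, 0 < z j} ∩ ({z | StrongLT z u} ∪ A)) \
        {z | (∀ j, 0 < z j) ∧ StrongLT z u}) := by
  rw [unitIntensity, Measure.restrict_apply hA]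
  congr 1
  ext z
  simp only [Set.mem_inter_iff, Set.mem_ofPred_eq, Set.mem_sdiff, Set.mem_union]
  tauto

theorem unitIntensity_toReal (hu : ∀ j, 0 < u j) {A : Set (Fin d → ℝ)} (hA : MeasurableSet A)
    {v : ℝ} (hv : 0 ≤ v)
    (h : volume ({z | ∀ j, 0 < z j} ∩ ({z | StrongLT z u} ∪ A)) = ENNReal.ofReal v) :
    unitIntensity u A ≠ ∞ ∧ (unitIntensity u A).toReal = v - ∏ j, u j := by
  have h0 := volume_pos_strongLT fun j => (hu j).le
  have hm : MeasurableSet {z : Fin d → ℝ | (∀ j, 0 < z j) ∧ StrongLT z u} :=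
    (measurableSet_forall_pos d).inter (measurableSet_strongLT measurable_id measurable_const)
  have hsub : {z : Fin d → ℝ | (∀ j, 0 < z j) ∧ StrongLT z u} ⊆
      {z | ∀ j, 0 < z j} ∩ ({z | StrongLT z u} ∪ A) := fun z hz => ⟨hz.1, Or.inl hz.2⟩
  have hp : 0 ≤ ∏ j, u j := Finset.prod_nonneg fun j _ => (hu j).le
  have hle : ∏ j, u j ≤ v := by
    have := measure_mono (μ := volume) hsub
    rw [h, h0] at this
    exact (ENNReal.ofReal_le_ofReal_iff hv).1 this
  rw [unitIntensity_apply u hA, measure_sdiff hsub hm.nullMeasurableSet (by simp [h0]), h, h0,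
    ← ENNReal.ofReal_sub _ hp]
  exact ⟨ENNReal.ofReal_ne_top, ENNReal.toReal_ofReal (by linarith)⟩

theorem gridMesh_pos (d : ℕ) {M : ℕ} (hM : 0 < M) : 0 < gridMesh d M := pow_pos hM _

theorem occupiedCells_subset_iff {ι : Type*} {N L : ℕ} {p : ι → Fin d → ℝ}
    {T : Finset (Fin d → ℕ)} : occupiedCells N L u p ⊆ T ↔
      ∀ i, gridIndex L u (p i) ∉ gridCells d N \ T := by
  simp only [Finset.subset_iff, mem_occupiedCells, Finset.mem_sdiff]
  constructor
  · rintro h i ⟨h1, h2⟩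
    exact h2 (h ⟨h1, i, rfl⟩)
  · rintro h c ⟨h1, i, rfl⟩
    by_contra h2
    exact h i ⟨h1, h2⟩

theorem IsPoissonProcess.slab_le (h : IsPoissonProcess N (unitIntensity u) P)
    (hu : ∀ j, 0 < u j) {L M : ℕ} (hL : 0 < L) (j : Fin d) (t : ℕ) :
    P {ω | ∃ i i' : N ω, i ≠ i' ∧ (i : Fin d → ℝ) ∈ gridSlab (L * M) L u j t ∧
      (i' : Fin d → ℝ) ∈ gridSlab (L * M) L u j t} ≤
      ENNReal.ofReal (((∏ j, u j) * (M ^ (d - 1) / L)) ^ 2) := by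
  have hp : 0 ≤ ∏ j, u j := Finset.prod_nonneg fun j _ => (hu j).le
  have h1 := h.measure_one_lt_le (measurableSet_gridSlab (L * M) L u j t)
    (b := (∏ j, u j) * (M ^ (d - 1) / L)) (by positivity) ?_
  · refine (measure_mono ?_).trans h1
    rintro ω ⟨i, i', hne, hi, hi'⟩
    exact Set.one_lt_encard_iff.2 ⟨i, i', ⟨i.2, hi⟩, ⟨i'.2, hi'⟩, fun h => hne (Subtype.ext h)⟩
  · refine le_trans ?_ (volume_gridSlab_le hL hu j t)
    rw [unitIntensity, Measure.restrict_apply (measurableSet_gridSlab _ _ _ _ _)]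
    exact measure_mono (Set.inter_subset_inter_right _ fun z hz => hz.1)

/-- The region below `a * u` has volume `∏ (a j * u j)`, of which the corner below `u` carries no
intensity. This is the source of the factor `exp (∏ u j)`. -/
theorem IsPoissonProcess.corner_le (h : IsPoissonProcess N (unitIntensity u) P)
    (hu : ∀ j, 0 < u j) (a : Fin d → ℕ) (ha : ∀ j, 1 ≤ a j) :
    P {ω | ω ∈ Set.univ ∧ (∃ i : N ω, ∀ j, a j * u j < (i : Fin d → ℝ) j) ∧
        ∀ i : N ω, ¬ StrongLT (i : Fin d → ℝ) fun j => a j * u j} ≤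
      ENNReal.ofReal (Real.exp (∏ j, u j) * Real.exp (-(∏ j, u j) * ∏ j, (a j : ℝ))) := by
  have hA : MeasurableSet {z : Fin d → ℝ | StrongLT z fun j => a j * u j} :=
    measurableSet_strongLT measurable_id measurable_const
  have hle : ∀ j, u j ≤ a j * u j := fun j =>
    le_mul_of_one_le_left (hu j).le (by exact_mod_cast ha j)
  obtain ⟨h1, h2⟩ := unitIntensity_toReal hu hA (v := ∏ j, (a j * u j : ℝ))
    (Finset.prod_nonneg fun j _ => (hu j).le.trans (hle j)) (by
      rw [← volume_pos_strongLT fun j => (hu j).le.trans (hle j)]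
      congr 1
      ext z
      simp only [Set.mem_inter_iff, Set.mem_ofPred_eq, Set.mem_union]
      exact and_congr_right fun _ => ⟨fun h => h.elim (fun h j => (h j).trans_le (hle j)) id,
        Or.inr⟩)
  have h3 := h.measure_inter_eq_empty hA h1
  rw [h2] at h3
  refine (measure_mono ?_).trans (h3.le.trans (le_of_eq ?_))
  · rintro ω ⟨-, -, hω⟩
    simp only [Set.mem_ofPred_eq, Set.eq_empty_iff_forall_notMem]
    rintro z ⟨hz, hz'⟩
    exact hω ⟨z, hz⟩ hz'
  · rw [← Real.exp_add, Finset.prod_mul_distrib]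
    congr 2
    ring

/-- The event says that no point falls in the cells of the box outside `T`. `cellVolume` also counts
the corner, which has no intensity here; the factor `exp (∏ u j)` compensates. -/
theorem IsPoissonProcess.occupied_subset (h : IsPoissonProcess N (unitIntensity u) P)
    (hu : ∀ j, 0 < u j) {L M : ℕ} (hL : 0 < L) (hM : 0 < M) (T : Finset (Fin d → ℕ)) :
    MeasurableSet {ω | ω ∈ Set.univ ∧
      occupiedCells (L * M) L u (Subtype.val : N ω → Fin d → ℝ) ⊆ T} ∧
    P.real {ω | ω ∈ Set.univ ∧ occupiedCells (L * M) L u (Subtype.val : N ω → Fin d → ℝ) ⊆ T} =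
      Real.exp (∏ j, u j) *
        Real.exp (-(∏ j, u j) * cellVolume L (gridCells d (L * M) \ T)) := by
  have hA : MeasurableSet {z : Fin d → ℝ | gridIndex L u z ∈ gridCells d (L * M) \ T} :=
    measurable_gridIndex L u (Finset.measurableSet _)
  have hp : 0 ≤ ∏ j, u j := Finset.prod_nonneg fun j _ => (hu j).le
  have hset : {ω | ω ∈ Set.univ ∧
      occupiedCells (L * M) L u (Subtype.val : N ω → Fin d → ℝ) ⊆ T} =
      {ω | N ω ∩ {z | gridIndex L u z ∈ gridCells d (L * M) \ T} = ∅} := by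
    ext ω
    simp only [Set.mem_ofPred_eq, Set.mem_univ, true_and, occupiedCells_subset_iff,
      Set.eq_empty_iff_forall_notMem, Set.mem_inter_iff, not_and, Subtype.forall]
  obtain ⟨h1, h2⟩ := unitIntensity_toReal hu hA
    (v := (∏ j, u j) * cellVolume L (gridCells d (L * M) \ T))
    (mul_nonneg hp ENNReal.toReal_nonneg)
    (volume_cellRegion_eq hL hM hu Finset.sdiff_subset)
  rw [hset]
  refine ⟨h.measurableSet_inter_eq_empty hA, ?_⟩
  rw [measureReal_def, h.measure_inter_eq_empty hA h1, h2,
    ENNReal.toReal_ofReal (Real.exp_pos _).le, ← Real.exp_add]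
  congr 1
  ring

/-- The factor `exp (-∏ u j)` is the probability that a unit-rate process on the whole orthant has
no point below `u`. With it, the Poisson quantity matches the joint probability of a record and of
`k` broken records for a sample, and the compensating factors of the void estimates cancel. -/
theorem IsPoissonProcess.abs_measureReal_sub_gridLimit_le [IsFiniteMeasure P] (hd : 1 ≤ d)
    (h : IsPoissonProcess N (unitIntensity u) P) (hu : ∀ j, 0 < u j) {M : ℕ} (hM : 0 < M)
    (k : ℕ) :
    |Real.exp (-∏ j, u j) * P.real {ω | numMaximaBelow (Function.swap StrongLT) (N ω) u = k} -
      gridLimit d M k (∏ j, u j)| ≤ gridError d M (∏ j, u j) := by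
  set w := ∏ j, u j with hw
  have hw0 : 0 < w := Finset.prod_pos fun j _ => hu j
  have hL := gridMesh_pos d hM
  have key := abs_measureReal_dominatingMinima_sub_le hd P (fun ω => (Subtype.val : N ω → _))
    Set.univ (M := M) hL hu hw0 (Real.exp_pos w).le (sq_nonneg _) (fun j t _ => h.slab_le hu hL j t)
    (fun a ha _ => h.corner_le hu a ha) (fun T _ => (h.occupied_subset hu hL hM T).1) k
  simp_rw [(h.occupied_subset hu hL hM _).2, ← hw, occupancySum_const_mul, Set.mem_univ, true_and,
    dominatingMinima_val] at key
  have hsplit : ∀ x : ℝ, x = Real.exp (-w) * (Real.exp w * x) := fun x => by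
    rw [← mul_assoc, ← Real.exp_add, neg_add_cancel, Real.exp_zero, one_mul]
  rw [hsplit (gridLimit d M k w), ← mul_sub, abs_mul, abs_of_pos (Real.exp_pos _)]
  refine (mul_le_mul_of_nonneg_left key (Real.exp_pos _).le).trans ?_
  rw [mul_add, ← hsplit, gridError]
  refine add_le_add_left (mul_le_of_le_one_left (by positivity) ?_) _
  exact Real.exp_le_one_iff.2 (by linarith)

theorem IsPoissonProcess.tendsto_gridLimit [IsFiniteMeasure P] (hd : 1 ≤ d)
    (h : IsPoissonProcess N (unitIntensity u) P) (hu : ∀ j, 0 < u j) (k : ℕ) :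
    Tendsto (fun M => gridLimit d M k (∏ j, u j)) atTop
      (𝓝 (Real.exp (-∏ j, u j) *
        P.real {ω | numMaximaBelow (Function.swap StrongLT) (N ω) u = k})) := by
  rw [tendsto_iff_norm_sub_tendsto_zero]
  refine squeeze_zero' (Eventually.of_forall fun _ => norm_nonneg _) ?_
    (tendsto_gridError hd (w := ∏ j, u j) (Finset.prod_pos fun j _ => hu j))
  filter_upwards [eventually_gt_atTop 0] with M hM
  rw [norm_sub_rev]
  exact h.abs_measureReal_sub_gridLimit_le hd hu hM k

/-- `IsPoissonProcess` postulates only measurability of counts. The number of minima inherits almost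
everywhere measurability and finiteness from the grid counts, which are measurable and approximate
it in probability. -/
theorem IsPoissonProcess.aemeasurable_numMaximaBelow (hd : 1 ≤ d)
    (h : IsPoissonProcess N (unitIntensity u) P) (hu : ∀ j, 0 < u j) :
    AEMeasurable (fun ω => numMaximaBelow (Function.swap StrongLT) (N ω) u) P ∧
      ∀ᵐ ω ∂P, numMaximaBelow (Function.swap StrongLT) (N ω) u ≠ ⊤ := by
  set w := ∏ j, u j with hw
  have hw0 : 0 < w := Finset.prod_pos fun j _ => hu j
  have hL : ∀ m, 0 < gridMesh d (m + 1) := fun m => gridMesh_pos d m.succ_pos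
  refine aemeasurable_of_tendsto_measure_ne (Km := fun m ω => gridMinima (gridMesh d (m + 1))
    (occupiedCells (gridMesh d (m + 1) * (m + 1)) (gridMesh d (m + 1)) u
      (Subtype.val : N ω → _))) (fun m => ?_) ?_
  · refine measurable_to_countable' fun k => ?_
    have := measurableSet_occupancy (gridCells d (gridMesh d (m + 1) * (m + 1)))
      (fun ω => occupiedCells (gridMesh d (m + 1) * (m + 1)) (gridMesh d (m + 1)) u
        (Subtype.val : N ω → _)) (fun ω c hc => (mem_occupiedCells.1 hc).1) Set.univ
      (fun T _ => (h.occupied_subset hu (hL m) m.succ_pos T).1)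
      (fun S => gridMinima (gridMesh d (m + 1)) S = k)
    convert this using 1
    ext ω
    simp
  · have hlim : Tendsto (fun m => ENNReal.ofReal (Real.exp w * gridError d (m + 1) w)) atTop
        (𝓝 0) := by
      have := ((tendsto_gridError hd hw0).comp (tendsto_add_atTop_nat 1)).const_mul (Real.exp w)
      simpa using ENNReal.tendsto_ofReal this
    refine tendsto_of_tendsto_of_tendsto_of_le_of_le tendsto_const_nhds hlim (fun _ => zero_le)
      fun m => ?_
    have key := measure_dominatingMinima_ne_gridMinima_le hd P
      (fun ω => (Subtype.val : N ω → _)) Set.univ (M := m + 1) (hL m) hu hw0 (Real.exp_pos w).le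
      (fun j t _ => h.slab_le hu (hL m) j t) (fun a ha _ => h.corner_le hu a ha)
    simp_rw [Set.mem_univ, true_and, dominatingMinima_val] at key
    refine key.trans ?_
    have h0 := outTail_nonneg d (m + 1) hw0.le
    rw [gridError, mul_add (Real.exp w), ENNReal.ofReal_add (by positivity) (by positivity)]
    refine add_le_add_left ?_ _
    rw [← ENNReal.ofReal_natCast, ← ENNReal.ofReal_mul (Nat.cast_nonneg _)]
    refine ENNReal.ofReal_le_ofReal ?_
    exact le_mul_of_one_le_left (by positivity) (Real.one_le_exp hw0.le)

end Unit

/-! ### Uniform samples -/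

/-- The uniform distribution on the unit cube. -/
def cubeMeasure (d : ℕ) : Measure (Fin d → ℝ) :=
  volume.restrict (Set.univ.pi fun _ => Set.Ioo 0 1)

theorem measurableSet_cube (d : ℕ) :
    MeasurableSet (Set.univ.pi fun _ : Fin d => Set.Ioo (0 : ℝ) 1) :=
  MeasurableSet.univ_pi fun _ => measurableSet_Ioo

instance (d : ℕ) : IsProbabilityMeasure (cubeMeasure d) := by
  constructor
  simp [cubeMeasure, volume_pi_pi]

/-- The law of `n` independent uniform points of the unit cube. -/
def sampleMeasure (d n : ℕ) : Measure (Fin n → Fin d → ℝ) :=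
  Measure.pi fun _ => cubeMeasure d

instance (d n : ℕ) : IsProbabilityMeasure (sampleMeasure d n) := by
  unfold sampleMeasure; infer_instance

theorem sampleMeasure_forall_notMem {d : ℕ} (n : ℕ) {A : Set (Fin d → ℝ)} (hA : MeasurableSet A) :
    sampleMeasure d n {x | ∀ i, x i ∉ A} = (1 - cubeMeasure d A) ^ n := by
  have : {x : Fin n → Fin d → ℝ | ∀ i, x i ∉ A} = Set.univ.pi fun _ => Aᶜ := by
    ext x; simp
  rw [this, sampleMeasure, Measure.pi_pi]
  simp [prob_compl_eq_one_sub hA]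

theorem sampleMeasure_pair {d n : ℕ} {i i' : Fin n} (h : i ≠ i') (A : Set (Fin d → ℝ)) :
    sampleMeasure d n {x | x i ∈ A ∧ x i' ∈ A} = cubeMeasure d A ^ 2 := by
  have : {x : Fin n → Fin d → ℝ | x i ∈ A ∧ x i' ∈ A} =
      Set.univ.pi fun l => if l ∈ ({i, i'} : Finset (Fin n)) then A else Set.univ := by
    ext x
    simp only [Set.mem_ofPred_eq, Set.mem_pi, Set.mem_univ, true_imp_iff]
    constructor
    · rintro ⟨h1, h2⟩ l
      split_ifs with hl
      · simp only [Finset.mem_insert, Finset.mem_singleton] at hl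
        rcases hl with rfl | rfl <;> assumption
      · trivial
    · intro hx
      have h1 := hx i
      have h2 := hx i'
      simp only [Finset.mem_insert, true_or, if_true, Finset.mem_singleton, or_true] at h1 h2
      exact ⟨h1, h2⟩
  rw [this, sampleMeasure, Measure.pi_pi]
  simp_rw [apply_ite (cubeMeasure d), measure_univ]
  rw [Finset.prod_ite_mem, Finset.univ_inter, Finset.prod_const, Finset.card_pair h]

theorem measurableSet_sample_forall_notMem {d : ℕ} (n : ℕ) {A : Set (Fin d → ℝ)}
    (hA : MeasurableSet A) : MeasurableSet {x : Fin n → Fin d → ℝ | ∀ i, x i ∉ A} := by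
  have : {x : Fin n → Fin d → ℝ | ∀ i, x i ∉ A} = Set.univ.pi fun _ => Aᶜ := by
    ext x; simp
  rw [this]
  exact MeasurableSet.univ_pi fun _ => hA.compl

theorem one_sub_pow_le_exp {v : ℝ} (hv : v ≤ 1) (n : ℕ) : (1 - v) ^ n ≤ Real.exp (-(n * v)) := by
  rw [neg_mul_eq_mul_neg, Real.exp_nat_mul]
  refine pow_le_pow_left₀ (by linarith) ?_ n
  linarith [Real.add_one_le_exp (-v)]

/-! ### Estimates for `n` independent uniform points -/

section Sample

variable {d n : ℕ} {u : Fin d → ℝ}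

theorem sampleMeasure_forall_notMem_eq {A : Set (Fin d → ℝ)}
    (hA : MeasurableSet A) {v : ℝ} (hv0 : 0 ≤ v) (hv : cubeMeasure d A = ENNReal.ofReal v) :
    v ≤ 1 ∧ sampleMeasure d n {x | ∀ i, x i ∉ A} = ENNReal.ofReal ((1 - v) ^ n) := by
  have hv1 : v ≤ 1 := by
    have : ENNReal.ofReal v ≤ 1 := hv ▸ prob_le_one
    exact ENNReal.ofReal_le_one.1 this
  refine ⟨hv1, ?_⟩
  rw [sampleMeasure_forall_notMem n hA, hv, ← ENNReal.ofReal_one, ← ENNReal.ofReal_sub _ hv0,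
    ENNReal.ofReal_pow (by linarith)]

theorem cubeMeasure_strongLT {v : Fin d → ℝ} (hv0 : ∀ j, 0 ≤ v j) (hv1 : ∀ j, v j ≤ 1) :
    cubeMeasure d {z | StrongLT z v} = ENNReal.ofReal (∏ j, v j) := by
  have hm : MeasurableSet {z : Fin d → ℝ | StrongLT z v} :=
    measurableSet_strongLT measurable_id measurable_const
  rw [cubeMeasure, Measure.restrict_apply hm, ← volume_pos_strongLT hv0]
  congr 1
  ext z
  simp only [Set.mem_inter_iff, Set.mem_ofPred_eq, Set.mem_pi, Set.mem_univ, true_imp_iff,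
    Set.mem_Ioo]
  exact ⟨fun h => ⟨fun j => (h.2 j).1, h.1⟩,
    fun h => ⟨h.2, fun j => ⟨h.1 j, (h.2 j).trans_le (hv1 j)⟩⟩⟩

/-- Union bound over at most `n ^ 2` ordered pairs. The bound is the Poisson one with `n * ∏ u j` in
place of `∏ u j`. -/
theorem sampleMeasure_slab_le (hu : ∀ j, 0 < u j) {L M : ℕ} (hL : 0 < L) (j : Fin d) (t : ℕ) :
    sampleMeasure d n {x | ∃ i i', i ≠ i' ∧ x i ∈ gridSlab (L * M) L u j t ∧
      x i' ∈ gridSlab (L * M) L u j t} ≤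
      ENNReal.ofReal ((n * (∏ j, u j) * (M ^ (d - 1) / L)) ^ 2) := by
  have hp : 0 ≤ ∏ j, u j := Finset.prod_nonneg fun j _ => (hu j).le
  have h1 : cubeMeasure d (gridSlab (L * M) L u j t) ≤
      ENNReal.ofReal ((∏ j, u j) * (M ^ (d - 1) / L)) := by
    refine le_trans ?_ (volume_gridSlab_le hL hu j t)
    rw [cubeMeasure, Measure.restrict_apply (measurableSet_gridSlab _ _ _ _ _)]
    exact measure_mono (Set.inter_subset_inter_right _ fun z hz j => (hz j trivial).1)
  have hcov : {x : Fin n → Fin d → ℝ | ∃ i i', i ≠ i' ∧ x i ∈ gridSlab (L * M) L u j t ∧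
      x i' ∈ gridSlab (L * M) L u j t} ⊆
      ⋃ q ∈ (Finset.univ : Finset (Fin n × Fin n)).filter fun q => q.1 ≠ q.2,
        {x | x q.1 ∈ gridSlab (L * M) L u j t ∧ x q.2 ∈ gridSlab (L * M) L u j t} := by
    rintro x ⟨i, i', hne, h⟩
    exact Set.mem_biUnion (x := (i, i')) (by simpa using hne) h
  refine (measure_mono hcov).trans ((measure_biUnion_finset_le _ _).trans ?_)
  calc ∑ q ∈ (Finset.univ : Finset (Fin n × Fin n)).filter fun q => q.1 ≠ q.2, sampleMeasure d n
        {x | x q.1 ∈ gridSlab (L * M) L u j t ∧ x q.2 ∈ gridSlab (L * M) L u j t}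
      ≤ ∑ q ∈ (Finset.univ : Finset (Fin n × Fin n)).filter fun q => q.1 ≠ q.2,
        ENNReal.ofReal ((∏ j, u j) * (M ^ (d - 1) / L)) ^ 2 := by
        refine Finset.sum_le_sum fun q hq => ?_
        rw [sampleMeasure_pair (Finset.mem_filter.1 hq).2]
        gcongr
    _ ≤ ∑ q : Fin n × Fin n, ENNReal.ofReal ((∏ j, u j) * (M ^ (d - 1) / L)) ^ 2 :=
        Finset.sum_le_sum_of_subset (Finset.filter_subset _ _)
    _ = ENNReal.ofReal ((n * (∏ j, u j) * (M ^ (d - 1) / L)) ^ 2) := by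
        rw [Finset.sum_const, Finset.card_univ, Fintype.card_prod, Fintype.card_fin,
          nsmul_eq_mul, ← ENNReal.ofReal_pow (by positivity), ← ENNReal.ofReal_natCast,
          ← ENNReal.ofReal_mul (Nat.cast_nonneg _)]
        congr 1
        push_cast
        ring

theorem sampleMeasure_corner_le (hu : ∀ j, 0 < u j) (R : Set (Fin n → Fin d → ℝ))
    (a : Fin d → ℕ) :
    sampleMeasure d n {x | x ∈ R ∧ (∃ i, ∀ j, a j * u j < x i j) ∧
        ∀ i, ¬ StrongLT (x i) fun j => a j * u j} ≤
      ENNReal.ofReal (1 * Real.exp (-(n * ∏ j, u j) * ∏ j, (a j : ℝ))) := by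
  have h0 : ∀ j, 0 ≤ a j * u j := fun j => mul_nonneg (Nat.cast_nonneg _) (hu j).le
  by_cases h : ∀ j, a j * u j ≤ 1
  · have hc := cubeMeasure_strongLT h0 h
    obtain ⟨h1, h2⟩ := sampleMeasure_forall_notMem_eq (n := n)
      (measurableSet_strongLT measurable_id measurable_const)
      (Finset.prod_nonneg fun j _ => h0 j) hc
    refine (measure_mono fun x hx => ?_).trans (h2.le.trans (ENNReal.ofReal_le_ofReal ?_))
    · exact hx.2.2
    · refine (one_sub_pow_le_exp h1 n).trans (le_of_eq ?_)
      rw [Finset.prod_mul_distrib, one_mul]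
      congr 1
      ring
  -- If the corner `a * u` is outside the cube, almost surely no sample point lies beyond it. This
  -- is why the event asks for a point beyond the corner and not only for emptiness below it.
  · push Not at h
    obtain ⟨j, hj⟩ := h
    refine le_trans (le_of_eq ?_) zero_le
    refine measure_mono_null (t := ⋃ i, (fun x => x i) ⁻¹'
      (Set.univ.pi fun _ => Set.Ioo 0 1)ᶜ) ?_ (measure_iUnion_null fun i => ?_)
    · rintro x ⟨-, ⟨i, hi⟩, -⟩
      refine Set.mem_iUnion.2 ⟨i, fun hx => ?_⟩
      have := (hx j trivial).2
      linarith [hi j]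
    · rw [sampleMeasure, (measurePreserving_eval (fun _ => cubeMeasure d) i).measure_preimage
        (measurableSet_cube d).compl.nullMeasurableSet]
      simp [cubeMeasure, Measure.restrict_apply (measurableSet_cube d).compl]

/-- The event says that all points avoid the corner and the cells of the box outside `T`. The
condition `M * u j < 1` keeps that region inside the cube, so its probability is its orthant volume.
The form `(1 + x / n) ^ n` prepares the limit `exp x`. -/
theorem sampleMeasure_occupied_subset (hu : ∀ j, 0 < u j) {L M : ℕ} (hL : 0 < L) (hM : 0 < M)
    (hMu : ∀ j, M * u j < 1) (hn : 0 < n) (T : Finset (Fin d → ℕ)) :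
    MeasurableSet {x : Fin n → Fin d → ℝ | x ∈ {x : Fin n → Fin d → ℝ | ∀ i, ¬ StrongLT (x i) u} ∧
      occupiedCells (L * M) L u x ⊆ T} ∧
    (sampleMeasure d n).real {x | x ∈ {x : Fin n → Fin d → ℝ | ∀ i, ¬ StrongLT (x i) u} ∧
      occupiedCells (L * M) L u x ⊆ T} =
      (1 + -(n * ∏ j, u j) * cellVolume L (gridCells d (L * M) \ T) / n) ^ n := by
  set A : Set (Fin d → ℝ) := {z | StrongLT z u} ∪
    {z | gridIndex L u z ∈ gridCells d (L * M) \ T} with hAdef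
  have hA : MeasurableSet A := (measurableSet_strongLT measurable_id measurable_const).union
    (measurable_gridIndex L u (Finset.measurableSet _))
  have hp : 0 ≤ ∏ j, u j := Finset.prod_nonneg fun j _ => (hu j).le
  have hset : {x | x ∈ {x : Fin n → Fin d → ℝ | ∀ i, ¬ StrongLT (x i) u} ∧
      occupiedCells (L * M) L u x ⊆ T} = {x | ∀ i, x i ∉ A} := by
    ext x
    simp only [Set.mem_ofPred_eq, occupiedCells_subset_iff, hAdef, Set.mem_union, not_or,
      forall_and]
  have hcube : cubeMeasure d A =
      ENNReal.ofReal ((∏ j, u j) * cellVolume L (gridCells d (L * M) \ T)) := by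
    rw [← volume_cellRegion_eq hL hM hu Finset.sdiff_subset, cubeMeasure,
      Measure.restrict_apply hA]
    congr 1
    ext z
    constructor
    · rintro ⟨h1, h2⟩
      exact ⟨fun j => (h2 j trivial).1, h1⟩
    · intro hz
      have := cellRegion_subset hL hM hu Finset.sdiff_subset hz
      exact ⟨hz.2, fun j _ => ⟨hz.1 j, (this j trivial).2.trans_lt (hMu j)⟩⟩
  rw [hset]
  refine ⟨measurableSet_sample_forall_notMem n hA, ?_⟩
  obtain ⟨h1, h2⟩ := sampleMeasure_forall_notMem_eq (n := n) hA
    (mul_nonneg hp (by exact ENNReal.toReal_nonneg)) hcube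
  rw [measureReal_def, h2, ENNReal.toReal_ofReal (pow_nonneg (by linarith) _)]
  have : (n : ℝ) ≠ 0 := by exact_mod_cast hn.ne'
  congr 1
  field_simp
  ring

/-- The probability that `u` sets a record-small value and breaks `k` records, when it comes after
`n` independent uniform points. -/
def brokenProb (d n k : ℕ) (u : Fin d → ℝ) : ℝ :=
  (sampleMeasure d n).real {x | x ∈ {x : Fin n → Fin d → ℝ | ∀ i, ¬ StrongLT (x i) u} ∧
    dominatingMinima u x = k}

/-- The discretized law of the number of minima, for `n` independent uniform points. -/
def gridApprox (d M k n : ℕ) (w : ℝ) : ℝ :=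
  occupancySum (gridCells d (gridMesh d M * M)) (fun S => gridMinima (gridMesh d M) S = k)
    fun T => (1 + -w * cellVolume (gridMesh d M) (gridCells d (gridMesh d M * M) \ T) / n) ^ n

theorem tendsto_gridApprox (d M k : ℕ) (w : ℝ) :
    Tendsto (fun n => gridApprox d M k n w) atTop (𝓝 (gridLimit d M k w)) :=
  tendsto_occupancySum _ _ fun _ => Real.tendsto_one_add_div_pow_exp _

theorem measurable_gridApprox (d M k n : ℕ) : Measurable (gridApprox d M k n) :=
  measurable_occupancySum _ _ fun T => by fun_prop

theorem abs_brokenProb_sub_gridApprox_le (hd : 1 ≤ d) (hu : ∀ j, 0 < u j) {M : ℕ} (hM : 0 < M)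
    (hMu : ∀ j, M * u j < 1) (hn : 0 < n) (k : ℕ) :
    |brokenProb d n k u - gridApprox d M k n (n * ∏ j, u j)| ≤
      gridError d M (n * ∏ j, u j) := by
  have hw0 : 0 < n * ∏ j, u j :=
    mul_pos (by exact_mod_cast hn) (Finset.prod_pos fun j _ => hu j)
  have hL := gridMesh_pos d hM
  have key := abs_measureReal_dominatingMinima_sub_le hd (sampleMeasure d n) (fun x => x)
    {x | ∀ i, ¬ StrongLT (x i) u} (M := M) hL hu hw0 zero_le_one (sq_nonneg _)
    (fun j t _ => sampleMeasure_slab_le hu hL j t)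
    (fun a _ _ => sampleMeasure_corner_le hu _ a)
    (fun T _ => (sampleMeasure_occupied_subset hu hL hM hMu hn T).1) k
  simp_rw [(sampleMeasure_occupied_subset hu hL hM hMu hn _).2] at key
  rwa [one_mul] at key

theorem sampleMeasure_record_eq (hu : ∀ j, 0 < u j) (hu1 : ∀ j, u j ≤ 1) :
    sampleMeasure d n {x | ∀ i, ¬ StrongLT (x i) u} = ENNReal.ofReal ((1 - ∏ j, u j) ^ n) :=
  (sampleMeasure_forall_notMem_eq (n := n) (measurableSet_strongLT measurable_id measurable_const)
    (Finset.prod_nonneg fun j _ => (hu j).le) (cubeMeasure_strongLT (fun j => (hu j).le) hu1)).2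

theorem brokenProb_nonneg (d n k : ℕ) (u : Fin d → ℝ) : 0 ≤ brokenProb d n k u :=
  measureReal_nonneg

theorem brokenProb_le_exp (k : ℕ) (hu : ∀ j, 0 < u j) (hu1 : ∀ j, u j ≤ 1) :
    brokenProb d n k u ≤ Real.exp (-(n * ∏ j, u j)) := by
  have hp1 : ∏ j, u j ≤ 1 := Finset.prod_le_one (fun j _ => (hu j).le) fun j _ => hu1 j
  refine (measureReal_mono (s₂ := {x | ∀ i, ¬ StrongLT (x i) u}) fun x hx => hx.1).trans ?_
  rw [measureReal_def, sampleMeasure_record_eq hu hu1,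
    ENNReal.toReal_ofReal (pow_nonneg (by linarith) _)]
  exact one_sub_pow_le_exp hp1 n

end Sample

/-! ### The product of independent uniform variables -/

theorem cubeMeasure_eq_pi (d : ℕ) :
    cubeMeasure d = Measure.pi fun _ => volume.restrict (Set.Ioo (0 : ℝ) 1) := by
  rw [cubeMeasure, volume_pi, Measure.restrict_pi_pi]

theorem lintegral_cubeMeasure_succ {d : ℕ} (j : Fin (d + 1)) {G : ℝ × (Fin d → ℝ) → ℝ≥0∞}
    (hG : Measurable G) :
    ∫⁻ u, G (u j, j.removeNth u) ∂cubeMeasure (d + 1) =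
      ∫⁻ t in Set.Ioo (0 : ℝ) 1, ∫⁻ v, G (t, v) ∂cubeMeasure d := by
  rw [cubeMeasure_eq_pi, cubeMeasure_eq_pi, lintegral_lintegral (f := fun t v => G (t, v))
    hG.aemeasurable]
  exact (measurePreserving_piFinSuccAbove
    (fun _ : Fin (d + 1) => volume.restrict (Set.Ioo (0 : ℝ) 1)) j).lintegral_comp hG

theorem lintegral_Ioo_comp_mul {a : ℝ} (ha : 0 < a) (b : ℝ) {g : ℝ → ℝ≥0∞} (hg : Measurable g) :
    ∫⁻ x in Set.Ioo 0 b, g (a * x) = ENNReal.ofReal a⁻¹ * ∫⁻ y in Set.Ioo 0 (a * b), g y := by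
  have hm := hg.indicator (measurableSet_Ioo (a := 0) (b := a * b))
  rw [← lintegral_indicator measurableSet_Ioo, ← lintegral_indicator measurableSet_Ioo,
    ← abs_of_pos (inv_pos.2 ha), ← smul_eq_mul, ← lintegral_smul_measure,
    ← Real.map_volume_mul_left ha.ne', lintegral_map hm (measurable_const_mul a)]
  congr with x
  by_cases hx : x ∈ Set.Ioo 0 b
  · rw [Set.indicator_of_mem hx, Set.indicator_of_mem]
    exact ⟨mul_pos ha hx.1, mul_lt_mul_of_pos_left hx.2 ha⟩
  · rw [Set.indicator_of_notMem hx, Set.indicator_of_notMem]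
    exact fun h => hx ⟨pos_of_mul_pos_right h.1 ha.le, lt_of_mul_lt_mul_left h.2 ha.le⟩

/-- An antiderivative of the integrand is `-(-log v) ^ (m + 1) / (m + 1)!`. This is the passage from
`m + 1` to `m + 2` factors in the density of a product of uniform variables. -/
theorem lintegral_Ioo_neg_log_pow_div {s : ℝ} (hs0 : 0 < s) (hs1 : s < 1) (m : ℕ) :
    ∫⁻ v in Set.Ioo s 1, ENNReal.ofReal ((-Real.log v) ^ m / m.factorial * v⁻¹) =
      ENNReal.ofReal ((-Real.log s) ^ (m + 1) / (m + 1).factorial) := by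
  have hderiv : ∀ v ∈ Set.uIcc s 1,
      HasDerivAt (fun v => -((-Real.log v) ^ (m + 1) / (m + 1).factorial))
        ((-Real.log v) ^ m / m.factorial * v⁻¹) v := by
    intro v hv
    rw [Set.uIcc_of_le hs1.le] at hv
    have hv0 : v ≠ 0 := (hs0.trans_le hv.1).ne'
    have h := ((((Real.hasDerivAt_log hv0).neg.pow (m + 1)).div_const
      ((m + 1).factorial : ℝ)).neg)
    refine HasDerivAt.congr_deriv (f := fun v => -((-Real.log v) ^ (m + 1) / (m + 1).factorial))
      h ?_
    rw [Nat.factorial_succ]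
    have : (m.factorial : ℝ) ≠ 0 := by positivity
    have : (m : ℝ) + 1 ≠ 0 := by positivity
    push_cast
    field_simp
    simp
  have hcont : ContinuousOn (fun v : ℝ => (-Real.log v) ^ m / m.factorial * v⁻¹)
      (Set.uIcc s 1) := by
    rw [Set.uIcc_of_le hs1.le]
    have h0 : ∀ v ∈ Set.Icc s 1, v ≠ 0 := fun v hv => (hs0.trans_le hv.1).ne'
    exact (((Real.continuousOn_log.mono fun v hv => h0 v hv).neg.pow m).div_const _).mul
      (continuousOn_inv₀.mono fun v hv => h0 v hv)
  have hint := hcont.intervalIntegrable (μ := volume)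
  have h := intervalIntegral.integral_eq_sub_of_hasDerivAt hderiv hint
  rw [intervalIntegral.integral_of_le hs1.le, integral_Ioc_eq_integral_Ioo] at h
  have hI := ((intervalIntegrable_iff_integrableOn_Ioc_of_le hs1.le).1 hint).mono_set
    Set.Ioo_subset_Ioc_self
  rw [← ofReal_integral_eq_lintegral_ofReal hI, h]
  · simp
  · refine (ae_restrict_iff' measurableSet_Ioo).2 (Eventually.of_forall fun v hv => ?_)
    have h1 : 0 ≤ -Real.log v := by
      have := Real.log_nonpos (hs0.trans hv.1).le hv.2.le
      linarith
    have h2 : 0 < v := hs0.trans hv.1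
    change 0 ≤ (-Real.log v) ^ m / m.factorial * v⁻¹
    positivity

/-- The density of the product of `m + 1` independent uniform variables. -/
theorem lintegral_cubeMeasure_prod (m : ℕ) {h : ℝ → ℝ≥0∞} (hh : Measurable h) :
    ∫⁻ u, h (∏ j, u j) ∂cubeMeasure (m + 1) =
      ∫⁻ v in Set.Ioo (0 : ℝ) 1, h v * ENNReal.ofReal ((-Real.log v) ^ m / m.factorial) := by
  induction m generalizing h with
  | zero =>
    have hm : Measurable fun q : ℝ × (Fin 0 → ℝ) => h (q.1 * ∏ j, q.2 j) := by fun_prop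
    have := lintegral_cubeMeasure_succ 0 hm
    simp only [Fin.removeNth] at this
    simp_rw [← Fin.prod_univ_succAbove] at this
    rw [this]
    simp
  | succ m ih =>
    have hm : Measurable fun q : ℝ × (Fin (m + 1) → ℝ) => h (q.1 * ∏ j, q.2 j) := by fun_prop
    have h1 := lintegral_cubeMeasure_succ 0 hm
    simp only [Fin.removeNth] at h1
    simp_rw [← Fin.prod_univ_succAbove] at h1
    rw [h1]
    simp_rw [fun t => ih (h := fun x => h (t * x)) (by fun_prop)]
    rw [lintegral_lintegral_swap (by fun_prop)]
    -- Substitute `s = t * v` for fixed `v`. The factor `v⁻¹` is the Jacobian and the indicator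
    -- records `s < v`; exchanging the integrals then leaves the integral of `(-log v) ^ m / m! *
    -- v⁻¹` over `(s, 1)`.
    have h2 : ∀ v ∈ Set.Ioo (0 : ℝ) 1,
        ∫⁻ t in Set.Ioo (0 : ℝ) 1, h (t * v) * ENNReal.ofReal ((-Real.log v) ^ m / m.factorial) =
        ∫⁻ s in Set.Ioo (0 : ℝ) 1, (Set.Ioi s).indicator
          (fun v => h s * ENNReal.ofReal ((-Real.log v) ^ m / m.factorial * v⁻¹)) v := by
      intro v hv
      have h0 : 0 ≤ (-Real.log v) ^ m / m.factorial := by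
        have := Real.log_nonpos hv.1.le hv.2.le
        have : 0 ≤ -Real.log v := by linarith
        positivity
      rw [lintegral_mul_const _ (by fun_prop)]
      simp_rw [mul_comm _ v]
      rw [lintegral_Ioo_comp_mul hv.1 1 hh, mul_one, mul_comm, ← mul_assoc,
        ← ENNReal.ofReal_mul h0, mul_comm, ← lintegral_mul_const _ hh,
        ← lintegral_indicator measurableSet_Ioo, ← lintegral_indicator measurableSet_Ioo]
      congr with s
      by_cases hs : s ∈ Set.Ioo 0 v
      · have hs' : s ∈ Set.Ioo (0 : ℝ) 1 := ⟨hs.1, hs.2.trans hv.2⟩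
        rw [Set.indicator_of_mem hs, Set.indicator_of_mem hs',
          Set.indicator_of_mem (show v ∈ Set.Ioi s from hs.2)]
      · rw [Set.indicator_of_notMem hs]
        by_cases hs' : s ∈ Set.Ioo (0 : ℝ) 1
        · rw [Set.indicator_of_mem hs', Set.indicator_of_notMem]
          exact fun h => hs ⟨hs'.1, h⟩
        · rw [Set.indicator_of_notMem hs']
    rw [setLIntegral_congr_fun measurableSet_Ioo h2, lintegral_lintegral_swap]
    · refine setLIntegral_congr_fun measurableSet_Ioo fun s hs => ?_
      rw [lintegral_indicator measurableSet_Ioi, Measure.restrict_restrict measurableSet_Ioi]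
      have : Set.Ioi s ∩ Set.Ioo 0 1 = Set.Ioo s 1 := by
        ext v
        simp only [Set.mem_inter_iff, Set.mem_Ioi, Set.mem_Ioo]
        exact ⟨fun h => ⟨h.1, h.2.2⟩, fun h => ⟨h.1, hs.1.trans h.1, h.2⟩⟩
      rw [this, lintegral_const_mul _ (by fun_prop), lintegral_Ioo_neg_log_pow_div hs.1 hs.2]
    · refine Measurable.aemeasurable ?_
      have : Function.uncurry (fun v s : ℝ => (Set.Ioi s).indicator
          (fun v => h s * ENNReal.ofReal ((-Real.log v) ^ m / m.factorial * v⁻¹)) v) =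
          {q : ℝ × ℝ | q.2 < q.1}.indicator fun q => h q.2 *
            ENNReal.ofReal ((-Real.log q.1) ^ m / m.factorial * q.1⁻¹) := by
        ext q
        simp [Function.uncurry, Set.indicator]
      rw [this]
      exact Measurable.indicator (by fun_prop) (measurableSet_lt measurable_snd measurable_fst)

/-! ### Dominated convergence for functions of `n * ∏ u j` -/

theorem lintegral_exp_mul_log_pow_lt_top {c : ℝ} (hc : 0 < c) (m : ℕ) :
    ∫⁻ w in Set.Ioi (0 : ℝ), ENNReal.ofReal (Real.exp (-c * w) * (1 + |Real.log w|) ^ m) < ∞ := by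
  -- The constant comes from `y ^ m / m! ≤ exp y` at `y = (1 + |log w|) / 2`, together with `exp
  -- (|log w| / 2) ≤ w ^ (1/2) + w ^ (-1/2)`. Both powers are integrable against `exp (-c w)`.
  set C : ℝ := 2 ^ m * m.factorial * Real.exp (1 / 2)
  have hb : ∀ w ∈ Set.Ioi (0 : ℝ), Real.exp (-c * w) * (1 + |Real.log w|) ^ m ≤
      C * (w ^ (1 / 2 : ℝ) * Real.exp (-c * w ^ (1 : ℝ)) +
        w ^ (-(1 / 2) : ℝ) * Real.exp (-c * w ^ (1 : ℝ))) := by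
    intro w hw
    have hw0 : (0 : ℝ) < w := hw
    set y := |Real.log w|
    have h1 := Real.pow_div_factorial_le_exp ((1 + y) / 2) (by positivity) m
    have h2 : Real.exp ((1 + y) / 2) ≤
        Real.exp (1 / 2) * (w ^ (1 / 2 : ℝ) + w ^ (-(1 / 2) : ℝ)) := by
      rw [add_div, Real.exp_add]
      refine mul_le_mul_of_nonneg_left ?_ (Real.exp_pos _).le
      rw [Real.rpow_def_of_pos hw0, Real.rpow_def_of_pos hw0]
      rcases abs_cases (Real.log w) with ⟨h, -⟩ | ⟨h, -⟩
      · have : y / 2 = Real.log w * (1 / 2) := by rw [← h]; ring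
        rw [this]
        linarith [Real.exp_pos (Real.log w * -(1 / 2))]
      · have : y / 2 = Real.log w * -(1 / 2) := by
          have : y = -Real.log w := h
          rw [this]; ring
        rw [this]
        linarith [Real.exp_pos (Real.log w * (1 / 2))]
    have h3 : (1 + y) ^ m = 2 ^ m * m.factorial * (((1 + y) / 2) ^ m / m.factorial) := by
      rw [div_pow]
      field_simp
    rw [Real.rpow_one, h3]
    calc Real.exp (-c * w) * (2 ^ m * m.factorial * (((1 + y) / 2) ^ m / m.factorial))
        ≤ Real.exp (-c * w) * (2 ^ m * m.factorial *
          (Real.exp (1 / 2) * (w ^ (1 / 2 : ℝ) + w ^ (-(1 / 2) : ℝ)))) := by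
          gcongr
          exact h1.trans h2
      _ = _ := by simp only [C]; ring
  have hI := ((integrableOn_rpow_mul_exp_neg_mul_rpow (p := 1) (s := 1 / 2) (b := c) (by norm_num)
    one_pos hc).add (integrableOn_rpow_mul_exp_neg_mul_rpow (p := 1) (s := -(1 / 2)) (b := c)
      (by norm_num) one_pos hc)).const_mul C
  refine lt_of_le_of_lt (setLIntegral_mono' measurableSet_Ioi fun w hw =>
    ENNReal.ofReal_le_ofReal (hb w hw)) ?_
  exact hI.lintegral_lt_top

/-- The normalizing sequence in dimension `m + 1`. -/
def cubeRate (m n : ℕ) : ℝ := n * m.factorial / Real.log n ^ m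

/-- By the density of the product and the substitution `w = n v`, the left side is the integral over
`0 < w < n` of `h n w * (1 - log w / log n) ^ m`. The last factor tends to `1`, so in the limit `n *
∏ u j` behaves like Lebesgue measure on `(0, ∞)`. -/
theorem tendsto_lintegral_cubeMeasure {m : ℕ} {c : ℝ} (hc : 0 < c) {h : ℕ → ℝ → ℝ≥0∞}
    {h' : ℝ → ℝ≥0∞} (hm : ∀ n, Measurable (h n))
    (hb : ∀ n : ℕ, ∀ w : ℝ, 0 < w → w < n → h n w ≤ ENNReal.ofReal (Real.exp (-c * w)))
    (hlim : ∀ w, 0 < w → Tendsto (fun n => h n w) atTop (𝓝 (h' w))) :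
    Tendsto (fun n : ℕ => ENNReal.ofReal (cubeRate m n) *
      ∫⁻ u, h n (n * ∏ j, u j) ∂cubeMeasure (m + 1)) atTop (𝓝 (∫⁻ w in Set.Ioi 0, h' w)) := by
  let H : ℕ → ℝ → ℝ≥0∞ := fun n => (Set.Iio (n : ℝ)).indicator fun w =>
    h n w * ENNReal.ofReal ((1 - Real.log w / Real.log n) ^ m)
  have hH : ∀ n, Measurable (H n) := fun n => by
    have := hm n
    exact Measurable.indicator (by fun_prop) measurableSet_Iio
  -- From `n = 3` on, `log n ≥ 1`, hence `|log w / log n| ≤ |log w|` and the dominating function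
  -- does not depend on `n`.
  have hlog : ∀ n : ℕ, 3 ≤ n → 1 ≤ Real.log n := by
    intro n hn
    rw [Real.le_log_iff_exp_le (by positivity)]
    have : (3 : ℝ) ≤ n := by exact_mod_cast hn
    linarith [Real.exp_one_lt_d9]
  have heq : ∀ n : ℕ, 3 ≤ n → ENNReal.ofReal (cubeRate m n) *
      ∫⁻ u, h n (n * ∏ j, u j) ∂cubeMeasure (m + 1) = ∫⁻ w in Set.Ioi 0, H n w := by
    intro n hn
    have hn0 : (0 : ℝ) < n := by positivity
    have hl := hlog n hn
    have hmn := hm n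
    have h1 : ∀ v ∈ Set.Ioo (0 : ℝ) 1,
        h n (n * v) * ENNReal.ofReal ((-Real.log v) ^ m / m.factorial) =
        (fun w => h n w * ENNReal.ofReal ((Real.log n - Real.log w) ^ m / m.factorial))
          (n * v) := by
      intro v hv
      simp only
      rw [Real.log_mul hn0.ne' hv.1.ne']
      congr 4
      ring
    rw [lintegral_cubeMeasure_prod m (h := fun x => h n (n * x)) (by fun_prop),
      setLIntegral_congr_fun measurableSet_Ioo h1,
      lintegral_Ioo_comp_mul hn0 1
        (g := fun w => h n w * ENNReal.ofReal ((Real.log n - Real.log w) ^ m / m.factorial))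
        (by fun_prop), mul_one, ← mul_assoc, ← ENNReal.ofReal_mul (by unfold cubeRate; positivity),
      ← lintegral_const_mul _ (by fun_prop), ← lintegral_indicator measurableSet_Ioo,
      ← lintegral_indicator measurableSet_Ioi]
    congr with w
    by_cases hw : w ∈ Set.Ioo (0 : ℝ) n
    · rw [Set.indicator_of_mem hw, Set.indicator_of_mem (show w ∈ Set.Ioi 0 from hw.1)]
      simp only [H]
      rw [Set.indicator_of_mem (show w ∈ Set.Iio (n : ℝ) from hw.2), mul_left_comm,
        ← ENNReal.ofReal_mul (by unfold cubeRate; positivity)]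
      congr 2
      have : (m.factorial : ℝ) ≠ 0 := by positivity
      rw [one_sub_div (by positivity), div_pow, cubeRate]
      field_simp
    · rw [Set.indicator_of_notMem hw]
      by_cases hw0 : w ∈ Set.Ioi (0 : ℝ)
      · rw [Set.indicator_of_mem hw0]
        simp only [H]
        rw [Set.indicator_of_notMem]
        exact fun h => hw ⟨hw0, h⟩
      · rw [Set.indicator_of_notMem hw0]
  have hbound : ∀ n : ℕ, 3 ≤ n → ∀ w ∈ Set.Ioi (0 : ℝ),
      H n w ≤ ENNReal.ofReal (Real.exp (-c * w) * (1 + |Real.log w|) ^ m) := by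
    intro n hn w hw
    by_cases hwn : w ∈ Set.Iio (n : ℝ)
    · simp only [H]
      rw [Set.indicator_of_mem hwn, ENNReal.ofReal_mul (Real.exp_pos _).le]
      refine mul_le_mul' (hb n w hw hwn) (ENNReal.ofReal_le_ofReal ?_)
      have hl := hlog n hn
      have h1 : Real.log w ≤ Real.log n := Real.log_le_log hw (le_of_lt hwn)
      refine pow_le_pow_left₀ ?_ ?_ m
      · rw [sub_nonneg, div_le_one (by positivity)]
        exact h1
      · have : |Real.log w / Real.log n| ≤ |Real.log w| := by
          rw [abs_div, abs_of_pos (by positivity : 0 < Real.log n)]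
          exact div_le_self (abs_nonneg _) hl
        linarith [neg_le_abs (Real.log w / Real.log n)]
    · simp [H, Set.indicator_of_notMem hwn]
  have hptw : ∀ w ∈ Set.Ioi (0 : ℝ), Tendsto (fun n => H n w) atTop (𝓝 (h' w)) := by
    intro w hw
    have h1 : Tendsto (fun n : ℕ => ENNReal.ofReal ((1 - Real.log w / Real.log n) ^ m)) atTop
        (𝓝 1) := by
      have h2 : Tendsto (fun n : ℕ => Real.log w / Real.log n) atTop (𝓝 0) :=
        (Real.tendsto_log_atTop.comp tendsto_natCast_atTop_atTop).const_div_atTop _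
      have h3 := ENNReal.tendsto_ofReal (((tendsto_const_nhds (x := (1 : ℝ))).sub h2).pow m)
      simpa using h3
    have h4 := ENNReal.Tendsto.mul (hlim w hw) (Or.inr ENNReal.one_ne_top) h1
      (Or.inl one_ne_zero)
    rw [mul_one] at h4
    refine h4.congr' ?_
    have : ∀ᶠ n : ℕ in atTop, w < n :=
      tendsto_natCast_atTop_atTop.eventually_gt_atTop w
    filter_upwards [this] with n hn
    simp only [H]
    rw [Set.indicator_of_mem (show w ∈ Set.Iio (n : ℝ) from hn)]
  refine Tendsto.congr' (f₁ := fun n => ∫⁻ w in Set.Ioi 0, H n w) ?_ ?_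
  · filter_upwards [eventually_ge_atTop 3] with n hn
    exact (heq n hn).symm
  · refine tendsto_lintegral_filter_of_dominated_convergence
      (fun w => ENNReal.ofReal (Real.exp (-c * w) * (1 + |Real.log w|) ^ m))
      (Eventually.of_forall hH) ?_ (lintegral_exp_mul_log_pow_lt_top hc m).ne ?_
    · filter_upwards [eventually_ge_atTop 3] with n hn
      exact (ae_restrict_iff' measurableSet_Ioi).2 (Eventually.of_forall (hbound n hn))
    · exact (ae_restrict_iff' measurableSet_Ioi).2 (Eventually.of_forall hptw)

/-- Replacing the coordinate `u j ≥ δ` by `δ` leaves an integral in one dimension less. For `m ≥ 1`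
that integral has order `1 / cubeRate (m - 1) n`, and `cubeRate m n` is smaller than `cubeRate (m -
1) n` by the factor `m / log n`. For `m = 0` the bound is `n * exp (-δ n)`. -/
theorem tendsto_lintegral_cubeMeasure_slab {m : ℕ} (j : Fin (m + 1)) {δ : ℝ} (hδ : 0 < δ) :
    Tendsto (fun n : ℕ => ENNReal.ofReal (cubeRate m n) *
      ∫⁻ u in {u | δ ≤ u j}, ENNReal.ofReal (Real.exp (-(n * ∏ j, u j))) ∂cubeMeasure (m + 1))
      atTop (𝓝 0) := by
  have hle : ∀ n : ℕ, ∫⁻ u in {u | δ ≤ u j}, ENNReal.ofReal (Real.exp (-(n * ∏ j, u j)))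
      ∂cubeMeasure (m + 1) ≤
      ∫⁻ v, ENNReal.ofReal (Real.exp (-δ * (n * ∏ i, v i))) ∂cubeMeasure m := by
    intro n
    have hset : MeasurableSet {u : Fin (m + 1) → ℝ | δ ≤ u j} :=
      measurableSet_le measurable_const (measurable_pi_apply j)
    have hG : Measurable ((Set.Ici δ ×ˢ Set.univ).indicator fun q : ℝ × (Fin m → ℝ) =>
        ENNReal.ofReal (Real.exp (-(n * (q.1 * ∏ i, q.2 i))))) :=
      Measurable.indicator (by fun_prop) (measurableSet_Ici.prod MeasurableSet.univ)
    have h1 := lintegral_cubeMeasure_succ j hG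
    rw [← lintegral_indicator hset]
    calc ∫⁻ u, {u : Fin (m + 1) → ℝ | δ ≤ u j}.indicator
          (fun u => ENNReal.ofReal (Real.exp (-(n * ∏ j, u j)))) u ∂cubeMeasure (m + 1)
        = ∫⁻ u, (Set.Ici δ ×ˢ Set.univ).indicator (fun q : ℝ × (Fin m → ℝ) =>
          ENNReal.ofReal (Real.exp (-(n * (q.1 * ∏ i, q.2 i))))) (u j, j.removeNth u)
            ∂cubeMeasure (m + 1) := by
          congr with u
          simp only [Set.indicator_apply, Set.mem_ofPred_eq, Set.mem_prod, Set.mem_Ici,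
            Set.mem_univ, and_true, Fin.removeNth, ← Fin.prod_univ_succAbove]
      _ = _ := h1
      _ ≤ ∫⁻ t in Set.Ioo (0 : ℝ) 1,
          ∫⁻ v, ENNReal.ofReal (Real.exp (-δ * (n * ∏ i, v i))) ∂cubeMeasure m := by
          refine lintegral_mono fun t => ?_
          rw [cubeMeasure]
          refine setLIntegral_mono' (measurableSet_cube m) fun v hv => ?_
          by_cases ht : δ ≤ t
          · rw [Set.indicator_of_mem (show (t, v) ∈ Set.Ici δ ×ˢ (Set.univ : Set (Fin m → ℝ)) from
              ⟨ht, trivial⟩)]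
            refine ENNReal.ofReal_le_ofReal (Real.exp_le_exp.2 ?_)
            have : 0 ≤ n * ∏ i, v i := mul_nonneg (Nat.cast_nonneg _)
              (Finset.prod_nonneg fun i _ => (hv i trivial).1.le)
            nlinarith
          · rw [Set.indicator_of_notMem fun h => ht h.1]
            exact zero_le
      _ = _ := by simp
  refine tendsto_of_tendsto_of_tendsto_of_le_of_le tendsto_const_nhds ?_ (fun _ => zero_le)
    fun n => mul_le_mul_right (hle n) _
  rcases m with _ | m
  · have h1 : ∀ n : ℕ, ENNReal.ofReal (cubeRate 0 n) *
        ∫⁻ v, ENNReal.ofReal (Real.exp (-δ * (n * ∏ i, v i))) ∂cubeMeasure 0 =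
        ENNReal.ofReal (n * Real.exp (-δ * n)) := by
      intro n
      rw [ENNReal.ofReal_mul (Nat.cast_nonneg n)]
      simp [cubeRate]
    simp_rw [h1]
    have h2 := (Real.tendsto_pow_mul_exp_neg_atTop_nhds_zero 1).comp
      (tendsto_natCast_atTop_atTop.const_mul_atTop hδ)
    have h3 := ENNReal.tendsto_ofReal (h2.const_mul δ⁻¹)
    rw [mul_zero, ENNReal.ofReal_zero] at h3
    refine h3.congr fun n => ?_
    simp only [Function.comp, pow_one]
    congr 1
    field_simp
  · have h1 := tendsto_lintegral_cubeMeasure (m := m) hδ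
      (h := fun _ w => ENNReal.ofReal (Real.exp (-δ * w))) (fun _ => by fun_prop)
      (fun _ _ _ _ => le_rfl) (fun _ _ => tendsto_const_nhds)
    have hfin : ∫⁻ w in Set.Ioi (0 : ℝ), ENNReal.ofReal (Real.exp (-δ * w)) ≠ ∞ := by
      simpa using (lintegral_exp_mul_log_pow_lt_top hδ 0).ne
    have h2 : Tendsto (fun n : ℕ => ENNReal.ofReal ((m + 1) / Real.log n)) atTop (𝓝 0) := by
      have := ENNReal.tendsto_ofReal
        ((Real.tendsto_log_atTop.comp tendsto_natCast_atTop_atTop).const_div_atTop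
          ((m : ℝ) + 1))
      simpa using this
    have h3 := ENNReal.Tendsto.mul h2 (Or.inr hfin) h1 (Or.inr ENNReal.zero_ne_top)
    rw [zero_mul] at h3
    refine h3.congr' ?_
    filter_upwards [eventually_ge_atTop 2] with n hn
    have hl : 0 < Real.log n := Real.log_pos (by exact_mod_cast hn)
    rw [← mul_assoc, ← ENNReal.ofReal_mul (by positivity)]
    congr 2
    rw [cubeRate, cubeRate, Nat.factorial_succ]
    push_cast
    field_simp
    ring

/-! ### The law of the number of minima in a homogeneous Poisson process -/

section Law

variable {d : ℕ} {u : Fin d → ℝ}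

theorem exists_isPoissonProcess_unitIntensity (hd : 1 ≤ d) (u : Fin d → ℝ) :
    ∃ (Ω : Type) (_ : MeasurableSpace Ω) (P : Measure Ω) (N : Ω → Set (Fin d → ℝ)),
      IsProbabilityMeasure P ∧ IsPoissonProcess N (unitIntensity u) P := by
  have : Nonempty (Fin d) := ⟨⟨0, hd⟩⟩
  have : SFinite (unitIntensity u) := by unfold unitIntensity; infer_instance
  exact exists_isPoissonProcess (unitIntensity u) fun x =>
    le_antisymm ((Measure.restrict_apply_le _ _).trans (measure_singleton x).le) zero_le

theorem map_eq_map_natCast_map_toNat {Ω : Type*} [MeasurableSpace Ω] {P : Measure Ω} {K : Ω → ℕ∞}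
    (hK : AEMeasurable K P) (hfin : ∀ᵐ ω ∂P, K ω ≠ ⊤) :
    P.map K = (P.map fun ω => (K ω).toNat).map (Nat.cast : ℕ → ℕ∞) ∧
      ∀ k : ℕ, (P.map fun ω => (K ω).toNat).real {k} = P.real {ω | K ω = k} := by
  have hm : AEMeasurable (fun ω => (K ω).toNat) P :=
    (measurable_of_countable ENat.toNat).comp_aemeasurable hK
  constructor
  · rw [AEMeasurable.map_map_of_aemeasurable measurable_from_nat.aemeasurable hm]
    refine Measure.map_congr ?_
    filter_upwards [hfin] with ω hω
    exact (ENat.natCast_toNat hω).symm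
  · intro k
    rw [measureReal_def, Measure.map_apply_of_aemeasurable hm (measurableSet_singleton k),
      ← measureReal_def]
    refine measureReal_congr (eventuallyEq_set.2 ?_)
    filter_upwards [hfin] with ω hω
    simp only [Set.mem_preimage, Set.mem_singleton_iff]
    constructor
    · intro h
      rw [← h, ENat.natCast_toNat hω]
    · intro h
      rw [h, ENat.toNat_natCast]

/-- Take the law from one process. For any other process with this intensity the point masses agree,
because in both cases they are limits of `gridLimit`, which does not refer to the process. -/
theorem exists_isMaximaLaw_unitIntensity (hd : 1 ≤ d) (hu : ∀ j, 0 < u j) :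
    ∃ q : Measure ℕ, IsProbabilityMeasure q ∧
      IsMaximaLaw (Function.swap StrongLT) (unitIntensity u) u q ∧
      ∀ k, ∀ M : ℕ, 0 < M → |Real.exp (-∏ j, u j) * q.real {k} - gridLimit d M k (∏ j, u j)| ≤
        gridError d M (∏ j, u j) := by
  obtain ⟨Ω, mΩ, P, N, hP, hN⟩ := exists_isPoissonProcess_unitIntensity hd u
  obtain ⟨hK, hfin⟩ := hN.aemeasurable_numMaximaBelow hd hu
  obtain ⟨h1, h2⟩ := map_eq_map_natCast_map_toNat hK hfin
  have hm : AEMeasurable (fun ω => (numMaximaBelow (Function.swap StrongLT) (N ω) u).toNat) P :=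
    (measurable_of_countable ENat.toNat).comp_aemeasurable hK
  refine ⟨P.map fun ω => (numMaximaBelow (Function.swap StrongLT) (N ω) u).toNat,
    Measure.isProbabilityMeasure_map hm, ⟨⟨Ω, mΩ, P, N, hP, hN⟩, ?_⟩, fun k M hM => ?_⟩
  · intro Ω' mΩ' P' N' hP' hN'
    obtain ⟨hK', hfin'⟩ := hN'.aemeasurable_numMaximaBelow hd hu
    obtain ⟨h1', h2'⟩ := map_eq_map_natCast_map_toNat hK' hfin'
    have hm' : AEMeasurable
        (fun ω => (numMaximaBelow (Function.swap StrongLT) (N' ω) u).toNat) P' :=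
      (measurable_of_countable ENat.toNat).comp_aemeasurable hK'
    have hq := Measure.isProbabilityMeasure_map hm
    have hq' := Measure.isProbabilityMeasure_map hm'
    rw [h1']
    congr 1
    refine Measure.ext_of_singleton fun k => ?_
    rw [← measureReal_eq_measureReal_iff, h2, h2']
    have := tendsto_nhds_unique (hN'.tendsto_gridLimit hd hu k) (hN.tendsto_gridLimit hd hu k)
    exact mul_left_cancel₀ (Real.exp_pos _).ne' this
  · rw [h2]
    exact hN.abs_measureReal_sub_gridLimit_le hd hu hM k

theorem prod_rpow_one_div (hd : 1 ≤ d) {w : ℝ} (hw : 0 < w) :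
    ∏ _j : Fin d, w ^ (1 / (d : ℝ)) = w := by
  have : (d : ℝ) ≠ 0 := by positivity
  rw [Finset.prod_const, Finset.card_univ, Fintype.card_fin, ← Real.rpow_natCast,
    ← Real.rpow_mul hw.le, one_div_mul_cancel this, Real.rpow_one]

/-- The laws of the number of minima depend measurably on the intensity. -/
theorem exists_kernel_isMaximaLaw (hd : 1 ≤ d) :
    ∃ L : Kernel ℝ ℕ, IsMarkovKernel L ∧
      (∀ w : ℝ, 0 < w → IsMaximaLaw (Function.swap StrongLT)
        (unitIntensity fun _ : Fin d => w ^ (1 / (d : ℝ))) (fun _ => w ^ (1 / (d : ℝ))) (L w)) ∧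
      ∀ w : ℝ, 0 < w → ∀ k, ∀ M : ℕ, 0 < M →
        |Real.exp (-w) * (L w).real {k} - gridLimit d M k w| ≤ gridError d M w := by
  have hex : ∀ w : ℝ, ∃ q : Measure ℕ, IsProbabilityMeasure q ∧ (0 < w →
      IsMaximaLaw (Function.swap StrongLT)
        (unitIntensity fun _ : Fin d => w ^ (1 / (d : ℝ))) (fun _ => w ^ (1 / (d : ℝ))) q ∧
      ∀ k, ∀ M : ℕ, 0 < M →
        |Real.exp (-w) * q.real {k} - gridLimit d M k w| ≤ gridError d M w) ∧
      (¬ 0 < w → q = Measure.dirac 0) := by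
    intro w
    by_cases hw : 0 < w
    · obtain ⟨q, h1, h2, h3⟩ := exists_isMaximaLaw_unitIntensity hd
        (u := fun _ : Fin d => w ^ (1 / (d : ℝ))) fun _ => Real.rpow_pos_of_pos hw _
      rw [prod_rpow_one_div hd hw] at h3
      exact ⟨q, h1, fun _ => ⟨h2, h3⟩, fun h => absurd hw h⟩
    -- An arbitrary value for `w ≤ 0`, where the exponential law has no mass; it makes the family a
    -- Markov kernel on all of `ℝ`.
    · exact ⟨Measure.dirac 0, inferInstance, fun h => absurd h hw, fun _ => rfl⟩
  choose q hq hpos hneg using hex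
  -- On `w > 0`, `exp (-w)` times the point mass is the pointwise limit of `gridLimit d M k w`,
  -- which is measurable in `w`. No measurable choice of the processes themselves is needed.
  have hreal : ∀ k, Measurable fun w => (q w).real {k} := by
    intro k
    have h1 : Measurable fun w => if 0 < w then Real.exp (-w) * (q w).real {k} else 0 := by
      refine measurable_of_tendsto_metrizable (f := fun M w =>
        if 0 < w then gridLimit d M k w else 0) (fun M => Measurable.ite measurableSet_Ioi
          (measurable_gridLimit d M k) measurable_const) (tendsto_pi_nhds.2 fun w => ?_)
      by_cases hw : 0 < w
      · simp only [if_pos hw]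
        rw [tendsto_iff_norm_sub_tendsto_zero]
        refine squeeze_zero' (Eventually.of_forall fun _ => norm_nonneg _) ?_
          (tendsto_gridError hd hw)
        filter_upwards [eventually_gt_atTop 0] with M hM
        rw [norm_sub_rev]
        exact (hpos w hw).2 k M hM
      · simp [hw]
    have h2 : (fun w => (q w).real {k}) = fun w => if 0 < w then
        Real.exp w * (if 0 < w then Real.exp (-w) * (q w).real {k} else 0) else
        (Measure.dirac (0 : ℕ)).real {k} := by
      ext w
      by_cases hw : 0 < w
      · rw [if_pos hw, if_pos hw, ← mul_assoc, ← Real.exp_add, add_neg_cancel, Real.exp_zero,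
          one_mul]
      · rw [if_neg hw, hneg w hw]
    rw [h2]
    exact Measurable.ite measurableSet_Ioi (Real.measurable_exp.mul h1) measurable_const
  have hmeas : Measurable q := by
    refine Measure.measurable_of_measurable_coe _ fun s hs => ?_
    simp_rw [← Measure.tsum_indicator_apply_singleton _ s hs]
    refine Measurable.tsum fun k => ?_
    by_cases hk : k ∈ s
    · simp only [Set.indicator_of_mem hk]
      have h : (fun w => q w {k}) = fun w => ENNReal.ofReal ((q w).real {k}) :=
        funext fun w => (ofReal_measureReal (h := measure_ne_top _ _)).symm
      rw [h]
      exact (hreal k).ennreal_ofReal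
    · simp only [Set.indicator_of_notMem hk]
      exact measurable_const
  exact ⟨⟨q, hmeas⟩, ⟨hq⟩, fun w hw => (hpos w hw).1, fun w hw => (hpos w hw).2⟩

end Law

/-! ### The mixture -/

theorem expMeasure_one_eq : expMeasure 1 =
    (volume.restrict (Set.Ioi 0)).withDensity fun w => ENNReal.ofReal (Real.exp (-w)) := by
  have h : expMeasure 1 = volume.withDensity (exponentialPDF 1) := rfl
  rw [h, ← withDensity_indicator measurableSet_Ioi]
  refine withDensity_congr_ae ?_
  have : ∀ᵐ w : ℝ, w ≠ 0 := by simp [ae_iff]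
  filter_upwards [this] with w hw
  rcases lt_or_gt_of_ne hw with h | h
  · rw [exponentialPDF_of_neg h, Set.indicator_of_notMem (by simpa using h.le)]
  · rw [exponentialPDF_of_nonneg h.le, Set.indicator_of_mem (by simpa using h)]
    simp

theorem bind_expMeasure_apply (L : Kernel ℝ ℕ) (s : Set ℕ) :
    (expMeasure 1).bind L s =
      ∫⁻ w in Set.Ioi 0, ENNReal.ofReal (Real.exp (-w)) * L w s := by
  rw [Measure.bind_apply MeasurableSet.of_discrete L.measurable.aemeasurable, expMeasure_one_eq,
    lintegral_withDensity_eq_lintegral_mul _ (by fun_prop)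
      (L.measurable_coe MeasurableSet.of_discrete)]
  rfl

/-! ### Asymptotics of the number of broken records -/

/-- Iterated limit argument: the error is made small by fixing `M` first, and only then does `n` go
to infinity. -/
theorem tendsto_of_le_add_le_add {a b : ℕ → ℝ≥0∞} {e : ℕ → ℕ → ℝ≥0∞} {η : ℕ → ℝ≥0∞} {x : ℝ≥0∞}
    (hx : x ≠ ∞) (hb : Tendsto b atTop (𝓝 x)) (hab : ∀ M n, a n ≤ b n + e M n)
    (hba : ∀ M n, b n ≤ a n + e M n) (he : ∀ M, Tendsto (e M) atTop (𝓝 (η M)))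
    (hη : Tendsto η atTop (𝓝 0)) : Tendsto a atTop (𝓝 x) := by
  rw [ENNReal.tendsto_nhds hx]
  intro ε hε
  have hε2 : 0 < ε / 2 := ENNReal.half_pos hε.ne'
  obtain ⟨M, hM⟩ := (hη.eventually_lt_const hε2).exists
  filter_upwards [(he M).eventually_lt_const hM, (ENNReal.tendsto_nhds hx).1 hb _ hε2]
    with n h1 h2
  constructor
  · have : x ≤ a n + ε := calc
      x ≤ b n + ε / 2 := tsub_le_iff_right.1 h2.1
      _ ≤ a n + e M n + ε / 2 := by gcongr; exact hba M n
      _ ≤ a n + ε / 2 + ε / 2 := by gcongr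
      _ = a n + ε := by rw [add_assoc, ENNReal.add_halves]
    exact tsub_le_iff_right.2 this
  · calc a n ≤ b n + e M n := hab M n
      _ ≤ x + ε / 2 + ε / 2 := by gcongr; exact h2.2
      _ = x + ε := by rw [add_assoc, ENNReal.add_halves]

section Asymptotics

variable {m : ℕ} {L : Kernel ℝ ℕ} [IsMarkovKernel L]

theorem ofReal_le_ofReal_add_of_abs_sub_le {x y z : ℝ} (hy : 0 ≤ y) (hz : 0 ≤ z)
    (h : |x - y| ≤ z) : ENNReal.ofReal x ≤ ENNReal.ofReal y + ENNReal.ofReal z := by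
  rw [← ENNReal.ofReal_add hy hz]
  exact ENNReal.ofReal_le_ofReal (by linarith [(abs_le.1 h).2])

/-- The error made on a point `u` of the cube by replacing `n` uniform points with a Poisson
process. -/
def approxError (m M k n : ℕ) (w : ℝ) : ℝ :=
  min (Real.exp (-1 * w))
    (|gridApprox (m + 1) M k n w - gridLimit (m + 1) M k w| + 2 * gridError (m + 1) M w)

theorem measurable_approxError (m M k n : ℕ) : Measurable (approxError m M k n) := by
  have h1 := measurable_gridApprox (m + 1) M k n
  have h2 := measurable_gridLimit (m + 1) M k
  have h3 := measurable_gridError (m + 1) M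
  unfold approxError
  refine Measurable.min (by fun_prop) (Measurable.add ?_ (h3.const_mul 2))
  exact measurable_norm.comp (h1.sub h2)

/-- If the box fits in the cube, the triangle inequality through `gridApprox` and `gridLimit` costs
two grid errors, one for the sample and one for the Poisson process. Otherwise some `u j ≥ 1 / M`,
and the trivial bound `exp (-w)` is charged to that slab. The minimum in `approxError` retains the
trivial bound for domination. -/
theorem abs_brokenProb_sub_le {n M k : ℕ} (hn : 0 < n) (hM : 0 < M)
    (hL : ∀ w : ℝ, 0 < w → ∀ k, ∀ M : ℕ, 0 < M →
      |Real.exp (-w) * (L w).real {k} - gridLimit (m + 1) M k w| ≤ gridError (m + 1) M w)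
    {u : Fin (m + 1) → ℝ} (hu : ∀ j, 0 < u j) (hu1 : ∀ j, u j < 1) :
    |brokenProb (m + 1) n k u - Real.exp (-(n * ∏ j, u j)) * (L (n * ∏ j, u j)).real {k}| ≤
      approxError m M k n (n * ∏ j, u j) +
        ∑ j, {u : Fin (m + 1) → ℝ | (M : ℝ)⁻¹ ≤ u j}.indicator
          (fun u => Real.exp (-(n * ∏ j, u j))) u := by
  have hw : 0 < n * ∏ j, u j :=
    mul_pos (by exact_mod_cast hn) (Finset.prod_pos fun j _ => hu j)
  have hM' : (0 : ℝ) < M := by exact_mod_cast hM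
  have hsum0 : ∀ j, 0 ≤ {u : Fin (m + 1) → ℝ | (M : ℝ)⁻¹ ≤ u j}.indicator
      (fun u => Real.exp (-(n * ∏ j, u j))) u := fun j =>
    Set.indicator_nonneg (fun _ _ => (Real.exp_pos _).le) _
  have h1 : |brokenProb (m + 1) n k u -
      Real.exp (-(n * ∏ j, u j)) * (L (n * ∏ j, u j)).real {k}| ≤
      Real.exp (-(n * ∏ j, u j)) := by
    have h2 := brokenProb_nonneg (m + 1) n k u
    have h3 := brokenProb_le_exp (n := n) k hu fun j => (hu1 j).le
    have h4 : 0 ≤ Real.exp (-(n * ∏ j, u j)) * (L (n * ∏ j, u j)).real {k} := by positivity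
    have h5 : Real.exp (-(n * ∏ j, u j)) * (L (n * ∏ j, u j)).real {k} ≤
        Real.exp (-(n * ∏ j, u j)) :=
      mul_le_of_le_one_right (Real.exp_pos _).le measureReal_le_one
    rw [abs_le]
    constructor <;> linarith
  by_cases h : ∀ j, M * u j < 1
  · refine le_add_of_le_of_nonneg ?_ (Finset.sum_nonneg fun j _ => hsum0 j)
    refine le_min (by simpa using h1) ?_
    have h2 := abs_brokenProb_sub_gridApprox_le (by omega) hu hM h hn k
    have h3 := hL _ hw k M hM
    rw [abs_sub_comm] at h3
    set A := gridApprox (m + 1) M k n (n * ∏ j, u j)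
    set B := gridLimit (m + 1) M k (n * ∏ j, u j)
    calc _ ≤ |brokenProb (m + 1) n k u - A| + |A - B| +
          |B - Real.exp (-(n * ∏ j, u j)) * (L (n * ∏ j, u j)).real {k}| := by
          refine (abs_sub_le _ B _).trans ?_
          gcongr
          exact abs_sub_le _ A _
      _ ≤ _ := by linarith
  · push Not at h
    obtain ⟨j, hj⟩ := h
    refine h1.trans (le_add_of_nonneg_of_le ?_ ?_)
    · have := gridError_nonneg (m + 1) M hw.le
      exact le_min (Real.exp_pos _).le (by positivity)
    · refine le_trans ?_ (Finset.single_le_sum (fun j _ => hsum0 j) (Finset.mem_univ j))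
      rw [Set.indicator_of_mem]
      exact (inv_le_iff_one_le_mul₀' hM').2 hj

/-- For fixed `M`, as `n → ∞`, the slab terms vanish and `gridApprox` tends to `gridLimit`, so the
normalized error tends to the integral of `min (exp (-w)) (2 * gridError)`. This in turn vanishes as
`M → ∞`. The main term already depends on `u` only through `n * ∏ u j`. -/
theorem tendsto_lintegral_brokenProb
    (hL : ∀ w : ℝ, 0 < w → ∀ k, ∀ M : ℕ, 0 < M →
      |Real.exp (-w) * (L w).real {k} - gridLimit (m + 1) M k w| ≤ gridError (m + 1) M w)
    (k : ℕ) :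
    Tendsto (fun n : ℕ => ENNReal.ofReal (cubeRate m n) *
      ∫⁻ u, ENNReal.ofReal (brokenProb (m + 1) n k u) ∂cubeMeasure (m + 1)) atTop
      (𝓝 ((expMeasure 1).bind L {k})) := by
  have hkm : Measurable fun w => (L w).real {k} :=
    (L.measurable_coe (measurableSet_singleton k)).ennreal_toReal
  let f : ℝ → ℝ≥0∞ := fun w => ENNReal.ofReal (Real.exp (-w) * (L w).real {k})
  have hf : Measurable f := by
    have : Measurable fun w : ℝ => Real.exp (-w) := by fun_prop
    exact (this.mul hkm).ennreal_ofReal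
  have hfin : (expMeasure 1).bind L {k} = ∫⁻ w in Set.Ioi 0, f w := by
    rw [bind_expMeasure_apply]
    refine lintegral_congr fun w => ?_
    simp only [f]
    rw [ENNReal.ofReal_mul (Real.exp_pos _).le, ofReal_measureReal]
  have hprob : IsProbabilityMeasure (expMeasure 1) := isProbabilityMeasure_expMeasure one_pos
  have hslabm : ∀ (M : ℕ) (j : Fin (m + 1)),
      MeasurableSet {u : Fin (m + 1) → ℝ | ((M + 1 : ℕ) : ℝ)⁻¹ ≤ u j} := fun M j =>
    measurableSet_le measurable_const (measurable_pi_apply j)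
  let E : ℕ → ℕ → (Fin (m + 1) → ℝ) → ℝ≥0∞ := fun M n u =>
    ENNReal.ofReal (approxError m (M + 1) k n (n * ∏ j, u j)) +
      ∑ j, {u : Fin (m + 1) → ℝ | ((M + 1 : ℕ) : ℝ)⁻¹ ≤ u j}.indicator
        (fun u => ENNReal.ofReal (Real.exp (-(n * ∏ j, u j)))) u
  have hE1 : ∀ M n, Measurable fun u : Fin (m + 1) → ℝ =>
      ENNReal.ofReal (approxError m (M + 1) k n (n * ∏ j, u j)) := fun M n =>
    ((measurable_approxError m (M + 1) k n).comp
      (by fun_prop : Measurable fun u : Fin (m + 1) → ℝ => n * ∏ j, u j)).ennreal_ofReal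
  have hE2 : ∀ (M n : ℕ) (j : Fin (m + 1)), Measurable
      ({u : Fin (m + 1) → ℝ | ((M + 1 : ℕ) : ℝ)⁻¹ ≤ u j}.indicator
        (fun u => ENNReal.ofReal (Real.exp (-(n * ∏ j, u j))))) := fun M n j =>
    Measurable.indicator (by fun_prop) (hslabm M j)
  have hE : ∀ M n, Measurable (E M n) := fun M n =>
    (hE1 M n).add (Finset.measurable_sum _ fun j _ => hE2 M n j)
  have hcmp : ∀ M n : ℕ, 0 < n → ∀ u ∈ Set.univ.pi fun _ : Fin (m + 1) => Set.Ioo (0 : ℝ) 1,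
      ENNReal.ofReal (brokenProb (m + 1) n k u) ≤ f (n * ∏ j, u j) + E M n u ∧
      f (n * ∏ j, u j) ≤ ENNReal.ofReal (brokenProb (m + 1) n k u) + E M n u := by
    intro M n hn u hu
    have h := abs_brokenProb_sub_le (k := k) hn M.succ_pos hL (fun j => (hu j trivial).1)
      fun j => (hu j trivial).2
    have hz := (abs_nonneg _).trans h
    have hw : 0 ≤ n * ∏ j, u j :=
      mul_nonneg (Nat.cast_nonneg _) (Finset.prod_nonneg fun j _ => (hu j trivial).1.le)
    have hEeq : E M n u = ENNReal.ofReal (approxError m (M + 1) k n (n * ∏ j, u j) +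
        ∑ j, {u : Fin (m + 1) → ℝ | ((M + 1 : ℕ) : ℝ)⁻¹ ≤ u j}.indicator
          (fun u => Real.exp (-(n * ∏ j, u j))) u) := by
      have h0 : ∀ j, 0 ≤ {u : Fin (m + 1) → ℝ | ((M + 1 : ℕ) : ℝ)⁻¹ ≤ u j}.indicator
          (fun u => Real.exp (-(n * ∏ j, u j))) u := fun j =>
        Set.indicator_nonneg (fun _ _ => (Real.exp_pos _).le) _
      have hg := gridError_nonneg (m + 1) (M + 1) hw
      have ha : 0 ≤ approxError m (M + 1) k n (n * ∏ j, u j) :=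
        le_min (Real.exp_pos _).le (by positivity)
      rw [ENNReal.ofReal_add ha (Finset.sum_nonneg fun j _ => h0 j), ENNReal.ofReal_sum_of_nonneg fun j _ => h0 j]
      simp only [E]
      congr 1
      refine Finset.sum_congr rfl fun j _ => ?_
      by_cases hj : u ∈ {u : Fin (m + 1) → ℝ | ((M + 1 : ℕ) : ℝ)⁻¹ ≤ u j}
      · rw [Set.indicator_of_mem hj, Set.indicator_of_mem hj]
      · rw [Set.indicator_of_notMem hj, Set.indicator_of_notMem hj, ENNReal.ofReal_zero]
    rw [hEeq]
    refine ⟨ofReal_le_ofReal_add_of_abs_sub_le (by positivity) hz h, ?_⟩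
    refine ofReal_le_ofReal_add_of_abs_sub_le (brokenProb_nonneg _ _ _ _) hz ?_
    rwa [abs_sub_comm]
  have hG : Tendsto (fun n : ℕ => ENNReal.ofReal (cubeRate m n) *
      ∫⁻ u, f (n * ∏ j, u j) ∂cubeMeasure (m + 1)) atTop (𝓝 ((expMeasure 1).bind L {k})) := by
    rw [hfin]
    refine tendsto_lintegral_cubeMeasure one_pos (h := fun _ => f) (fun _ => hf)
      (fun n w _ _ => ENNReal.ofReal_le_ofReal ?_) fun _ _ => tendsto_const_nhds
    rw [neg_one_mul]
    exact mul_le_of_le_one_right (Real.exp_pos _).le measureReal_le_one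
  have hη : ∀ M, Tendsto (fun n : ℕ => ENNReal.ofReal (cubeRate m n) *
      ∫⁻ u, E M n u ∂cubeMeasure (m + 1)) atTop
      (𝓝 (∫⁻ w in Set.Ioi 0, ENNReal.ofReal (min (Real.exp (-1 * w))
        (2 * gridError (m + 1) (M + 1) w)))) := by
    intro M
    have h1 := tendsto_lintegral_cubeMeasure (m := m) one_pos
      (h := fun n w => ENNReal.ofReal (approxError m (M + 1) k n w))
      (h' := fun w => ENNReal.ofReal (min (Real.exp (-1 * w))
        (2 * gridError (m + 1) (M + 1) w)))
      (fun n => (measurable_approxError m (M + 1) k n).ennreal_ofReal)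
      (fun n w _ _ => ENNReal.ofReal_le_ofReal (min_le_left _ _)) (fun w _ => by
        refine ENNReal.tendsto_ofReal (tendsto_const_nhds.min ?_)
        have := ((tendsto_gridApprox (m + 1) (M + 1) k w).sub_const
          (gridLimit (m + 1) (M + 1) k w)).abs.add_const (2 * gridError (m + 1) (M + 1) w)
        simpa using this)
    have h2 := h1.add (tendsto_finsetSum Finset.univ fun j _ =>
      tendsto_lintegral_cubeMeasure_slab (m := m) j (δ := ((M + 1 : ℕ) : ℝ)⁻¹) (by positivity))
    rw [Finset.sum_const_zero, add_zero] at h2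
    refine h2.congr fun n => ?_
    simp only [E]
    rw [lintegral_add_left (hE1 M n), lintegral_finsetSum _ fun j _ => hE2 M n j, mul_add,
      Finset.mul_sum]
    simp_rw [lintegral_indicator (hslabm M _)]
  have hη0 : Tendsto (fun M => ∫⁻ w in Set.Ioi (0 : ℝ), ENNReal.ofReal (min (Real.exp (-1 * w))
      (2 * gridError (m + 1) (M + 1) w))) atTop (𝓝 0) := by
    have h0 : ∫⁻ _ in Set.Ioi (0 : ℝ), (0 : ℝ≥0∞) = 0 := by simp
    rw [← h0]
    refine tendsto_lintegral_of_dominated_convergence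
      (fun w => ENNReal.ofReal (Real.exp (-1 * w))) (fun M => ?_) (fun M => ?_) ?_ ?_
    · have := measurable_gridError (m + 1) (M + 1)
      exact (Measurable.min (by fun_prop) (this.const_mul 2)).ennreal_ofReal
    · exact Eventually.of_forall fun w => ENNReal.ofReal_le_ofReal (min_le_left _ _)
    · simpa using (lintegral_exp_mul_log_pow_lt_top one_pos 0).ne
    · refine (ae_restrict_iff' measurableSet_Ioi).2 (Eventually.of_forall fun w hw => ?_)
      have h1 := ((tendsto_gridError (d := m + 1) (by omega) hw).comp
        (tendsto_add_atTop_nat 1)).const_mul 2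
      have h2 := ENNReal.tendsto_ofReal
        ((tendsto_const_nhds (x := Real.exp (-1 * w))).min h1)
      rwa [mul_zero, min_eq_right (Real.exp_pos _).le, ENNReal.ofReal_zero] at h2
  have hbind : IsProbabilityMeasure ((expMeasure 1).bind L) := by infer_instance
  -- The comparison requires `n > 0`, hence the shift of the sequence by one. The box size is
  -- likewise `M + 1` throughout.
  refine (tendsto_add_atTop_iff_nat 1).1 (tendsto_of_le_add_le_add (measure_ne_top _ _)
    ((tendsto_add_atTop_iff_nat 1).2 hG) ?_ ?_
    (fun M => (tendsto_add_atTop_iff_nat 1).2 (hη M)) hη0)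
  · intro M n
    rw [← mul_add, ← lintegral_add_right _ (hE M (n + 1))]
    refine mul_le_mul_right ?_ _
    rw [cubeMeasure]
    exact setLIntegral_mono' (measurableSet_cube _) fun u hu => (hcmp M (n + 1) n.succ_pos u hu).1
  · intro M n
    rw [← mul_add, ← lintegral_add_right _ (hE M (n + 1))]
    refine mul_le_mul_right ?_ _
    rw [cubeMeasure]
    exact setLIntegral_mono' (measurableSet_cube _) fun u hu => (hcmp M (n + 1) n.succ_pos u hu).2

/-- The integrand is `(1 - w / n) ^ n` with `w = n * ∏ u j`, and `exp (-w)` has total mass `1` on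
`(0, ∞)`. So `cubeRate m n` is asymptotically the reciprocal of the probability of a record. -/
theorem tendsto_lintegral_record (m : ℕ) :
    Tendsto (fun n : ℕ => ENNReal.ofReal (cubeRate m n) *
      ∫⁻ u, ENNReal.ofReal ((1 - ∏ j, u j) ^ n) ∂cubeMeasure (m + 1)) atTop (𝓝 1) := by
  have hprob : IsProbabilityMeasure (expMeasure 1) := isProbabilityMeasure_expMeasure one_pos
  have h1 : ∫⁻ w in Set.Ioi 0, ENNReal.ofReal (Real.exp (-w)) = 1 := by
    have := measure_univ (μ := expMeasure 1)
    rwa [expMeasure_one_eq, withDensity_apply _ MeasurableSet.univ, Measure.restrict_univ] at this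
  have h2 := tendsto_lintegral_cubeMeasure (m := m) one_pos
    (h := fun n w => ENNReal.ofReal ((1 + -w / n) ^ n))
    (h' := fun w => ENNReal.ofReal (Real.exp (-w))) (fun n => by fun_prop)
    (fun n w hw hwn => ENNReal.ofReal_le_ofReal ?_)
    (fun w _ => ENNReal.tendsto_ofReal (Real.tendsto_one_add_div_pow_exp (-w)))
  · rw [h1] at h2
    refine h2.congr' ?_
    filter_upwards [eventually_gt_atTop 0] with n hn
    have : (n : ℝ) ≠ 0 := by positivity
    congr 2 with u
    congr 2
    field_simp
    ring
  · have hn : (0 : ℝ) < n := hw.trans hwn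
    have := one_sub_pow_le_exp (v := w / n) ((div_le_one hn).2 hwn.le) n
    rw [mul_div_cancel₀ _ hn.ne'] at this
    rw [neg_div, ← sub_eq_add_neg, neg_one_mul]
    exact this

end Asymptotics

/-! ### Broken records of a sequence of uniform points -/

theorem setsRecord_swap_iff {d : ℕ} (X : ℕ → Fin d → ℝ) (n : ℕ) :
    SetsRecord (Function.swap StrongLT) X n ↔ ∀ i : Fin n, ¬ StrongLT (X i) (X n) :=
  ⟨fun h i => h i i.2, fun h i hi => h ⟨i, hi⟩⟩

theorem numBroken_nonneg_iff {E : Type*} (r : E → E → Prop) (X : ℕ → E) (n : ℕ) :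
    0 ≤ numBroken r X n ↔ SetsRecord r X n := by
  unfold numBroken
  split_ifs with h <;> simp [h]

/-- An earlier current record can only be killed by `X n` itself. The broken records are therefore
the minima among the first `n` points that dominate `X n`. -/
theorem numBroken_swap_eq_iff {d : ℕ} (X : ℕ → Fin d → ℝ) (n k : ℕ) :
    numBroken (Function.swap StrongLT) X n = k ↔ (∀ i : Fin n, ¬ StrongLT (X i) (X n)) ∧
      dominatingMinima (X n) (fun i : Fin n => X i) = k := by
  classical
  rw [← setsRecord_swap_iff]
  unfold numBroken
  split_ifs with h
  · have hset : (((Finset.range n).filter fun j => IsCurrentRecord (Function.swap StrongLT) X n j ∧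
        ¬ IsCurrentRecord (Function.swap StrongLT) X (n + 1) j : Finset ℕ) : Set ℕ) =
        Fin.val '' {j : Fin n | (∀ i : Fin n, ¬ StrongLT (X i) (X j)) ∧
          StrongLT (X n) (X j)} := by
      ext j
      rw [Finset.mem_coe, Finset.mem_filter, Finset.mem_range, Set.mem_image]
      simp only [Set.mem_ofPred_eq, IsCurrentRecord, Function.swap]
      constructor
      · rintro ⟨hj, ⟨-, h1⟩, h2⟩
        refine ⟨⟨j, hj⟩, ⟨fun i => h1 i i.2, ?_⟩, rfl⟩
        by_contra h3
        refine h2 ⟨hj.trans n.lt_succ_self, fun i hi => ?_⟩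
        rcases Nat.lt_succ_iff_lt_or_eq.1 hi with hi | rfl
        · exact h1 i hi
        · exact h3
      · rintro ⟨j, ⟨h1, h2⟩, rfl⟩
        exact ⟨j.2, ⟨j.2, fun i hi => h1 ⟨i, hi⟩⟩, fun h3 => h3.2 n n.lt_succ_self h2⟩
    have hcard : ((((Finset.range n).filter fun j =>
        IsCurrentRecord (Function.swap StrongLT) X n j ∧
        ¬ IsCurrentRecord (Function.swap StrongLT) X (n + 1) j).card : ℕ) : ℕ∞) =
        dominatingMinima (X n) fun i : Fin n => X i := by
      rw [← Set.encard_coe_eq_coe_finsetCard, hset, Fin.val_injective.encard_image]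
      rfl
    rw [← hcard]
    simp only [h, true_and]
    exact ⟨fun h => by exact_mod_cast h, fun h => by exact_mod_cast h⟩
  · simp only [h, false_and]

theorem numBroken_congr {E E' : Type*} {r : E → E → Prop} {r' : E' → E' → Prop} {X : ℕ → E}
    {Y : ℕ → E'} (h : ∀ i j, r (X i) (X j) ↔ r' (Y i) (Y j)) (n : ℕ) :
    numBroken r X n = numBroken r' Y n := by
  have h1 : SetsRecord r X = SetsRecord r' Y := by
    ext i
    simp only [SetsRecord, h]
  have h2 : IsCurrentRecord r X = IsCurrentRecord r' Y := by
    ext i j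
    simp only [IsCurrentRecord, h]
  rw [numBroken, numBroken, h1, h2]

theorem measurableSet_forall_not_strongLT {α ι : Type*} [MeasurableSpace α] [Countable ι] {d : ℕ}
    {f g : ι → α → Fin d → ℝ} (hf : ∀ i, Measurable (f i)) (hg : ∀ i, Measurable (g i)) :
    MeasurableSet {a | ∀ i, ¬ StrongLT (f i a) (g i a)} := by
  rw [Set.ofPred_forall]
  exact MeasurableSet.iInter fun i => (measurableSet_strongLT (hf i) (hg i)).compl

theorem measurableSet_sample_record (d n : ℕ) :
    MeasurableSet {q : (Fin d → ℝ) × (Fin n → Fin d → ℝ) | ∀ i, ¬ StrongLT (q.2 i) q.1} :=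
  measurableSet_forall_not_strongLT (fun i => by fun_prop) fun _ => measurable_fst

theorem measurable_dominatingMinima (d n : ℕ) :
    Measurable fun q : (Fin d → ℝ) × (Fin n → Fin d → ℝ) => dominatingMinima q.1 q.2 := by
  classical
  have h : (fun q : (Fin d → ℝ) × (Fin n → Fin d → ℝ) => dominatingMinima q.1 q.2) =
      fun q => ((∑ i, if (∀ i', ¬ StrongLT (q.2 i') (q.2 i)) ∧ StrongLT q.1 (q.2 i) then 1 else 0 :
        ℕ) : ℕ∞) := by
    ext1 q
    rw [← Finset.card_filter, ← Set.encard_coe_eq_coe_finsetCard, dominatingMinima]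
    congr 1
    ext i
    simp
  rw [h]
  exact measurable_from_nat.comp (Finset.measurable_sum _ fun i _ => Measurable.ite
    ((measurableSet_forall_not_strongLT (fun i => by fun_prop) fun _ => by fun_prop).inter
      (measurableSet_strongLT measurable_fst (by fun_prop))) measurable_const measurable_const)

/-! ### Conditional law of the number of broken records -/

section Law

variable {d : ℕ} {Ω : Type*} [MeasurableSpace Ω] {P : Measure Ω} [IsProbabilityMeasure P]
  {X : ℕ → Ω → Fin d → ℝ}

theorem map_prodMk_sample (hX : ∀ i, Measurable (X i)) (hind : iIndepFun X P)
    (hlaw : ∀ i, P.map (X i) = cubeMeasure d) (n : ℕ) :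
    P.map (fun ω => (X n ω, fun i : Fin n => X i ω)) =
      (cubeMeasure d).prod (sampleMeasure d n) := by
  have h1 := (iIndepFun_iff_map_fun_eq_pi_map (f := fun (i : Fin (n + 1)) => X i)
    fun i => (hX i).aemeasurable).1 (hind.precomp Fin.val_injective)
  simp_rw [hlaw] at h1
  have h2 := (measurePreserving_piFinSuccAbove
    (fun _ : Fin (n + 1) => cubeMeasure d) (Fin.last n)).map_eq
  rw [← h1, Measure.map_map (MeasurableEquiv.measurable _) (by fun_prop)] at h2
  rw [sampleMeasure, ← h2]
  congr 1
  ext ω : 1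
  simp only [Function.comp, MeasurableEquiv.piFinSuccAbove, MeasurableEquiv.coe_mk,
    Fin.insertNthEquiv_last, Fin.snocEquiv_symm_apply]
  rfl

/-- By independence the new observation is integrated separately against the law of the first `n`
points. -/
theorem measure_numBroken (hX : ∀ i, Measurable (X i)) (hind : iIndepFun X P)
    (hlaw : ∀ i, P.map (X i) = cubeMeasure d) (n k : ℕ) :
    MeasurableSet {ω | numBroken (Function.swap StrongLT) (fun i => X i ω) n = k} ∧
    P {ω | numBroken (Function.swap StrongLT) (fun i => X i ω) n = k} =
      ∫⁻ u, ENNReal.ofReal (brokenProb d n k u) ∂cubeMeasure d := by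
  have hA : MeasurableSet {q : (Fin d → ℝ) × (Fin n → Fin d → ℝ) |
      (∀ i, ¬ StrongLT (q.2 i) q.1) ∧ dominatingMinima q.1 q.2 = k} :=
    (measurableSet_sample_record d n).inter
      (measurable_dominatingMinima d n (measurableSet_singleton _))
  have hm : Measurable fun ω => (X n ω, fun i : Fin n => X i ω) := by fun_prop
  have hset : {ω | numBroken (Function.swap StrongLT) (fun i => X i ω) n = k} =
      (fun ω => (X n ω, fun i : Fin n => X i ω)) ⁻¹'
      {q | (∀ i, ¬ StrongLT (q.2 i) q.1) ∧ dominatingMinima q.1 q.2 = k} := by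
    ext ω
    exact numBroken_swap_eq_iff (fun i => X i ω) n k
  rw [hset]
  refine ⟨hm hA, ?_⟩
  rw [← Measure.map_apply hm hA, map_prodMk_sample hX hind hlaw, Measure.prod_apply hA]
  refine lintegral_congr fun u => ?_
  rw [brokenProb, ofReal_measureReal]
  rfl

theorem measure_numBroken_nonneg (hX : ∀ i, Measurable (X i)) (hind : iIndepFun X P)
    (hlaw : ∀ i, P.map (X i) = cubeMeasure d) (n : ℕ) :
    MeasurableSet {ω | 0 ≤ numBroken (Function.swap StrongLT) (fun i => X i ω) n} ∧
    P {ω | 0 ≤ numBroken (Function.swap StrongLT) (fun i => X i ω) n} =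
      ∫⁻ u, ENNReal.ofReal ((1 - ∏ j, u j) ^ n) ∂cubeMeasure d := by
  have hA := measurableSet_sample_record d n
  have hm : Measurable fun ω => (X n ω, fun i : Fin n => X i ω) := by fun_prop
  have hset : {ω | 0 ≤ numBroken (Function.swap StrongLT) (fun i => X i ω) n} =
      (fun ω => (X n ω, fun i : Fin n => X i ω)) ⁻¹' {q | ∀ i, ¬ StrongLT (q.2 i) q.1} := by
    ext ω
    exact (numBroken_nonneg_iff _ _ _).trans (setsRecord_swap_iff (fun i => X i ω) n)
  rw [hset]
  refine ⟨hm hA, ?_⟩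
  rw [← Measure.map_apply hm hA, map_prodMk_sample hX hind hlaw, Measure.prod_apply hA]
  conv_lhs => rw [cubeMeasure]
  conv_rhs => rw [cubeMeasure]
  refine setLIntegral_congr_fun (measurableSet_cube d) fun u hu => ?_
  exact sampleMeasure_record_eq (fun j => (hu j trivial).1) fun j => (hu j trivial).2.le

/-- Records have positive probability at every `n`, so the conditional laws are probability measures
for all `n` and not only in the limit. `1 ≤ d` makes the product smaller than `1` on the cube. -/
theorem lintegral_record_ne_zero (hd : 1 ≤ d) (n : ℕ) :
    ∫⁻ u, ENNReal.ofReal ((1 - ∏ j, u j) ^ n) ∂cubeMeasure d ≠ 0 := by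
  have hm : Measurable fun u : Fin d → ℝ => ENNReal.ofReal ((1 - ∏ j, u j) ^ n) := by fun_prop
  rw [Ne, lintegral_eq_zero_iff hm, cubeMeasure]
  intro h
  have h1 := (ae_restrict_iff' (measurableSet_cube d)).1 h
  have h2 : volume (Set.univ.pi fun _ : Fin d => Set.Ioo (0 : ℝ) 1) = 0 := by
    refine measure_mono_null (fun u hu => ?_) (ae_iff.1 h1)
    simp only [Set.mem_ofPred_eq, Classical.not_imp, Pi.zero_apply]
    refine ⟨hu, ?_⟩
    have hlt : ∏ j, u j < 1 := by
      obtain ⟨e, rfl⟩ : ∃ e, d = e + 1 := ⟨d - 1, by omega⟩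
      rw [Fin.prod_univ_succ]
      refine mul_lt_one_of_nonneg_of_lt_one_left (hu 0 trivial).1.le (hu 0 trivial).2 ?_
      exact Finset.prod_le_one (fun j _ => (hu _ trivial).1.le) fun j _ => (hu _ trivial).2.le
    have : 0 < (1 - ∏ j, u j) ^ n := pow_pos (by linarith) n
    simpa using this
  simp [volume_pi_pi] at h2

/-- On `ℕ`, Fatou's lemma for counting measure bounds the limit mass of any set by the lower limit
of its masses; the portmanteau criterion on open sets then gives weak convergence. Tightness comes
for free because the limit has mass `1`. -/
theorem tendsto_probabilityMeasure_nat {μ : ℕ → ProbabilityMeasure ℕ} {κ : ProbabilityMeasure ℕ}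
    (h : ∀ k, Tendsto (fun n => (μ n : Measure ℕ) {k}) atTop (𝓝 ((κ : Measure ℕ) {k}))) :
    Tendsto μ atTop (𝓝 κ) := by
  refine tendsto_of_forall_isOpen_le_liminf' fun G _ => ?_
  have hG : MeasurableSet G := MeasurableSet.of_discrete
  simp_rw [← Measure.tsum_indicator_apply_singleton _ G hG, ← lintegral_count]
  have hlim : ∀ k, G.indicator (fun k => (κ : Measure ℕ) {k}) k =
      liminf (fun n => G.indicator (fun k => (μ n : Measure ℕ) {k}) k) atTop := by
    intro k
    by_cases hk : k ∈ G
    · simp only [Set.indicator_of_mem hk]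
      exact (h k).liminf_eq.symm
    · simp [hk]
  simp_rw [hlim]
  exact lintegral_liminf_le fun n => measurable_of_countable _

/-- Convergence of the number of broken records, for record-small values of uniform points. -/
theorem condTendsto_numBroken_cube (hd : 1 ≤ d) (hX : ∀ i, Measurable (X i)) (hind : iIndepFun X P)
    (hlaw : ∀ i, P.map (X i) = cubeMeasure d) {L : Kernel ℝ ℕ} [IsMarkovKernel L]
    (hL : ∀ w : ℝ, 0 < w → ∀ k, ∀ M : ℕ, 0 < M →
      |Real.exp (-w) * (L w).real {k} - gridLimit d M k w| ≤ gridError d M w)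
    (κ : ProbabilityMeasure ℕ) (hκ : (κ : Measure ℕ) = (expMeasure 1).bind L) :
    CondTendstoInDistribution P
      (fun n ω => numBroken (Function.swap StrongLT) (fun i => X i ω) n) κ := by
  set K : ℕ → Ω → ℤ := fun n ω => numBroken (Function.swap StrongLT) (fun i => X i ω) n with hK
  have hKm : ∀ n, Measurable fun ω => (K n ω).toNat := by
    intro n
    refine measurable_to_countable' fun k => ?_
    have h0 := (measure_numBroken_nonneg hX hind hlaw n).1
    have hk := (measure_numBroken hX hind hlaw n k).1
    -- `Int.toNat` sends the value `-1` to `0`, so the fibre over `0` also contains the event that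
    -- no record is set. Conditioning on a record removes it below.
    rcases k with _ | k
    · have : (fun ω => (K n ω).toNat) ⁻¹' {0} =
          {ω | 0 ≤ numBroken (Function.swap StrongLT) (fun i => X i ω) n}ᶜ ∪
          {ω | numBroken (Function.swap StrongLT) (fun i => X i ω) n = (0 : ℕ)} := by
        ext ω
        simp only [Set.mem_preimage, Set.mem_singleton_iff, Set.mem_union, Set.mem_compl_iff,
          Set.mem_ofPred_eq, hK]
        omega
      rw [this]
      exact h0.compl.union hk
    · convert hk using 1
      ext ω
      simp only [Set.mem_preimage, Set.mem_singleton_iff, Set.mem_ofPred_eq, hK]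
      omega
  have hpos : ∀ n, P {ω | 0 ≤ K n ω} ≠ 0 := fun n => by
    rw [(measure_numBroken_nonneg hX hind hlaw n).2]
    exact lintegral_record_ne_zero hd n
  have hcond : ∀ n, IsProbabilityMeasure (cond P {ω | 0 ≤ K n ω}) := fun n =>
    cond_isProbabilityMeasure (hpos n)
  have hmap : ∀ n, IsProbabilityMeasure
      ((cond P {ω | 0 ≤ K n ω}).map fun ω => (K n ω).toNat) := fun n =>
    Measure.isProbabilityMeasure_map (hKm n).aemeasurable
  refine ⟨fun n => ⟨(cond P {ω | 0 ≤ K n ω}).map fun ω => (K n ω).toNat, hmap n⟩, fun n => ?_, ?_⟩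
  · simp only [ProbabilityMeasure.coe_mk]
    rw [Measure.map_map measurable_from_nat (hKm n)]
    refine Measure.map_congr ?_
    have := ae_cond_mem (μ := P) (measure_numBroken_nonneg hX hind hlaw n).1
    filter_upwards [this] with ω hω
    exact (Int.toNat_of_nonneg hω).symm
  · refine tendsto_probabilityMeasure_nat fun k => ?_
    obtain ⟨m, rfl⟩ : ∃ m, d = m + 1 := ⟨d - 1, by omega⟩
    have hval : ∀ n, ((cond P {ω | 0 ≤ K n ω}).map fun ω => (K n ω).toNat) {k} =
        (∫⁻ u, ENNReal.ofReal (brokenProb (m + 1) n k u) ∂cubeMeasure (m + 1)) /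
        ∫⁻ u, ENNReal.ofReal ((1 - ∏ j, u j) ^ n) ∂cubeMeasure (m + 1) := by
      intro n
      rw [Measure.map_apply (hKm n) (measurableSet_singleton k),
        cond_apply (measure_numBroken_nonneg hX hind hlaw n).1,
        (measure_numBroken_nonneg hX hind hlaw n).2, ← (measure_numBroken hX hind hlaw n k).2,
        mul_comm, ← div_eq_mul_inv]
      congr 2
      ext ω
      simp only [Set.mem_inter_iff, Set.mem_preimage, Set.mem_singleton_iff, Set.mem_ofPred_eq, hK]
      omega
    simp only [ProbabilityMeasure.coe_mk, hval, hκ]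
    -- Numerator and denominator both carry the factor `cubeRate m n`, which cancels in the
    -- quotient.
    have h1 := ENNReal.Tendsto.div (tendsto_lintegral_brokenProb hL k)
      (Or.inr one_ne_zero) (tendsto_lintegral_record m) (Or.inl ENNReal.one_ne_top)
    rw [div_one] at h1
    refine h1.congr' ?_
    filter_upwards [eventually_ge_atTop 2] with n hn
    have hrate : 0 < cubeRate m n := by
      have hl : 0 < Real.log n := Real.log_pos (by exact_mod_cast hn)
      unfold cubeRate
      positivity
    exact ENNReal.mul_div_mul_left _ _ (ENNReal.ofReal_pos.2 hrate).ne' ENNReal.ofReal_ne_top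

end Law

/-! ### From exponential to uniform coordinates -/

/-- The map `z ↦ exp (-z)`, coordinate by coordinate. -/
def expNeg {d : ℕ} (z : Fin d → ℝ) (j : Fin d) : ℝ := Real.exp (-z j)

theorem measurable_expNeg {d : ℕ} : Measurable (expNeg (d := d)) :=
  measurable_pi_lambda _ fun j =>
    (Real.measurable_exp.comp measurable_neg).comp (measurable_pi_apply j)

theorem strongLT_expNeg_iff {d : ℕ} {y z : Fin d → ℝ} :
    StrongLT (expNeg y) (expNeg z) ↔ StrongLT z y := by
  simp [StrongLT, expNeg]

theorem expNeg_injective {d : ℕ} : Function.Injective (expNeg (d := d)) := fun y z h => by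
  ext j
  have := congrFun h j
  simpa [expNeg] using this

/-- Injectivity preserves counts: distinct points stay distinct, so the number of image points in
`B` is the number of points in `f ⁻¹' B`. -/
theorem IsPoissonProcess.image {E F Ω : Type*} [MeasurableSpace E] [MeasurableSpace F]
    [MeasurableSpace Ω] {N : Ω → Set E} {ν : Measure E} {P : Measure Ω}
    (h : IsPoissonProcess N ν P) {f : E → F} (hf : Measurable f) (hinj : Function.Injective f)
    {ν' : Measure F} (hν : ν.map f = ν') : IsPoissonProcess (fun ω => f '' N ω) ν' P := by
  have hcount : ∀ (B : Set F) ω, (f '' N ω ∩ B).encard = (N ω ∩ f ⁻¹' B).encard := fun B ω => by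
    rw [← Set.image_inter_preimage, hinj.encard_image]
  have happ : ∀ B, MeasurableSet B → ν' B = ν (f ⁻¹' B) := fun B hB => by
    rw [← hν, Measure.map_apply hf hB]
  refine ⟨fun B hB => ?_, fun B hB hfin => ?_, fun m B hB hfin hdis => ?_⟩
  · simp_rw [hcount]
    exact h.measurable_count _ (hf hB)
  · simp_rw [hcount]
    rw [happ B hB] at hfin ⊢
    exact h.law_count _ (hf hB) hfin
  · simp_rw [hcount]
    refine h.indep_count m _ (fun i => hf (hB i)) (fun i => ?_) fun i j hij =>
      (hdis hij).preimage f
    rw [← happ _ (hB i)]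
    exact hfin i

theorem numMaximaBelow_expNeg_image {d : ℕ} (S : Set (Fin d → ℝ)) (x : Fin d → ℝ) :
    numMaximaBelow (Function.swap StrongLT) (expNeg '' S) (expNeg x) =
      numMaximaBelow StrongLT S x := by
  rw [numMaximaBelow, numMaximaBelow,
    ← expNeg_injective.encard_image {z | z ∈ S ∧ IsMaximum StrongLT S z ∧ StrongLT z x}]
  congr 1
  ext y
  constructor
  · rintro ⟨⟨z, hz, rfl⟩, h1, h2⟩
    exact ⟨z, ⟨hz, fun y hy hzy => h1 _ ⟨y, hy, rfl⟩ (strongLT_expNeg_iff.2 hzy),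
      strongLT_expNeg_iff.1 h2⟩, rfl⟩
  · rintro ⟨z, ⟨hz, h1, h2⟩, rfl⟩
    refine ⟨⟨z, hz, rfl⟩, ?_, strongLT_expNeg_iff.2 h2⟩
    rintro _ ⟨y, hy, rfl⟩ hzy
    exact h1 y hy (strongLT_expNeg_iff.1 hzy)

/-- The density `exp (-z)` is exactly the absolute derivative of `z ↦ exp (-z)`, whose range is `(0,
∞)`. The uniform, Gumbel and intensity transformations below all rest on this change of variables.
-/
theorem map_exp_neg_withDensity :
    ((volume : Measure ℝ).withDensity fun z => ENNReal.ofReal (Real.exp (-z))).map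
      (fun z => Real.exp (-z)) = volume.restrict (Set.Ioi 0) := by
  ext B hB
  have hm : Measurable fun z : ℝ => Real.exp (-z) := by fun_prop
  rw [Measure.map_apply hm hB, withDensity_apply _ (hm hB), Measure.restrict_apply hB]
  have h := lintegral_image_eq_lintegral_abs_deriv_mul (hm hB)
    (f := fun z => Real.exp (-z)) (f' := fun z => -Real.exp (-z))
    (fun z _ => by simpa using ((hasDerivAt_neg z).exp).hasDerivWithinAt)
    (fun y _ z _ hyz => by simpa using hyz) fun _ => 1
  simp only [abs_neg, Real.abs_exp, mul_one] at h
  rw [← h, Set.image_preimage_eq_inter_range]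
  have : Set.range (fun z : ℝ => Real.exp (-z)) = Set.Ioi 0 := by
    ext w
    constructor
    · rintro ⟨z, rfl⟩
      exact Real.exp_pos _
    · intro hw
      exact ⟨-Real.log w, by simp [Real.exp_log hw]⟩
  rw [this]
  simp

theorem map_exp_neg_expMeasure :
    (expMeasure 1).map (fun z => Real.exp (-z)) = volume.restrict (Set.Ioo 0 1) := by
  have hm : Measurable fun z : ℝ => Real.exp (-z) := by fun_prop
  have hpre : (fun z : ℝ => Real.exp (-z)) ⁻¹' Set.Iio 1 = Set.Ioi 0 := by
    ext z
    simp
  rw [expMeasure_one_eq, ← restrict_withDensity measurableSet_Ioi, ← hpre,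
    ← Measure.restrict_map hm measurableSet_Iio, map_exp_neg_withDensity,
    Measure.restrict_restrict measurableSet_Iio, Set.inter_comm, Set.Ioi_inter_Iio]

theorem map_expNeg_pi_expMeasure (d : ℕ) :
    (Measure.pi fun _ : Fin d => expMeasure 1).map expNeg = cubeMeasure d := by
  have hm : Measurable fun z : ℝ => Real.exp (-z) := by fun_prop
  have hprob : IsProbabilityMeasure (expMeasure 1) := isProbabilityMeasure_expMeasure one_pos
  have hσ : SigmaFinite ((expMeasure 1).map fun z => Real.exp (-z)) := by
    rw [map_exp_neg_expMeasure]; infer_instance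
  rw [cubeMeasure_eq_pi, ← map_exp_neg_expMeasure]
  exact Measure.pi_map_pi (f := fun (_ : Fin d) z => Real.exp (-z)) fun _ => hm.aemeasurable

/-- The factor `exp (-g)` of the Gumbel density is the Jacobian of `w = exp (-g)`, and the remaining
factor is `exp (-w)`. -/
theorem map_exp_neg_gumbelMeasure :
    gumbelMeasure.map (fun g => Real.exp (-g)) = expMeasure 1 := by
  have hm : Measurable fun z : ℝ => Real.exp (-z) := by fun_prop
  ext B hB
  have hi : Measurable fun z : ℝ =>
      B.indicator (fun w => ENNReal.ofReal (Real.exp (-w))) (Real.exp (-z)) :=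
    (Measurable.indicator (by fun_prop) hB).comp hm
  rw [expMeasure_one_eq, ← map_exp_neg_withDensity, withDensity_apply _ hB,
    Measure.map_apply hm hB, ← lintegral_indicator hB,
    lintegral_map (Measurable.indicator (by fun_prop) hB) hm,
    lintegral_withDensity_eq_lintegral_mul _ (by fun_prop) hi, gumbelMeasure,
    withDensity_apply _ (hm hB), ← lintegral_indicator (hm hB)]
  refine lintegral_congr fun z => ?_
  simp only [Pi.mul_apply]
  by_cases hz : Real.exp (-z) ∈ B
  · rw [Set.indicator_of_mem hz, Set.indicator_of_mem (show z ∈ (fun z => Real.exp (-z)) ⁻¹' B from hz),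
      ENNReal.ofReal_mul (Real.exp_pos _).le]
  · rw [Set.indicator_of_notMem hz, Set.indicator_of_notMem (show z ∉ (fun z => Real.exp (-z)) ⁻¹' B from hz), mul_zero]

theorem lintegral_pi_prod {d : ℕ} (μ : Fin d → Measure ℝ) [∀ j, SigmaFinite (μ j)]
    {f : ℝ → ℝ≥0∞} (hf : Measurable f) :
    ∫⁻ z, ∏ j, f (z j) ∂Measure.pi μ = ∏ j, ∫⁻ z, f z ∂μ j := by
  induction d with
  | zero => simp
  | succ d ih =>
    have hm : Measurable fun q : ℝ × (Fin d → ℝ) => f q.1 * ∏ j, f (q.2 j) := by fun_prop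
    have h := (measurePreserving_piFinSuccAbove μ 0).lintegral_comp hm
    have hg : Measurable fun v : Fin d → ℝ => ∏ j, f (v j) := by fun_prop
    have h2 := lintegral_prod_mul (μ := μ 0) (ν := Measure.pi fun j => μ (Fin.succAbove 0 j))
      (g := fun v : Fin d → ℝ => ∏ j, f (v j)) hf.aemeasurable hg.aemeasurable
    rw [ih fun j => μ (Fin.succAbove 0 j)] at h2
    simp_rw [Fin.prod_univ_succ]
    exact h.trans h2

theorem pi_withDensity_volume {d : ℕ} {f : ℝ → ℝ≥0∞} (hf : Measurable f)
    [SigmaFinite ((volume : Measure ℝ).withDensity f)] :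
    (Measure.pi fun _ : Fin d => (volume : Measure ℝ).withDensity f) =
      volume.withDensity fun z => ∏ j, f (z j) := by
  refine Measure.pi_eq fun s hs => ?_
  rw [withDensity_apply _ (MeasurableSet.univ_pi hs), volume_pi, Measure.restrict_pi_pi,
    lintegral_pi_prod _ hf]
  exact Finset.prod_congr rfl fun j _ => (withDensity_apply _ (hs j)).symm

/-- The density factors over the coordinates, so the one-dimensional change of variables gives
Lebesgue measure on the orthant. The restriction to points not dominating `x` becomes the
restriction to points not dominated by `expNeg x`. -/
theorem map_expNeg_expIntensity {d : ℕ} (x : Fin d → ℝ) :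
    (expIntensity x).map expNeg = unitIntensity (expNeg x) := by
  have hm : Measurable fun z : ℝ => Real.exp (-z) := by fun_prop
  have hσ : SigmaFinite
      ((volume : Measure ℝ).withDensity fun z => ENNReal.ofReal (Real.exp (-z))) := by
    infer_instance
  have hσ' : SigmaFinite (((volume : Measure ℝ).withDensity
      fun z => ENNReal.ofReal (Real.exp (-z))).map fun z => Real.exp (-z)) := by
    rw [map_exp_neg_withDensity]; infer_instance
  have hS : MeasurableSet {z : Fin d → ℝ | ¬ StrongLT z (expNeg x)} :=
    (measurableSet_strongLT measurable_id measurable_const).compl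
  have hpre : {z : Fin d → ℝ | ¬ StrongLT x z} =
      expNeg ⁻¹' {z | ¬ StrongLT z (expNeg x)} := by
    ext z
    simp [strongLT_expNeg_iff]
  have hdens : (fun z : Fin d → ℝ => ENNReal.ofReal (Real.exp (-∑ j, z j))) =
      fun z => ∏ j, ENNReal.ofReal (Real.exp (-z j)) := by
    ext z
    rw [← ENNReal.ofReal_prod_of_nonneg fun _ _ => (Real.exp_pos _).le, ← Real.exp_sum,
      Finset.sum_neg_distrib]
  rw [expIntensity, hpre, withDensity_indicator (measurable_expNeg hS),
    ← restrict_withDensity (measurable_expNeg hS), hdens,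
    ← pi_withDensity_volume (f := fun z => ENNReal.ofReal (Real.exp (-z))) (by fun_prop),
    ← Measure.restrict_map measurable_expNeg hS, unitIntensity]
  have hmap : (Measure.pi fun _ : Fin d =>
      (volume : Measure ℝ).withDensity fun z => ENNReal.ofReal (Real.exp (-z))).map expNeg =
      volume.restrict {z : Fin d → ℝ | ∀ j, 0 < z j} := by
    have h1 := Measure.pi_map_pi (f := fun (_ : Fin d) z => Real.exp (-z))
      (μ := fun _ => (volume : Measure ℝ).withDensity fun z => ENNReal.ofReal (Real.exp (-z)))
      fun _ => hm.aemeasurable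
    rw [map_exp_neg_withDensity, ← Measure.restrict_pi_pi, ← volume_pi] at h1
    refine h1.trans ?_
    congr 1
    ext z
    simp [Set.mem_pi]
  rw [hmap, Measure.restrict_restrict hS]
  congr 1
  ext z
  simp only [Set.mem_inter_iff, Set.mem_ofPred_eq, and_comm]

/-- Every process with the exponential intensity is pushed forward to a homogeneous one with the
same count, which fixes the law. Existence is obtained directly, because `expIntensity x` is
s-finite and has no atoms. -/
theorem IsMaximaLaw.expIntensity {d : ℕ} (hd : 1 ≤ d) {x : Fin d → ℝ} {q : Measure ℕ}
    (h : IsMaximaLaw (Function.swap StrongLT) (unitIntensity (expNeg x)) (expNeg x) q) :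
    IsMaximaLaw StrongLT (expIntensity x) x q := by
  constructor
  · have : Nonempty (Fin d) := ⟨⟨0, hd⟩⟩
    have : SFinite (ParetoRecords.expIntensity x) := by
      unfold ParetoRecords.expIntensity; infer_instance
    exact exists_isPoissonProcess (ParetoRecords.expIntensity x) fun z =>
      withDensity_absolutelyContinuous _ _ (measure_singleton z)
  · intro Ω mΩ P N hP hN
    have := h.2 Ω mΩ P _ hP
      (hN.image measurable_expNeg expNeg_injective (map_expNeg_expIntensity x))
    simpa only [numMaximaBelow_expNeg_image] using this

theorem gumbelMeasure_bind_comap (L : Kernel ℝ ℕ) {e : ℝ → ℝ} (he : e = fun g => Real.exp (-g))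
    (hm : Measurable e) : gumbelMeasure.bind (L.comap e hm) = (expMeasure 1).bind L := by
  subst he
  ext s hs
  rw [Measure.bind_apply hs (Kernel.measurable _).aemeasurable,
    Measure.bind_apply hs L.measurable.aemeasurable, ← map_exp_neg_gumbelMeasure,
    lintegral_map (L.measurable_coe hs) hm]
  rfl

end ParetoRecords

end

/-! ### Assembly of the two descriptions and the two convergence statements -/

theorem theorem1p1 (d : ℕ) (hd : 1 ≤ d) :
    ∃ κ : ProbabilityMeasure ℕ,
      -- `κ` is the mixture, over a standard Gumbel `g`, of the laws of `𝒦_g`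
      (∃ L : Kernel ℝ ℕ, IsMarkovKernel L ∧
        (∀ g : ℝ, ParetoRecords.IsMaximaLaw StrongLT
          (ParetoRecords.expIntensity fun _ : Fin d => g / d) (fun _ => g / d) (L g)) ∧
        (κ : Measure ℕ) = ParetoRecords.gumbelMeasure.bind L) ∧
      -- `κ` is the mixture, over an Exponential(1) `w`, of the laws of `𝒦'_w`
      (∃ L' : Kernel ℝ ℕ, IsMarkovKernel L' ∧
        (∀ w : ℝ, 0 < w → ParetoRecords.IsMaximaLaw (Function.swap StrongLT)
          (ParetoRecords.unitIntensity fun _ : Fin d => w ^ (1 / (d : ℝ)))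
          (fun _ => w ^ (1 / (d : ℝ))) (L' w)) ∧
        (κ : Measure ℕ) = (expMeasure 1).bind L') ∧
      -- exponential observations, record-large values
      (∀ (Ω : Type*) (_ : MeasurableSpace Ω) (P : Measure Ω) (X : ℕ → Ω → Fin d → ℝ),
        IsProbabilityMeasure P → (∀ i, Measurable (X i)) → iIndepFun X P →
        (∀ i, P.map (X i) = Measure.pi fun _ => expMeasure 1) →
        ParetoRecords.CondTendstoInDistribution P
          (fun n ω => ParetoRecords.numBroken StrongLT (fun i => X i ω) n) κ) ∧
      -- uniform observations, record-small values
      (∀ (Ω : Type*) (_ : MeasurableSpace Ω) (P : Measure Ω) (X : ℕ → Ω → Fin d → ℝ),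
        IsProbabilityMeasure P → (∀ i, Measurable (X i)) → iIndepFun X P →
        (∀ i, P.map (X i) = volume.restrict (Set.univ.pi fun _ => Set.Ioo 0 1)) →
        ParetoRecords.CondTendstoInDistribution P
          (fun n ω => ParetoRecords.numBroken (Function.swap StrongLT) (fun i => X i ω) n) κ) := by
  obtain ⟨L, hL, hlaw, happrox⟩ := ParetoRecords.exists_kernel_isMaximaLaw hd
  have hprob : IsProbabilityMeasure (expMeasure 1) := isProbabilityMeasure_expMeasure one_pos
  have he : Measurable fun g : ℝ => Real.exp (-g) := by fun_prop
  refine ⟨⟨(expMeasure 1).bind L, inferInstance⟩, ⟨L.comap _ he, inferInstance, fun g => ?_, ?_⟩,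
    ⟨L, hL, hlaw, rfl⟩, ?_, ?_⟩
  · have h := hlaw (Real.exp (-g)) (Real.exp_pos _)
    -- With `w = exp (-g)`, the point `x' (w)` is the image of `x (g)` under `expNeg`.
    have hx : (fun _ : Fin d => Real.exp (-g) ^ (1 / (d : ℝ))) =
        ParetoRecords.expNeg fun _ => g / d := by
      ext j
      rw [← Real.exp_mul, ParetoRecords.expNeg]
      congr 1
      ring
    rw [hx] at h
    exact h.expIntensity hd
  · exact (ParetoRecords.gumbelMeasure_bind_comap L rfl he).symm
  · intro Ω _ P X _ hX hind hX1
    have h := ParetoRecords.condTendsto_numBroken_cube hd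
      (X := fun i ω => ParetoRecords.expNeg (X i ω))
      (fun i => ParetoRecords.measurable_expNeg.comp (hX i))
      (hind.comp (fun _ => ParetoRecords.expNeg) fun _ => ParetoRecords.measurable_expNeg)
      (fun i => by
        rw [← ParetoRecords.map_expNeg_pi_expMeasure, ← hX1 i,
          Measure.map_map ParetoRecords.measurable_expNeg (hX i)]
        rfl) happrox ⟨(expMeasure 1).bind L, inferInstance⟩ rfl
    have hnum : (fun n ω => ParetoRecords.numBroken StrongLT (fun i => X i ω) n) =
        fun n ω => ParetoRecords.numBroken (Function.swap StrongLT)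
          (fun i => ParetoRecords.expNeg (X i ω)) n := by
      ext n ω
      exact ParetoRecords.numBroken_congr (r' := Function.swap StrongLT)
        (Y := fun i => ParetoRecords.expNeg (X i ω)) (fun i j => ParetoRecords.strongLT_expNeg_iff.symm) n
    rw [hnum]
    exact h
  · intro Ω _ P X _ hX hind hX1
    exact ParetoRecords.condTendsto_numBroken_cube hd hX hind hX1 happrox _ rfl
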